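/- **Conventions.** Let $d\in\mathbb N$, $\langle z\rangle=\sqrt{1+|z|^2}$ for $z=(x,\xi)\in\mathbb R^{2d}$, $D_{x_k}=-i\,\partial/\partial x_k$, $D_{\xi_k}=-i\,\partial/\partial \xi_k$, and $D_x\cdot D_\xi=\sum_{k=1}^d D_{x_k}D_{\xi_k}$. For $m\in\mathbb R$, $G_h^m$ is the set of families $a=a(z;h)$, $z\in\mathbb R^{2d}$, $h\in(0,1]$, which are $C^\infty$ in $z$ for each $h$ and such that for every $\alpha\in\mathbb N^{2d}$ there is $C_\alpha>0$ with $$|\partial_z^\alpha a(z;h)|\le C_\alpha\, h^{|\alpha|}\langle hz\rangle^{m-|\alpha|},\qquad z\in\mathbb R^{2d},\ h\in(0,1].$$ Put $(a)_{h^{-1}}(z)=a(h^{-1}z;h)$. For $t\in\mathbb R$ and a symbol $a=a(\cdot\,;h)$ with $h$ fixed, the $t$-quantization acts on $u\in\mathscr S(\mathbb R^d)$ by $$a^t(x,D)u(x)=\lim_{\varepsilon\to0+}(2\pi)^{-d}\int_{\mathbb R^{2d}}\psi(\varepsilon\xi)\,e^{i(x-y)\cdot\xi}\,a(tx+(1-t)y,\xi)\,u(y)\,dy\,d\xi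 ,$$ where $\psi\in C_c^\infty(\mathbb R^d)$ is any function equal to $1$ near the origin. $a(x,D)=a^1(x,D)$ is the Kohn–Nirenberg quantization and $a^w(x,D)=a^{1/2}(x,D)$ is the Weyl quantization. For $b\in\mathscr S'(\mathbb R^{2d})$ the operator $b^w(x,D)$ is defined by $$(b^w(x,D)f,g)=(2\pi)^{-d}(b,W(g,f)),\quad f,g\in\mathscr S(\mathbb R^d),\qquad W(f,g)(x,\xi)=\int_{\mathbb R^d} f(x+y/2)\,\overline{g(x-y/2)}\,e^{-iy\cdot\xi}\,dy,$$ where $(\cdot,\cdot)$ is conjugate linear in the second argument. **Theorem.** Let $m\in\mathbb R$ and $a\in G_h^m$. For each $h\in(0,1]$ there is a unique $b(\cdot\,;h)\in\mathscr S'(\mathbb R^{2d})$ with $b(\cdot\,;h)^w(x,D)=a(\cdot\,;h)(x,D)$. This $b(\cdot\,;h)$ is a function, its Weyl quantization in the sense of the limit above also equals $a(\cdot\,;h)(x,D)$, and $b\in G_h^m$. Moreover $$b(x,\xi;h)\sim\sum_{j=0}^\infty h^{2j}a_j(x,\xi;h),\qquad a_j(x,\xi;h)=\frac{\left(-\frac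 i2 D_x\cdot D_\xi\right)^j}{j!}(a)_{h^{-1}}\Big|_{(hx,h\xi)},$$ in the sense that $a_j\in G_h^{m-2j}$ for all $j\ge0$ and, for every $N\ge1$, $$b-\sum_{j=0}^{N-1}h^{2j}a_j\in h^{2N}G_h^{m-2N},$$ that is, for every $\alpha\in\mathbb N^{2d}$ there is $C_{N,\alpha}>0$ with $$\Big|\partial_z^\alpha\Big(b-\sum_{j=0}^{N-1}h^{2j}a_j\Big)(z;h)\Big|\le C_{N,\alpha}\,h^{2N+|\alpha|}\langle hz\rangle^{m-2N-|\alpha|},\qquad z\in\mathbb R^{2d},\ h\in(0,1].$$ -/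

import Mathlib

open Filter Topology MeasureTheory Complex
open scoped ContDiff SchwartzMap RealInnerProductSpace ComplexConjugate Nat

noncomputable section

/-- The configuration space `ℝ^d` with its Euclidean norm. -/
abbrev ConfigSpace (d : ℕ) : Type := EuclideanSpace ℝ (Fin d)

/-- Phase space `ℝ^{2d}`, with points `z = (x, ξ)`. -/
abbrev PhaseSpace (d : ℕ) : Type := ConfigSpace d × ConfigSpace d

/-- The Japanese bracket `⟨z⟩ = (1 + |x|² + |ξ|²)^{1/2}` of `z = (x, ξ) ∈ ℝ^{2d}`.
It is written out because the product type carries the maximum norm. -/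
def japaneseBracket {d : ℕ} (z : PhaseSpace d) : ℝ :=
  Real.sqrt (1 + ‖z.1‖ ^ 2 + ‖z.2‖ ^ 2)

/-- `a ∈ G_h^m`: the family `a h = a(·; h)`, `0 < h ≤ 1`, is an `h`-Shubin symbol of order `m`.
The estimate of all partial derivatives of order `k` is expressed through the `k`-th Fréchet
derivative. Only the values of `a` at `h ∈ (0, 1]` matter. -/
structure IsHShubin {d : ℕ} (m : ℝ) (a : ℝ → PhaseSpace d → ℂ) : Prop where
  smooth : ∀ h ∈ Set.Ioc (0 : ℝ) 1, ContDiff ℝ ∞ (a h)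
  bound : ∀ k : ℕ, ∃ C : ℝ, ∀ h ∈ Set.Ioc (0 : ℝ) 1, ∀ z : PhaseSpace d,
    ‖iteratedFDeriv ℝ k (a h) z‖ ≤ C * h ^ k * japaneseBracket (h • z) ^ (m - k)

/-- `c ∈ h^r G_h^m`. -/
def IsHPowShubin {d : ℕ} (r m : ℝ) (c : ℝ → PhaseSpace d → ℂ) : Prop :=
  ∃ g : ℝ → PhaseSpace d → ℂ, IsHShubin m g ∧
    ∀ h ∈ Set.Ioc (0 : ℝ) 1, ∀ z, c h z = ((h ^ r : ℝ) : ℂ) * g h z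

/-- `μ̃_j = max_{k ≥ j} μ_k` (the maximum exists when `μ_k → -∞`). -/
def tailMax (μ : ℕ → ℝ) (j : ℕ) : ℝ := ⨆ k : ℕ, μ (j + k)

/-- The asymptotic expansion `b ∼ ∑_j h^{μ̃_0 - μ_j} a_j`, where `a_j ∈ G_h^{μ_j}` and
`μ_j → -∞`. -/
structure HasHAsymptoticExpansion {d : ℕ} (b : ℝ → PhaseSpace d → ℂ) (μ : ℕ → ℝ)
    (a : ℕ → ℝ → PhaseSpace d → ℂ) : Prop where
  tendsto_order : Tendsto μ atTop atBot
  mem : ∀ j, IsHShubin (μ j) (a j)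
  smooth : ∀ h ∈ Set.Ioc (0 : ℝ) 1, ContDiff ℝ ∞ (b h)
  remainder : ∀ N : ℕ, 1 ≤ N →
    IsHPowShubin (tailMax μ 0 - tailMax μ N) (tailMax μ N) (fun h z =>
      b h z - ∑ j ∈ Finset.range N, ((h ^ (tailMax μ 0 - μ j) : ℝ) : ℂ) * a j h z)

/-- For `μ_j = m - 2j` one has `μ̃_j = m - 2j`. In particular `μ̃_0 - μ_j = 2j`. -/
theorem tailMax_sub_two_mul (m : ℝ) (j : ℕ) :
    tailMax (fun i : ℕ => m - 2 * (i : ℝ)) j = m - 2 * (j : ℝ) := by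
  unfold tailMax
  apply le_antisymm
  · refine ciSup_le fun k => ?_
    push_cast
    have : (0 : ℝ) ≤ k := Nat.cast_nonneg k
    linarith
  · have hb : BddAbove (Set.range fun k : ℕ => m - 2 * (((j + k : ℕ)) : ℝ)) := by
      refine ⟨m, ?_⟩
      rintro _ ⟨k, rfl⟩
      have : (0 : ℝ) ≤ ((j + k : ℕ) : ℝ) := Nat.cast_nonneg _
      simp only
      linarith
    simpa using le_ciSup hb 0

/-- `D_{x_k} = -i ∂/∂x_k`. -/
def dX {d : ℕ} (k : Fin d) (f : PhaseSpace d → ℂ) : PhaseSpace d → ℂ :=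
  fun z => -I * fderiv ℝ f z (EuclideanSpace.single k 1, 0)

/-- `D_{ξ_k} = -i ∂/∂ξ_k`. -/
def dXi {d : ℕ} (k : Fin d) (f : PhaseSpace d → ℂ) : PhaseSpace d → ℂ :=
  fun z => -I * fderiv ℝ f z (0, EuclideanSpace.single k 1)

/-- `-(i/2) D_x · D_ξ = -(i/2) ∑_k D_{x_k} D_{ξ_k}`. -/
def halfDxDxi {d : ℕ} (f : PhaseSpace d → ℂ) : PhaseSpace d → ℂ :=
  fun z => -(I / 2) * ∑ k : Fin d, dX k (dXi k f) z

/-- The `j`-th symbol of the expansion: `(-(i/2) D_x · D_ξ)^j / j!` applied to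
`a_{h⁻¹} : w ↦ a(h⁻¹ w; h)`, evaluated at `(hx, hξ)`. -/
def knWeylTerm {d : ℕ} (a : ℝ → PhaseSpace d → ℂ) (j : ℕ) : ℝ → PhaseSpace d → ℂ :=
  fun h z => (halfDxDxi^[j] (fun w => a h (h⁻¹ • w))) (h • z) / (j ! : ℂ)

/-- The regularized integral
`∫∫ ψ(ε ξ) e^{i (x - y) · ξ} a(t x + (1 - t) y, ξ) u(y) dy (2π)^{-d} dξ`. -/
def regQuantization {d : ℕ} (ψ : ConfigSpace d → ℂ) (ε t : ℝ) (a : PhaseSpace d → ℂ)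
    (u : 𝓢(ConfigSpace d, ℂ)) (x : ConfigSpace d) : ℂ :=
  ((2 * Real.pi : ℝ) : ℂ)⁻¹ ^ d * ∫ p : ConfigSpace d × ConfigSpace d,
    ψ (ε • p.2) * cexp (I * (⟪x - p.1, p.2⟫ : ℝ)) * a (t • x + (1 - t) • p.1, p.2) * u p.1

/-- `A = a^t(x, D)` on `𝓢(ℝ^d)`: for every cutoff `ψ ∈ C_c^∞(ℝ^d)` equal to one near the origin,
the regularized integrals converge pointwise to `A u` as `ε → 0+`.
`t = 1` is the Kohn-Nirenberg quantization and `t = 1/2` is the Weyl quantization. -/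
def IsQuantization {d : ℕ} (t : ℝ) (a : PhaseSpace d → ℂ)
    (A : 𝓢(ConfigSpace d, ℂ) → ConfigSpace d → ℂ) : Prop :=
  ∀ ψ : ConfigSpace d → ℂ, ContDiff ℝ ∞ ψ → HasCompactSupport ψ → (∀ᶠ ξ in 𝓝 0, ψ ξ = 1) →
    ∀ (u : 𝓢(ConfigSpace d, ℂ)) (x : ConfigSpace d),
      Tendsto (fun ε : ℝ => regQuantization ψ ε t a u x) (𝓝[>] 0) (𝓝 (A u x))

/-- The Wigner distribution
`W(f, g)(x, ξ) = ∫ f(x + y/2) conj(g(x - y/2)) e^{-i y · ξ} dy`. -/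
def wigner {d : ℕ} (f g : 𝓢(ConfigSpace d, ℂ)) (z : PhaseSpace d) : ℂ :=
  ∫ y : ConfigSpace d, f (z.1 + (1 / 2 : ℝ) • y) * conj (g (z.1 - (1 / 2 : ℝ) • y)) *
    cexp (-I * (⟪y, z.2⟫ : ℝ))

/-- `T^w(x, D) = A` for a tempered distribution `T ∈ 𝓢'(ℝ^{2d})`:
`(A f, g) = (2π)^{-d} (T, W(g, f))` for all `f, g ∈ 𝓢(ℝ^d)`, where `(·, ·)` is conjugate linear in
the second argument, that is, `(T, W) = T (conj W)`. Here `Φ` is the Schwartz function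
`conj W(g, f)`. -/
def IsWeylSymbol {d : ℕ} (T : 𝓢'(PhaseSpace d, ℂ))
    (A : 𝓢(ConfigSpace d, ℂ) → ConfigSpace d → ℂ) : Prop :=
  ∀ f g : 𝓢(ConfigSpace d, ℂ), ∃ Φ : 𝓢(PhaseSpace d, ℂ),
    (∀ z, Φ z = conj (wigner g f z)) ∧
      ∫ x, A f x * conj (g x) = ((2 * Real.pi : ℝ) : ℂ)⁻¹ ^ d * T Φ

end

/-!
The Weyl symbol of the Kohn-Nirenberg operator `a(x, D)` is `b = exp((i/2) ∂_x · ∂_ξ) a`, and the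
expansion is the Taylor series of this exponential. For amplitudes the exponential is realized as
the oscillatory mean `oscMean 1 a`, where
`oscMean s f w = π^{-d} ∫ e^{2i y · η} f(w + s (y, η)) dy dη`. The oscillatory integral is made
absolutely convergent by powers of the operator `oscStep`, which lowers the order of an amplitude by
one and leaves such integrals unchanged (`integral_chirp_oscStep`). All estimates depend only on
the order and the constants of the amplitude.

*Symbol estimates and expansion.* With `α_h(w) = a(h⁻¹ w; h)` one has
`oscMean 1 (a h) z = oscMean h α_h (h z)`, and the `α_h` are symbols of order `m` with constants
independent of `h` (`IsHShubin.exists_isSymbol_rescale`). Under the oscillating integral a factor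
`y_k` becomes `(i/2) ∂_{η_k}`, and a factor `η_k` becomes `(i/2) ∂_{y_k}`. Hence
`∂_s oscMean s f = 2 s oscMean s (crossOp f)` with `crossOp = (i/2) ∂_x · ∂_ξ`
(`IsAmplitude.hasDerivAt_oscMean`). As `crossOp` lowers the order of symbols by two, `N`
integrations in `s` bound the Taylor remainder of order `N` by `s^{2N} (1 + ‖w‖)^{m - 2N}`
(`exists_norm_oscRemainder_le`). The derivatives of the remainder are the remainders of the
derivatives, so they obey the same estimate with the order lowered accordingly
(`exists_norm_iteratedFDeriv_oscRemainder_le`). The case `N = 0` says that `b ∈ G_h^m`.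

*Quantization.* Transposition gives `∫ (oscMean 1 a) Θ = ∫ a (chirpTransform Θ)` for Schwartz
functions `Θ` (`IsAmplitude.integral_oscMean_mul`), where `chirpTransform` is the convolution with
`π^{-d} e^{2i x · ξ}`. The regularized Weyl quantization of `b` pairs `b` with an explicit Schwartz
function, whose chirp transform is a product of an approximate identity in `x` and the kernel of
`a(x, D)` (`chirpTransform_weylTest`). The limit `ε → 0+` then yields
`IsAmplitude.isQuantization_half_oscMean`. In the same way `conj W(g, f)` is the inverse chirp
transform of `e^{i x · ξ} conj(g(x)) f̂(ξ)` (`chirpInverse_rihaczek`), so that the distribution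
given by `b` is a Weyl symbol of `a(x, D)`.

*Uniqueness.* The chirp transform is a bijection of the Schwartz space
(`chirpTransform_reflect_chirpTransform`), so a distribution with vanishing Weyl quantization
vanishes, after a bijective change of test functions, on all tensor products. Tensor products
separate tempered distributions (`eq_zero_of_schwartzTensor`): the distribution annihilates every
translate of a product bump, and by commutativity of convolution it also annihilates the mollified
test functions. Commutativity is tested in a Banach space of weighted derivatives through which the
distribution factors.
-/

noncomputable section

/-! ### Amplitudes -/

section Amplitude

theorem one_add_norm_pos {X : Type*} [NormedAddCommGroup X] (z : X) : 0 < 1 + ‖z‖ := by positivity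

theorem one_le_one_add_norm {X : Type*} [NormedAddCommGroup X] (z : X) : 1 ≤ 1 + ‖z‖ := by
  linarith [norm_nonneg z]

variable {X : Type*} [NormedAddCommGroup X] [NormedSpace ℝ X]
variable {E : Type*} [NormedAddCommGroup E] [NormedSpace ℝ E]

/-- `f` is an amplitude of order `M` with constants `C`: all derivatives of `f` grow at most like
`(1 + ‖z‖) ^ M`. No decay is gained by differentiating. -/
structure IsAmplitude (M : ℝ) (C : ℕ → ℝ) (f : X → E) : Prop where
  smooth : ContDiff ℝ ∞ f
  bound : ∀ k z, ‖iteratedFDeriv ℝ k f z‖ ≤ C k * (1 + ‖z‖) ^ M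

namespace IsAmplitude

theorem const_nonneg {M : ℝ} {C : ℕ → ℝ} {f : X → E} (hf : IsAmplitude M C f) (k : ℕ) :
    0 ≤ C k := by
  have h := (norm_nonneg _).trans (hf.bound k 0)
  simpa using h

theorem norm_le {M : ℝ} {C : ℕ → ℝ} {f : X → E} (hf : IsAmplitude M C f) (z : X) :
    ‖f z‖ ≤ C 0 * (1 + ‖z‖) ^ M := by
  simpa using hf.bound 0 z

theorem mono {M M' : ℝ} {C C' : ℕ → ℝ} {f : X → E} (hf : IsAmplitude M C f) (hM : M ≤ M')
    (hC : ∀ k, C k ≤ C' k) : IsAmplitude M' C' f where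
  smooth := hf.smooth
  bound k z := (hf.bound k z).trans <| by
    have := hf.const_nonneg k
    gcongr
    · exact this.trans (hC k)
    · exact hC k
    · exact one_le_one_add_norm z

theorem fderiv {M : ℝ} {C : ℕ → ℝ} {f : X → E} (hf : IsAmplitude M C f) :
    IsAmplitude M (fun k => C (k + 1)) (fderiv ℝ f) where
  smooth := hf.smooth.fderiv_right (by simp)
  bound k z := by rw [norm_iteratedFDeriv_fderiv]; exact hf.bound (k + 1) z

theorem clm_apply {F : Type*} [NormedAddCommGroup F] [NormedSpace ℝ F]
    {M : ℝ} {C : ℕ → ℝ} {f : X → F →L[ℝ] E} (hf : IsAmplitude M C f) (v : F) :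
    IsAmplitude M (fun k => ‖v‖ * C k) (fun z => f z v) where
  smooth := hf.smooth.clm_apply contDiff_const
  bound k z := by
    refine (norm_iteratedFDeriv_clm_apply_const (hf.smooth.contDiffAt (x := z))
      (mod_cast le_top)).trans ?_
    rw [mul_assoc]
    gcongr
    exact hf.bound k z

theorem add {M : ℝ} {C C' : ℕ → ℝ} {f g : X → E} (hf : IsAmplitude M C f)
    (hg : IsAmplitude M C' g) : IsAmplitude M (fun k => C k + C' k) (fun z => f z + g z) where
  smooth := hf.smooth.add hg.smooth
  bound k z := by
    have h := iteratedFDeriv_add_apply (i := k) (x := z) (𝕜 := ℝ) (f := f) (g := g)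
      ((hf.smooth.of_le (mod_cast le_top)).contDiffAt)
      ((hg.smooth.of_le (mod_cast le_top)).contDiffAt)
    change ‖iteratedFDeriv ℝ k (f + g) z‖ ≤ _
    rw [h, add_mul]
    exact (norm_add_le _ _).trans (add_le_add (hf.bound k z) (hg.bound k z))

theorem zero (M : ℝ) : IsAmplitude M (fun _ => 0) (fun _ : X => (0 : E)) where
  smooth := contDiff_const
  bound k z := by simp

theorem sum {ι : Type*} {M : ℝ} {C : ι → ℕ → ℝ} {f : ι → X → E} (s : Finset ι)
    (hf : ∀ i ∈ s, IsAmplitude M (C i) (f i)) :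
    IsAmplitude M (fun k => ∑ i ∈ s, C i k) (fun z => ∑ i ∈ s, f i z) := by
  classical
  induction s using Finset.induction_on with
  | empty => simpa using zero M
  | insert i s hi ih =>
    simp only [Finset.sum_insert hi]
    exact (hf i (by simp)).add (ih fun j hj => hf j (by simp [hj]))

/-- The Leibniz constants of a product of amplitudes. -/
def mulConst (C C' : ℕ → ℝ) (k : ℕ) : ℝ :=
  ∑ i ∈ Finset.range (k + 1), (k.choose i : ℝ) * C i * C' (k - i)

theorem smul {𝕜 : Type*} [NormedField 𝕜] [NormedAlgebra ℝ 𝕜] [NormedSpace 𝕜 E]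
    [IsScalarTower ℝ 𝕜 E] {M M' : ℝ} {C C' : ℕ → ℝ} {q : X → 𝕜} {f : X → E}
    (hq : IsAmplitude M C q) (hf : IsAmplitude M' C' f) :
    IsAmplitude (M + M') (mulConst C C') (fun z => q z • f z) where
  smooth := hq.smooth.smul hf.smooth
  bound k z := by
    refine (norm_iteratedFDeriv_smul_le hq.smooth hf.smooth z (n := k) (mod_cast le_top)).trans ?_
    rw [mulConst, Finset.sum_mul]
    refine Finset.sum_le_sum fun i _ => ?_
    have h1 := hq.bound i z
    have h2 := hf.bound (k - i) z
    have h0 := hq.const_nonneg i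
    calc (k.choose i : ℝ) * ‖iteratedFDeriv ℝ i q z‖ * ‖iteratedFDeriv ℝ (k - i) f z‖
        ≤ (k.choose i : ℝ) * (C i * (1 + ‖z‖) ^ M) * (C' (k - i) * (1 + ‖z‖) ^ M') := by gcongr
      _ = _ := by rw [Real.rpow_add (one_add_norm_pos z)]; ring

theorem const_smul {𝕜 : Type*} [NormedField 𝕜] [NormedAlgebra ℝ 𝕜] [NormedSpace 𝕜 E]
    [IsScalarTower ℝ 𝕜 E] {M : ℝ} {C : ℕ → ℝ} {f : X → E} (c : 𝕜)
    (hf : IsAmplitude M C f) : IsAmplitude M (fun k => ‖c‖ * C k) (fun z => c • f z) where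
  smooth := hf.smooth.const_smul c
  bound k z := by
    have := iteratedFDeriv_const_smul_apply' (𝕜 := ℝ) (i := k) (a := c) (x := z) (f := f)
      ((hf.smooth.of_le (mod_cast le_top)).contDiffAt)
    rw [this, norm_smul, mul_assoc]
    gcongr
    exact hf.bound k z

theorem continuousLinearMap (L : X →L[ℝ] E) : IsAmplitude 1 (fun _ => ‖L‖) L where
  smooth := L.contDiff
  bound k z := by
    rw [Real.rpow_one]
    have h1 : ‖L‖ ≤ ‖L‖ * (1 + ‖z‖) :=
      le_mul_of_one_le_right (norm_nonneg _) (one_le_one_add_norm z)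
    match k with
    | 0 =>
      rw [norm_iteratedFDeriv_zero]
      refine (L.le_opNorm z).trans ?_
      gcongr
      linarith
    | 1 =>
      rw [← norm_iteratedFDeriv_fderiv, norm_iteratedFDeriv_zero, L.fderiv]
      exact h1
    | k + 2 =>
      have : (_root_.fderiv ℝ L : X → X →L[ℝ] E) = fun _ => L := by
        ext1 z; exact L.fderiv
      rw [← norm_iteratedFDeriv_fderiv, this, iteratedFDeriv_succ_const]
      simpa using (norm_nonneg L).trans h1

theorem const (c : E) : IsAmplitude 0 (fun _ => ‖c‖) (fun _ : X => c) where
  smooth := contDiff_const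
  bound k z := by
    cases k with
    | zero => simp
    | succ k => simp [iteratedFDeriv_succ_const]

theorem continuous {M : ℝ} {C : ℕ → ℝ} {f : X → E} (hf : IsAmplitude M C f) : Continuous f :=
  hf.smooth.continuous

end IsAmplitude

/-- The Peetre inequality. -/
theorem one_add_norm_rpow_add_le (m : ℝ) {S s : ℝ} (hs : |s| ≤ S) (w z : X) :
    (1 + ‖w + s • z‖) ^ m ≤ (1 + S) ^ |m| * (1 + ‖w‖) ^ m * (1 + ‖z‖) ^ |m| := by
  have hS : 0 ≤ S := (abs_nonneg s).trans hs
  have hz := norm_nonneg z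
  have hw := norm_nonneg w
  have hsz : ‖s • z‖ ≤ S * ‖z‖ := by
    rw [norm_smul, Real.norm_eq_abs]; gcongr
  rcases le_total 0 m with hm | hm
  · rw [abs_of_nonneg hm, ← Real.mul_rpow (by positivity) (by positivity),
      ← Real.mul_rpow (by positivity) (by positivity)]
    gcongr
    have := norm_add_le w (s • z)
    nlinarith [mul_nonneg hS hw, mul_nonneg hw hz, mul_nonneg (mul_nonneg hS hw) hz]
  · have key : 1 + ‖w‖ ≤ (1 + S) * (1 + ‖z‖) * (1 + ‖w + s • z‖) := by
      have h1 : ‖w‖ ≤ ‖w + s • z‖ + ‖s • z‖ := by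
        simpa using norm_sub_le (w + s • z) (s • z)
      have h2 := norm_nonneg (w + s • z)
      nlinarith [mul_nonneg hS hz, mul_nonneg hz h2, mul_nonneg (mul_nonneg hS hz) h2,
        mul_nonneg hS h2]
    have h3 := Real.rpow_le_rpow_of_nonpos (by positivity) key hm
    rw [Real.mul_rpow (by positivity) (by positivity),
      Real.mul_rpow (by positivity) (by positivity)] at h3
    rw [abs_of_nonpos hm, Real.rpow_neg (by positivity), Real.rpow_neg (by positivity)]
    have p1 : 0 < (1 + S) ^ m := by positivity
    have p2 : 0 < (1 + ‖z‖) ^ m := by positivity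
    rw [← div_eq_inv_mul, ← div_eq_mul_inv, div_div, le_div_iff₀ (by positivity)]
    linarith

theorem iteratedFDeriv_comp_affine {f : X → E} (hf : ContDiff ℝ ∞ f) (w : X) (s : ℝ) (k : ℕ)
    (z : X) : iteratedFDeriv ℝ k (fun z => f (w + s • z)) z =
      s ^ k • iteratedFDeriv ℝ k f (w + s • z) := by
  have h1 := iteratedFDeriv_comp_const_smul (𝕜 := ℝ) (i := k) (f := fun y => f (w + y)) s
    ((hf.comp (contDiff_const.add contDiff_id)).of_le (mod_cast le_top))
  rw [h1]
  simp only [iteratedFDeriv_comp_add_left]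

/-- The amplitude `z ↦ f (w + s z)`, with constants controlled by the Peetre inequality. -/
theorem IsAmplitude.comp_affine {m : ℝ} {C : ℕ → ℝ} {f : X → E} (hf : IsAmplitude m C f)
    {S s : ℝ} (hs : |s| ≤ S) (w : X) :
    IsAmplitude |m| (fun k => S ^ k * C k * ((1 + S) ^ |m| * (1 + ‖w‖) ^ m))
      (fun z => f (w + s • z)) where
  smooth := hf.smooth.comp (contDiff_const.add (contDiff_const.smul contDiff_id))
  bound k z := by
    rw [iteratedFDeriv_comp_affine hf.smooth, norm_smul, norm_pow, Real.norm_eq_abs]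
    have h1 := hf.bound k (w + s • z)
    have h2 := one_add_norm_rpow_add_le m hs w z
    have h0 := hf.const_nonneg k
    have hS : 0 ≤ S := (abs_nonneg s).trans hs
    calc |s| ^ k * ‖iteratedFDeriv ℝ k f (w + s • z)‖
        ≤ S ^ k * (C k * ((1 + S) ^ |m| * (1 + ‖w‖) ^ m * (1 + ‖z‖) ^ |m|)) := by
          gcongr
          exact h1.trans (by gcongr)
      _ = _ := by ring

end Amplitude

/-! ### The oscillating factor and the first-order operator preserving it -/

section Oscillation

variable {d : ℕ}

/-- The coordinate functions of phase space: `inl k` stands for `x_k`, `inr k` for `ξ_k`. -/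
def phaseCoord : Fin d ⊕ Fin d → PhaseSpace d →L[ℝ] ℝ
  | .inl k => (EuclideanSpace.proj k).comp (ContinuousLinearMap.fst ℝ _ _)
  | .inr k => (EuclideanSpace.proj k).comp (ContinuousLinearMap.snd ℝ _ _)

/-- The direction dual to a coordinate under `(x, ξ) ↦ x · ξ`: the direction `ξ_k` for `x_k`, and
the direction `x_k` for `ξ_k`. -/
def dualDir : Fin d ⊕ Fin d → PhaseSpace d
  | .inl k => (0, EuclideanSpace.single k 1)
  | .inr k => (EuclideanSpace.single k 1, 0)

/-- The oscillating factor `e^{2i x · ξ}`. -/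
def chirp (z : PhaseSpace d) : ℂ := cexp (2 * I * (⟪z.1, z.2⟫ : ℝ))

theorem norm_chirp (z : PhaseSpace d) : ‖chirp z‖ = 1 := by
  rw [chirp, mul_comm (2 : ℂ), mul_assoc, mul_comm I]
  have := Complex.norm_exp_ofReal_mul_I (2 * ⟪z.1, z.2⟫)
  push_cast at this
  exact this

theorem contDiff_chirp : ContDiff ℝ ∞ (chirp (d := d)) := by
  unfold chirp
  have h : ContDiff ℝ ∞ fun z : PhaseSpace d => (⟪z.1, z.2⟫ : ℝ) :=
      contDiff_fst.inner ℝ contDiff_snd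
  exact (contDiff_const.mul (ofRealCLM.contDiff.comp h)).cexp

theorem fderiv_chirp (z : PhaseSpace d) (l : Fin d ⊕ Fin d) :
    fderiv ℝ chirp z (dualDir l) = 2 * I * (phaseCoord l z : ℝ) * chirp z := by
  have h : HasFDerivAt (fun z : PhaseSpace d => (⟪z.1, z.2⟫ : ℝ)) _ z :=
    (hasFDerivAt_fst (p := z)).inner ℝ (hasFDerivAt_snd (p := z))
  have h2 : HasFDerivAt chirp _ z :=
    ((ofRealCLM.hasFDerivAt.comp z h).const_mul (2 * I)).cexp
  rw [h2.fderiv]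
  rcases l with k | k
  · simp [dualDir, phaseCoord, chirp, EuclideanSpace.inner_single_right]; ring
  · simp [dualDir, phaseCoord, chirp, EuclideanSpace.inner_single_left]; ring

/-- The squared Japanese bracket `1 + |z|²`. -/
def bracketSq (z : PhaseSpace d) : ℝ := 1 + ∑ l, phaseCoord l z ^ 2

theorem bracketSq_eq (z : PhaseSpace d) : bracketSq z = 1 + ‖z.1‖ ^ 2 + ‖z.2‖ ^ 2 := by
  simp [bracketSq, Fintype.sum_sum_type, phaseCoord, EuclideanSpace.norm_sq_eq, add_assoc]

theorem bracketSq_pos (z : PhaseSpace d) : 0 < bracketSq z := by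
  rw [bracketSq_eq]; positivity

theorem contDiff_bracketSq : ContDiff ℝ ∞ (bracketSq (d := d)) := by
  unfold bracketSq
  fun_prop

theorem one_add_norm_sq_le (z : PhaseSpace d) : (1 + ‖z‖) ^ 2 ≤ 2 * bracketSq z := by
  rw [bracketSq_eq]
  rcases max_choice ‖z.1‖ ‖z.2‖ with h | h <;> rw [Prod.norm_def, h] <;>
  nlinarith [sq_nonneg (‖z.1‖ - 1), sq_nonneg (‖z.2‖ - 1), sq_nonneg ‖z.1‖, sq_nonneg ‖z.2‖]

theorem bracketSq_le (z : PhaseSpace d) : bracketSq z ≤ 2 * (1 + ‖z‖) ^ 2 := by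
  rw [bracketSq_eq]
  have h1 := norm_fst_le z
  have h2 := norm_snd_le z
  nlinarith [norm_nonneg z.1, norm_nonneg z.2, norm_nonneg z]

/-- The weight `1 / (1 + |z|²)`. -/
def invBracketSq (z : PhaseSpace d) : ℝ := (bracketSq z)⁻¹

theorem contDiff_invBracketSq : ContDiff ℝ ∞ (invBracketSq (d := d)) :=
  contDiff_bracketSq.inv fun z => (bracketSq_pos z).ne'

theorem fderiv_invBracketSq (z : PhaseSpace d) : fderiv ℝ invBracketSq z =
    invBracketSq z • invBracketSq z • (∑ l, (-2 * phaseCoord l z) • phaseCoord (d := d) l) := by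
  have h1 : HasFDerivAt (bracketSq (d := d))
      (∑ l, (2 * phaseCoord l z) • phaseCoord (d := d) l) z := by
    have : ∀ l ∈ (Finset.univ : Finset (Fin d ⊕ Fin d)), HasFDerivAt (fun z => phaseCoord l z ^ 2)
        ((2 * phaseCoord l z) • phaseCoord (d := d) l) z := fun l _ => by
      simpa using (phaseCoord (d := d) l).hasFDerivAt.pow 2
    exact (HasFDerivAt.fun_sum this).const_add 1
  have h2 := (hasDerivAt_inv (bracketSq_pos z).ne').comp_hasFDerivAt z h1
  have h3 : fderiv ℝ invBracketSq z = _ := h2.fderiv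
  rw [h3, smul_smul, Finset.smul_sum, Finset.smul_sum]
  refine Finset.sum_congr rfl fun l _ => ?_
  rw [smul_smul, smul_smul, invBracketSq]
  congr 1
  ring

theorem exists_isAmplitude_invBracketSq :
    ∃ C, IsAmplitude (-2) C (invBracketSq (d := d)) := by
  -- The derivative of `1 / p` is `-(1 / p) (1 / p) p'` with `p'` of order one, so the bounds
  -- propagate from lower to higher derivatives through the Leibniz rule.
  set L : PhaseSpace d → PhaseSpace d →L[ℝ] ℝ :=
      fun z => ∑ l, (-2 * phaseCoord l z) • phaseCoord (d := d) l
    with hL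
  obtain ⟨CL, hCL⟩ : ∃ C, IsAmplitude 1 C L := by
    refine ⟨_, IsAmplitude.sum (C := fun l k =>
      ‖(((-2 : ℝ) • phaseCoord (d := d) l).smulRight (phaseCoord (d := d) l))‖) _ fun l _ => ?_⟩
    exact IsAmplitude.continuousLinearMap
        (((-2 : ℝ) • phaseCoord (d := d) l).smulRight (phaseCoord (d := d) l))
  have hbase (z : PhaseSpace d) : invBracketSq z ≤ 2 * (1 + ‖z‖) ^ (-2 : ℝ) := by
    rw [Real.rpow_neg (one_add_norm_pos z).le, ← div_eq_mul_inv, invBracketSq, inv_eq_one_div,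
      div_le_div_iff₀ (bracketSq_pos z) (by positivity)]
    have := one_add_norm_sq_le z
    norm_cast
    linarith
  have key (n : ℕ) : ∃ C, ∀ k ≤ n, ∀ z : PhaseSpace d,
      ‖iteratedFDeriv ℝ k invBracketSq z‖ ≤ C * (1 + ‖z‖) ^ (-2 : ℝ) := by
    induction n with
    | zero =>
      refine ⟨2, fun k hk z => ?_⟩
      obtain rfl : k = 0 := by omega
      rw [norm_iteratedFDeriv_zero, Real.norm_of_nonneg
          (by exact inv_nonneg.2 (bracketSq_pos z).le)]
      exact hbase z
    | succ n ih =>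
      obtain ⟨C, hC⟩ := ih
      have hC0 : 0 ≤ C := by
        have := (norm_nonneg _).trans (hC 0 (by omega) 0)
        simpa using this
      set D : ℝ := ∑ i ∈ Finset.range (n + 1), (n.choose i : ℝ) * C *
        (∑ j ∈ Finset.range (n - i + 1), ((n - i).choose j : ℝ) * C * CL (n - i - j)) with hD
      refine ⟨max C D, fun k hk z => ?_⟩
      have hz : 0 < (1 + ‖z‖) ^ (-2 : ℝ) := by positivity
      rcases Nat.lt_or_ge k (n + 1) with hk' | hk'
      · exact (hC k (by omega) z).trans (by gcongr; exact le_max_left _ _)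
      obtain rfl : k = n + 1 := by omega
      have hD1 : ‖iteratedFDeriv ℝ (n + 1) invBracketSq z‖ ≤ D * (1 + ‖z‖) ^ (-2 : ℝ) := by
        have e : fderiv ℝ (invBracketSq (d := d)) =
            fun z => invBracketSq z • (fun z => invBracketSq z • L z) z := by
          ext1 z; exact fderiv_invBracketSq z
        rw [← norm_iteratedFDeriv_fderiv, e]
        have s1 := contDiff_invBracketSq (d := d)
        refine (norm_iteratedFDeriv_smul_le (N := ∞) s1 (s1.smul hCL.smooth) z (n := n)
          (mod_cast le_top)).trans ?_
        rw [hD, Finset.sum_mul]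
        refine Finset.sum_le_sum fun i hi => ?_
        have hi' : i ≤ n := by simpa [Nat.lt_succ_iff] using hi
        have h1 := hC i hi' z
        have h2 : ‖iteratedFDeriv ℝ (n - i) (fun z => invBracketSq z • L z) z‖ ≤
            ∑ j ∈ Finset.range (n - i + 1), ((n - i).choose j : ℝ) * C * CL (n - i - j) := by
          refine (norm_iteratedFDeriv_smul_le (N := ∞) s1 hCL.smooth z (n := n - i)
            (WithTop.coe_le_coe.2 le_top)).trans ?_
          refine Finset.sum_le_sum fun j hj => ?_
          have hj' : j ≤ n := by simp at hj; omega
          have h3 := hC j hj' z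
          have h4 := hCL.bound (n - i - j) z
          have h5 := hCL.const_nonneg (n - i - j)
          calc ((n - i).choose j : ℝ) * ‖iteratedFDeriv ℝ j invBracketSq z‖ *
                ‖iteratedFDeriv ℝ (n - i - j) L z‖
              ≤ ((n - i).choose j : ℝ) * (C * (1 + ‖z‖) ^ (-2 : ℝ)) *
                (CL (n - i - j) * (1 + ‖z‖) ^ (1 : ℝ)) := by gcongr
            _ = ((n - i).choose j : ℝ) * C * CL (n - i - j) * (1 + ‖z‖) ^ (-1 : ℝ) := by
                rw [show (-1 : ℝ) = -2 + 1 by norm_num, Real.rpow_add (one_add_norm_pos z)]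
                ring
            _ ≤ ((n - i).choose j : ℝ) * C * CL (n - i - j) * 1 := by
                gcongr
                exact Real.rpow_le_one_of_one_le_of_nonpos (one_le_one_add_norm z) (by norm_num)
            _ = _ := mul_one _
        calc (n.choose i : ℝ) * ‖iteratedFDeriv ℝ i invBracketSq z‖ *
              ‖iteratedFDeriv ℝ (n - i) (fun z => invBracketSq z • L z) z‖
            ≤ (n.choose i : ℝ) * (C * (1 + ‖z‖) ^ (-2 : ℝ)) *
              (∑ j ∈ Finset.range (n - i + 1), ((n - i).choose j : ℝ) * C * CL (n - i - j)) := by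
              gcongr
          _ = _ := by ring
      exact hD1.trans (by gcongr; exact le_max_right _ _)
  choose C hC using key
  exact ⟨C, contDiff_invBracketSq, fun k z => hC k k le_rfl z⟩

instance isAddHaarMeasure_volume_phaseSpace :
    (volume : Measure (PhaseSpace d)).IsAddHaarMeasure :=
  inferInstanceAs ((volume : Measure (ConfigSpace d)).prod volume).IsAddHaarMeasure

theorem integrable_of_norm_le_rpow {F : Type*} [NormedAddCommGroup F] {f : PhaseSpace d → F}
    (hf : Continuous f) {c r : ℝ}
    (hr : r < -(2 * d)) (h : ∀ z, ‖f z‖ ≤ c * (1 + ‖z‖) ^ r) : Integrable f := by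
  have hd : (Module.finrank ℝ (PhaseSpace d) : ℝ) < -r := by
    rw [Module.finrank_prod]; simp; linarith
  have h1 := (integrable_one_add_norm (μ := (volume : Measure (PhaseSpace d))) hd).const_mul c
  refine h1.mono' hf.aestronglyMeasurable (Eventually.of_forall fun z => ?_)
  simpa using h z

variable {E : Type*} [NormedAddCommGroup E] [NormedSpace ℝ E] [NormedSpace ℂ E]
  [IsScalarTower ℝ ℂ E]

set_option linter.unusedSectionVars false

/-- The operator `T f = f / p + (i/2) ∑_l ∂_{l'} (z_l f / p)`, `p = 1 + |z|²`, where `l'` is the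
direction dual to the coordinate `z_l`. It is the transpose of an operator fixing `e^{2i x · ξ}`,
and it lowers the order of amplitudes by one. -/
def oscStep (f : PhaseSpace d → E) (z : PhaseSpace d) : E :=
  invBracketSq z • f z + (I / 2) • ∑ l,
    fderiv ℝ (fun z => (invBracketSq z • phaseCoord l z) • f z) z (dualDir l)

theorem ofReal_smul_of_tower (r : ℝ) (x : E) : (r : ℂ) • x = r • x :=
  algebraMap_smul ℂ r x

theorem exists_isAmplitude_invBracketSq_coord (l : Fin d ⊕ Fin d) :
    ∃ C, IsAmplitude (-1) C fun z => invBracketSq z • phaseCoord l z := by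
  obtain ⟨C, hC⟩ := exists_isAmplitude_invBracketSq (d := d)
  refine ⟨_, (hC.smul (IsAmplitude.continuousLinearMap (phaseCoord l))).mono ?_ fun k => le_rfl⟩
  norm_num

theorem exists_isAmplitude_oscStep (M : ℝ) (C : ℕ → ℝ) :
    ∃ C' : ℕ → ℝ, ∀ f : PhaseSpace d → E, IsAmplitude M C f →
      IsAmplitude (M - 1) C' (oscStep f) := by
  obtain ⟨C₀, hC₀⟩ := exists_isAmplitude_invBracketSq (d := d)
  choose C₁ hC₁ using exists_isAmplitude_invBracketSq_coord (d := d)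
  refine ⟨fun k => IsAmplitude.mulConst C₀ C k + ‖I / 2‖ * ∑ l, ‖dualDir (d := d) l‖ *
      IsAmplitude.mulConst (C₁ l) C (k + 1), fun f hf => ?_⟩
  · refine IsAmplitude.add ((hC₀.smul hf).mono (by linarith) fun k => le_rfl)
      (IsAmplitude.const_smul _ (IsAmplitude.sum _ fun l _ => ?_))
    exact (((hC₁ l).smul hf).mono (M' := M - 1) (by linarith) fun k => le_rfl).fderiv.clm_apply _

theorem exists_isAmplitude_oscStep_iterate (M : ℝ) (C : ℕ → ℝ) (K : ℕ) :
    ∃ C' : ℕ → ℝ, ∀ f : PhaseSpace d → E, IsAmplitude M C f →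
      IsAmplitude (M - K) C' (oscStep^[K] f) := by
  induction K with
  | zero => exact ⟨C, fun f hf => by simpa using hf⟩
  | succ K ih =>
    obtain ⟨C', h'⟩ := ih
    obtain ⟨C'', h''⟩ := exists_isAmplitude_oscStep (E := E) (d := d) (M - K) C'
    refine ⟨C'', fun f hf => ?_⟩
    rw [Function.iterate_succ_apply']
    exact (h'' _ (h' f hf)).mono (by push_cast; linarith) fun k => le_rfl

theorem IsAmplitude.integrable_chirp_smul {M : ℝ} {C : ℕ → ℝ} {f : PhaseSpace d → E}
    (hf : IsAmplitude M C f) (hM : M < -(2 * d)) : Integrable fun z => chirp z • f z :=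
  integrable_of_norm_le_rpow (contDiff_chirp.continuous.smul hf.continuous) hM fun z => by
    rw [norm_smul, norm_chirp, one_mul]; exact hf.norm_le z

/-- Multiplication by a coordinate is, under the oscillating integral, `i/2` times the derivative
in the dual direction. -/
theorem integral_chirp_coord_smul {M : ℝ} {C : ℕ → ℝ} {f : PhaseSpace d → E}
    (hf : IsAmplitude M C f) (hM : M + 1 < -(2 * d)) (l : Fin d ⊕ Fin d) :
    ∫ z, chirp z • phaseCoord l z • f z =
      (I / 2) • ∫ z, chirp z • fderiv ℝ f z (dualDir l) := by
  have hz : IsAmplitude (1 + M) _ fun z => phaseCoord l z • f z :=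
    (IsAmplitude.continuousLinearMap (phaseCoord l)).smul hf
  have i1 := hz.integrable_chirp_smul (by linarith)
  have i2 := (hf.fderiv.clm_apply (dualDir l)).integrable_chirp_smul (by linarith)
  have i3 := hf.integrable_chirp_smul (by linarith)
  have e : ∀ z, fderiv ℝ chirp z (dualDir l) • f z =
      (2 * I) • (chirp z • phaseCoord l z • f z) := by
    intro z
    rw [fderiv_chirp, ← ofReal_smul_of_tower (phaseCoord l z) (f z), smul_smul, smul_smul]
    congr 1; ring
  have h := integral_smul_fderiv_eq_neg_fderiv_smul_of_integrable (μ := volume)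
    (f := chirp (d := d)) (g := f) (v := dualDir l)
    (by simp_rw [e]; exact i1.smul (2 * I)) i2 i3
    (fun z _ => contDiff_chirp.differentiable (by simp) z)
    (fun z _ => hf.smooth.differentiable (by simp) z)
  rw [h]
  simp_rw [e]
  rw [integral_smul, ← neg_smul, smul_smul]
  have : I / 2 * -(2 * I) = 1 := by
    ring_nf; simp
  simp [this]

/-- `oscStep` does not change integrals against `e^{2i x · ξ}`: by integration by parts its two
terms contribute `f / p` and `|z|² f / p`. -/
theorem integral_chirp_oscStep {M : ℝ} {C : ℕ → ℝ} {f : PhaseSpace d → E}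
    (hf : IsAmplitude M C f) (hM : M < -(2 * d)) :
    ∫ z, chirp z • oscStep f z = ∫ z, chirp z • f z := by
  obtain ⟨C₀, hC₀⟩ := exists_isAmplitude_invBracketSq (d := d)
  choose C₁ hC₁ using exists_isAmplitude_invBracketSq_coord (d := d)
  have a1 (l) := (hC₁ l).smul hf
  have i0 := (hC₀.smul hf).integrable_chirp_smul (by linarith)
  have i1 (l) := ((a1 l).fderiv.clm_apply (dualDir l)).integrable_chirp_smul (by linarith)
  have i2 (l) := ((IsAmplitude.continuousLinearMap (phaseCoord l)).smul
    (a1 l)).integrable_chirp_smul (by linarith)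
  have h1 (l) := integral_chirp_coord_smul (a1 l) (by linarith) l
  have e1 : ∀ z, chirp z • oscStep f z = chirp z • invBracketSq z • f z + (I / 2) • ∑ l, chirp z •
      fderiv ℝ (fun z => (invBracketSq z • phaseCoord l z) • f z) z (dualDir l) := fun z => by
    rw [oscStep, smul_add, smul_comm (chirp z) (I / 2), Finset.smul_sum]
  have e2 : ∀ z, chirp z • f z = chirp z • invBracketSq z • f z + ∑ l, chirp z • phaseCoord l z •
      (invBracketSq z • phaseCoord l z) • f z := fun z => by
    rw [← Finset.smul_sum, ← smul_add]
    congr 1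
    simp_rw [smul_smul]
    rw [← Finset.sum_smul, ← add_smul]
    have : invBracketSq z + ∑ l, phaseCoord l z * (invBracketSq z • phaseCoord l z) = 1 := by
      have : invBracketSq z * bracketSq z = 1 := inv_mul_cancel₀ (bracketSq_pos z).ne'
      rw [bracketSq, mul_add, Finset.mul_sum] at this
      rw [← this, mul_one]
      congr 1
      exact Finset.sum_congr rfl fun l _ => by rw [smul_eq_mul]; ring
    rw [this, one_smul]
  have i3 : Integrable fun z => (I / 2) • ∑ l, chirp z •
      fderiv ℝ (fun z => (invBracketSq z • phaseCoord l z) • f z) z (dualDir l) :=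
    (integrable_finsetSum _ fun l _ => i1 l).smul (I / 2)
  simp_rw [e1]
  rw [integral_congr_ae (Eventually.of_forall e2)]
  rw [integral_add i0 i3, integral_smul,
    integral_finsetSum _ fun l _ => i1 l, integral_add i0 (integrable_finsetSum _ fun l _ => i2 l),
    integral_finsetSum _ fun l _ => i2 l, Finset.smul_sum]
  congr 1
  exact Finset.sum_congr rfl fun l _ => (h1 l).symm

end Oscillation

/-! ### Oscillatory integrals -/

section OscIntegral

set_option linter.unusedSectionVars false

variable {d : ℕ} {E : Type*} [NormedAddCommGroup E] [NormedSpace ℝ E] [NormedSpace ℂ E]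
  [IsScalarTower ℝ ℂ E]

theorem contDiff_oscStep {f : PhaseSpace d → E} (hf : ContDiff ℝ ∞ f) :
    ContDiff ℝ ∞ (oscStep f) := by
  refine (contDiff_invBracketSq.smul hf).add (ContDiff.const_smul _ (ContDiff.sum fun l _ => ?_))
  have h : ContDiff ℝ ∞ fun z => (invBracketSq z • phaseCoord l z) • f z :=
    (contDiff_invBracketSq.smul (phaseCoord l).contDiff).smul hf
  exact (h.fderiv_right (m := ∞) (by simp)).clm_apply contDiff_const

theorem contDiff_oscStep_iterate {f : PhaseSpace d → E} (hf : ContDiff ℝ ∞ f) (K : ℕ) :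
    ContDiff ℝ ∞ (oscStep^[K] f) := by
  induction K with
  | zero => exact hf
  | succ K ih => rw [Function.iterate_succ_apply']; exact contDiff_oscStep ih

theorem oscStep_eventuallyEq {f g : PhaseSpace d → E} {z : PhaseSpace d} (h : f =ᶠ[𝓝 z] g) :
    oscStep f =ᶠ[𝓝 z] oscStep g := by
  filter_upwards [h.eventuallyEq_nhds] with y hy
  rw [oscStep, oscStep, hy.eq_of_nhds]
  congr 2
  refine Finset.sum_congr rfl fun l _ => ?_
  have : (fun z => (invBracketSq z • phaseCoord l z) • f z) =ᶠ[𝓝 y]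
      fun z => (invBracketSq z • phaseCoord l z) • g z := by
    filter_upwards [hy] with x hx
    rw [hx]
  rw [this.fderiv_eq]

theorem oscStep_iterate_eventuallyEq {f g : PhaseSpace d → E} {z : PhaseSpace d}
    (h : f =ᶠ[𝓝 z] g) (K : ℕ) : oscStep^[K] f =ᶠ[𝓝 z] oscStep^[K] g := by
  induction K with
  | zero => exact h
  | succ K ih =>
    rw [Function.iterate_succ_apply', Function.iterate_succ_apply']
    exact oscStep_eventuallyEq ih

theorem differentiable_weighted {f : PhaseSpace d → E} (hf : ContDiff ℝ ∞ f) (l : Fin d ⊕ Fin d) :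
    Differentiable ℝ fun z => (invBracketSq z • phaseCoord l z) • f z :=
  ((contDiff_invBracketSq.smul (phaseCoord l).contDiff).smul hf).differentiable (by simp)

theorem oscStep_add {f g : PhaseSpace d → E} (hf : ContDiff ℝ ∞ f) (hg : ContDiff ℝ ∞ g) :
    oscStep (fun z => f z + g z) = fun z => oscStep f z + oscStep g z := by
  ext1 z
  have h (l : Fin d ⊕ Fin d) : fderiv ℝ (fun z => (invBracketSq z • phaseCoord l z) •
      (f z + g z)) z =
      fderiv ℝ (fun z => (invBracketSq z • phaseCoord l z) • f z) z +
      fderiv ℝ (fun z => (invBracketSq z • phaseCoord l z) • g z) z := by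
    simp_rw [smul_add]
    exact fderiv_fun_add (differentiable_weighted hf l z) (differentiable_weighted hg l z)
  simp only [oscStep, h, _root_.add_apply, Finset.sum_add_distrib, smul_add (I / 2),
    smul_add (invBracketSq z) (f z)]
  abel

theorem oscStep_const_smul {f : PhaseSpace d → E} (hf : ContDiff ℝ ∞ f) (c : ℂ) :
    oscStep (fun z => c • f z) = fun z => c • oscStep f z := by
  ext1 z
  have h (l : Fin d ⊕ Fin d) : fderiv ℝ (fun z => (invBracketSq z • phaseCoord l z) • (c • f z)) z =
      c • fderiv ℝ (fun z => (invBracketSq z • phaseCoord l z) • f z) z := by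
    simp_rw [smul_comm _ c (_ : E)]
    exact fderiv_fun_const_smul (differentiable_weighted hf l z) c
  simp only [oscStep, h, _root_.smul_apply, ← Finset.smul_sum, smul_add]
  rw [smul_comm c (I / 2), smul_comm c (invBracketSq z)]

theorem oscStep_iterate_add {f g : PhaseSpace d → E} (hf : ContDiff ℝ ∞ f) (hg : ContDiff ℝ ∞ g)
    (K : ℕ) : oscStep^[K] (fun z => f z + g z) = fun z => oscStep^[K] f z + oscStep^[K] g z := by
  induction K with
  | zero => rfl
  | succ K ih =>
    rw [Function.iterate_succ_apply', ih,
      oscStep_add (contDiff_oscStep_iterate hf K) (contDiff_oscStep_iterate hg K),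
      Function.iterate_succ_apply', Function.iterate_succ_apply']

theorem oscStep_iterate_const_smul {f : PhaseSpace d → E} (hf : ContDiff ℝ ∞ f) (c : ℂ) (K : ℕ) :
    oscStep^[K] (fun z => c • f z) = fun z => c • oscStep^[K] f z := by
  induction K with
  | zero => rfl
  | succ K ih =>
    rw [Function.iterate_succ_apply', ih, oscStep_const_smul (contDiff_oscStep_iterate hf K),
      Function.iterate_succ_apply']

/-- The oscillatory integral `∫ e^{2i x · ξ} f(x, ξ) dx dξ`. The sequence of which the limit is
taken is eventually constant when `f` is an amplitude, see `IsAmplitude.oscIntegral_eq`. -/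
def oscIntegral (f : PhaseSpace d → E) : E :=
  limUnder atTop fun K : ℕ => ∫ z, chirp z • (oscStep^[K] f) z

namespace IsAmplitude

variable {M : ℝ} {C C' : ℕ → ℝ} {f g : PhaseSpace d → E}

theorem integrable_oscStep_iterate (hf : IsAmplitude M C f) {K : ℕ} (hK : M - K < -(2 * d)) :
    Integrable fun z => chirp z • (oscStep^[K] f) z := by
  obtain ⟨C', hC'⟩ := exists_isAmplitude_oscStep_iterate (E := E) (d := d) M C K
  exact (hC' f hf).integrable_chirp_smul hK

/-- The oscillatory integral is attained as soon as `oscStep` has made the amplitude integrable. -/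
theorem oscIntegral_eq (hf : IsAmplitude M C f) {K : ℕ} (hK : M - K < -(2 * d)) :
    oscIntegral f = ∫ z, chirp z • (oscStep^[K] f) z := by
  have h (j : ℕ) : ∫ z, chirp z • (oscStep^[K + j] f) z = ∫ z, chirp z • (oscStep^[K] f) z := by
    induction j with
    | zero => rfl
    | succ j ih =>
      obtain ⟨C', hC'⟩ := exists_isAmplitude_oscStep_iterate (E := E) (d := d) M C (K + j)
      rw [← add_assoc, Function.iterate_succ_apply', integral_chirp_oscStep (hC' f hf), ih]
      push_cast
      have : (0 : ℝ) ≤ j := j.cast_nonneg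
      linarith
  refine Tendsto.limUnder_eq (tendsto_const_nhds.congr' ?_)
  filter_upwards [eventually_ge_atTop K] with K' hK'
  rw [← h (K' - K), Nat.add_sub_cancel' hK']

/-- A number of steps after which amplitudes of order `M` become integrable. -/
theorem exists_steps (d : ℕ) (M : ℝ) : ∃ K : ℕ, M - K < -(2 * d) := by
  obtain ⟨K, hK⟩ := exists_nat_gt (M + 2 * d)
  exact ⟨K, by linarith⟩

theorem oscIntegral_eq_integral (hf : IsAmplitude M C f) (hM : M < -(2 * d)) :
    oscIntegral f = ∫ z, chirp z • f z :=
  hf.oscIntegral_eq (K := 0) (by simpa using hM)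

theorem oscIntegral_add {C' : ℕ → ℝ} (hf : IsAmplitude M C f) (hg : IsAmplitude M C' g) :
    oscIntegral (fun z => f z + g z) = oscIntegral f + oscIntegral g := by
  obtain ⟨K, hK⟩ := exists_steps d M
  rw [hf.oscIntegral_eq hK, hg.oscIntegral_eq hK, (hf.add hg).oscIntegral_eq hK,
    oscStep_iterate_add hf.smooth hg.smooth]
  simp_rw [smul_add]
  exact integral_add (hf.integrable_oscStep_iterate hK) (hg.integrable_oscStep_iterate hK)

theorem oscIntegral_const_smul (hf : IsAmplitude M C f) (c : ℂ) :
    oscIntegral (fun z => c • f z) = c • oscIntegral f := by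
  obtain ⟨K, hK⟩ := exists_steps d M
  rw [hf.oscIntegral_eq hK, (hf.const_smul c).oscIntegral_eq hK,
    oscStep_iterate_const_smul hf.smooth, ← integral_smul]
  simp_rw [smul_comm _ c]

theorem oscIntegral_sum {ι : Type*} {C : ι → ℕ → ℝ} {f : ι → PhaseSpace d → E} (s : Finset ι)
    (hf : ∀ i ∈ s, IsAmplitude M (C i) (f i)) :
    oscIntegral (fun z => ∑ i ∈ s, f i z) = ∑ i ∈ s, oscIntegral (f i) := by
  classical
  induction s using Finset.induction_on with
  | empty =>
    have := (IsAmplitude.zero (X := PhaseSpace d) (E := E) M).oscIntegral_const_smul 0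
    simpa using this
  | insert i s hi ih =>
    simp only [Finset.sum_insert hi]
    rw [oscIntegral_add (hf i (by simp)) (IsAmplitude.sum s fun j hj => hf j (by simp [hj])),
      ih fun j hj => hf j (by simp [hj])]

end IsAmplitude

/-- Oscillatory integrals are bounded in terms of the order and the constants of the amplitude. -/
theorem exists_norm_oscIntegral_le (M : ℝ) (C : ℕ → ℝ) :
    ∃ B : ℝ, ∀ f : PhaseSpace d → E, IsAmplitude M C f → ‖oscIntegral f‖ ≤ B := by
  obtain ⟨K, hK⟩ := IsAmplitude.exists_steps d M
  obtain ⟨C', hC'⟩ := exists_isAmplitude_oscStep_iterate (E := E) (d := d) M C K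
  refine ⟨∫ z : PhaseSpace d, C' 0 * (1 + ‖z‖) ^ (M - K), fun f hf => ?_⟩
  rw [hf.oscIntegral_eq hK]
  refine norm_integral_le_of_norm_le ?_ (Eventually.of_forall fun z => ?_)
  · have := integrable_of_norm_le_rpow (d := d) (f := fun z => C' 0 * (1 + ‖z‖) ^ (M - K))
      (continuous_const.mul ((continuous_const.add continuous_norm).rpow_const
        fun z => Or.inl (one_add_norm_pos z).ne')) (c := |C' 0|) hK fun z => ?_
    · exact this
    · rw [norm_mul, Real.norm_eq_abs, Real.norm_of_nonneg (by positivity)]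
  · rw [norm_smul, norm_chirp, one_mul]
    exact (hC' f hf).norm_le z

/-- Oscillatory integrals depend continuously on the amplitude under convergence which is locally
stationary and bounded in the space of amplitudes of a fixed order. -/
theorem tendsto_oscIntegral {M : ℝ} {C : ℕ → ℝ} {f : ℕ → PhaseSpace d → E} {g : PhaseSpace d → E}
    (hf : ∀ n, IsAmplitude M C (f n)) {C' : ℕ → ℝ} (hg : IsAmplitude M C' g)
    (h : ∀ z, ∀ᶠ n in atTop, f n =ᶠ[𝓝 z] g) :
    Tendsto (fun n => oscIntegral (f n)) atTop (𝓝 (oscIntegral g)) := by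
  obtain ⟨K, hK⟩ := IsAmplitude.exists_steps d M
  obtain ⟨C'', hC''⟩ := exists_isAmplitude_oscStep_iterate (E := E) (d := d) M C K
  rw [hg.oscIntegral_eq hK]
  simp_rw [fun n => (hf n).oscIntegral_eq hK]
  refine tendsto_integral_of_dominated_convergence (fun z => C'' 0 * (1 + ‖z‖) ^ (M - K))
    (fun n => ((hf n).integrable_oscStep_iterate hK).aestronglyMeasurable) ?_ (fun n => ?_) ?_
  · exact integrable_of_norm_le_rpow (d := d) (f := fun z => C'' 0 * (1 + ‖z‖) ^ (M - K))
      (continuous_const.mul ((continuous_const.add continuous_norm).rpow_const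
        fun z => Or.inl (one_add_norm_pos z).ne')) (c := |C'' 0|) hK fun z => by
          rw [norm_mul, Real.norm_eq_abs, Real.norm_of_nonneg (by positivity)]
  · refine Eventually.of_forall fun z => ?_
    rw [norm_smul, norm_chirp, one_mul]
    exact (hC'' _ (hf n)).norm_le z
  · refine Eventually.of_forall fun z => tendsto_const_nhds.congr' ?_
    filter_upwards [h z] with n hn
    rw [(oscStep_iterate_eventuallyEq hn K).eq_of_nhds]

theorem exists_isAmplitude_of_hasCompactSupport {X : Type*} [NormedAddCommGroup X] [NormedSpace ℝ X]
    {F : Type*} [NormedAddCommGroup F] [NormedSpace ℝ F]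
    {f : X → F} (hf : ContDiff ℝ ∞ f) (hs : HasCompactSupport f) (M : ℝ) :
    ∃ C, IsAmplitude M C f := by
  have h (k : ℕ) : ∃ C, ∀ z, ‖iteratedFDeriv ℝ k f z‖ ≤ C * (1 + ‖z‖) ^ M := by
    have hc : Continuous fun z => (1 + ‖z‖) ^ (-M) • iteratedFDeriv ℝ k f z :=
      ((continuous_const.add continuous_norm).rpow_const
        fun z => Or.inl (one_add_norm_pos z).ne').smul
        (hf.continuous_iteratedFDeriv (mod_cast le_top))
    obtain ⟨C, hC⟩ := ((hs.iteratedFDeriv (𝕜 := ℝ) k).smul_left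
      (f := fun z : X => (1 + ‖z‖) ^ (-M))).exists_bound_of_continuous hc
    refine ⟨C, fun z => ?_⟩
    have h1 := hC z
    have h2 : 0 < (1 + ‖z‖) ^ M := by positivity
    simp only [Pi.smul_apply', norm_smul, Real.rpow_neg (one_add_norm_pos z).le, norm_inv,
      Real.norm_of_nonneg h2.le] at h1
    rwa [inv_mul_le_iff₀ h2, mul_comm] at h1
  choose C hC using h
  exact ⟨C, hf, hC⟩

/-- A smooth compactly supported function on `ℝ^d` equal to one on the unit ball. -/
def bump (d : ℕ) : ContDiffBump (0 : ConfigSpace d) := ⟨1, 2, one_pos, one_lt_two⟩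

/-- The cutoffs `φ(x / (n + 1)) φ(ξ / (n + 1))` exhausting phase space. -/
def cutoff (n : ℕ) (z : PhaseSpace d) : ℝ :=
  bump d ((n + 1 : ℝ)⁻¹ • z.1) * bump d ((n + 1 : ℝ)⁻¹ • z.2)

theorem exists_isAmplitude_cutoff (d : ℕ) :
    ∃ C, ∀ n, IsAmplitude 0 C (cutoff (d := d) n) := by
  have h1 : ContDiff ℝ ∞ fun z : PhaseSpace d => bump d z.1 * bump d z.2 :=
    ((bump d).contDiff.comp contDiff_fst).mul ((bump d).contDiff.comp contDiff_snd)
  have h2 : HasCompactSupport fun z : PhaseSpace d => bump d z.1 * bump d z.2 := by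
    refine HasCompactSupport.intro
      ((bump d).hasCompactSupport.isCompact.prod (bump d).hasCompactSupport.isCompact)
      fun z hz => ?_
    rw [Set.mem_prod, not_and_or] at hz
    rcases hz with hz | hz <;> simp [image_eq_zero_of_notMem_tsupport hz]
  obtain ⟨C, hC⟩ := exists_isAmplitude_of_hasCompactSupport h1 h2 0
  refine ⟨fun k => 1 ^ k * C k * ((1 + 1) ^ |(0 : ℝ)| * (1 + ‖(0 : PhaseSpace d)‖) ^ (0 : ℝ)),
    fun n => ?_⟩
  have hn : |(n + 1 : ℝ)⁻¹| ≤ 1 := by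
    rw [abs_of_nonneg (by positivity)]
    exact inv_le_one_of_one_le₀ (by linarith [(n.cast_nonneg : (0 : ℝ) ≤ n)])
  have h3 := (hC.comp_affine hn 0).mono (M' := 0) (by simp) fun k => le_rfl
  simp only [zero_add, Prod.smul_fst, Prod.smul_snd] at h3
  exact h3

theorem hasCompactSupport_cutoff (n : ℕ) : HasCompactSupport (cutoff (d := d) n) := by
  have h := (bump d).hasCompactSupport.comp_smul (c := (n + 1 : ℝ)⁻¹) (by positivity)
  refine HasCompactSupport.intro (h.isCompact.prod h.isCompact) fun z hz => ?_
  rw [Set.mem_prod, not_and_or] at hz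
  rcases hz with hz | hz
  · rw [cutoff, image_eq_zero_of_notMem_tsupport hz, zero_mul]
  · rw [cutoff, image_eq_zero_of_notMem_tsupport hz, mul_zero]

theorem cutoff_eventuallyEq_one (z : PhaseSpace d) :
    ∀ᶠ n : ℕ in atTop, cutoff n =ᶠ[𝓝 z] fun _ => 1 := by
  obtain ⟨N, hN⟩ := exists_nat_gt ‖z‖
  filter_upwards [eventually_ge_atTop N] with n hn
  have h1 : ‖z‖ < n + 1 := by
    have : (N : ℝ) ≤ n := mod_cast hn
    linarith
  filter_upwards [continuous_norm.continuousAt.eventually_lt continuousAt_const h1] with y hy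
  have h2 (x : ConfigSpace d) (hx : ‖x‖ ≤ ‖y‖) : bump d ((n + 1 : ℝ)⁻¹ • x) = 1 := by
    refine (bump d).one_of_mem_closedBall ?_
    rw [mem_closedBall_zero_iff, norm_smul, norm_inv, Real.norm_of_nonneg (by positivity),
      inv_mul_le_iff₀ (by positivity)]
    simp only [bump, mul_one]
    linarith
  rw [cutoff, h2 _ (norm_fst_le y), h2 _ (norm_snd_le y), one_mul]

theorem exists_isAmplitude_cutoff_smul (M : ℝ) (C : ℕ → ℝ) :
    ∃ C' : ℕ → ℝ, ∀ f : PhaseSpace d → E, IsAmplitude M C f → ∀ n,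
      IsAmplitude M C' fun z => cutoff n z • f z := by
  obtain ⟨C₀, hC₀⟩ := exists_isAmplitude_cutoff d
  exact ⟨_, fun f hf n => ((hC₀ n).smul hf).mono (by simp) fun k => le_rfl⟩

theorem exists_isAmplitude_cutoff_smul_decay {M : ℝ} {C : ℕ → ℝ} {f : PhaseSpace d → E}
    (hf : IsAmplitude M C f) (n : ℕ) (M' : ℝ) :
    ∃ C', IsAmplitude M' C' fun z => cutoff n z • f z := by
  obtain ⟨C₀, hC₀⟩ := exists_isAmplitude_cutoff d
  exact exists_isAmplitude_of_hasCompactSupport ((hC₀ n).smooth.smul hf.smooth)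
    ((hasCompactSupport_cutoff n).smul_right) M'

theorem cutoff_smul_eventuallyEq (f : PhaseSpace d → E) (z : PhaseSpace d) :
    ∀ᶠ n : ℕ in atTop, (fun z => cutoff n z • f z) =ᶠ[𝓝 z] f := by
  filter_upwards [cutoff_eventuallyEq_one z] with n hn
  filter_upwards [hn] with y hy
  rw [hy, one_smul]

/-- The oscillatory integral is the limit of the integrals with cutoffs. Identities between
absolutely convergent integrals pass to oscillatory integrals in this way. -/
theorem IsAmplitude.tendsto_integral_cutoff {M : ℝ} {C : ℕ → ℝ} {f : PhaseSpace d → E}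
    (hf : IsAmplitude M C f) :
    Tendsto (fun n => ∫ z, chirp z • cutoff n z • f z) atTop (𝓝 (oscIntegral f)) := by
  obtain ⟨C', hC'⟩ := exists_isAmplitude_cutoff_smul (E := E) (d := d) M C
  refine (tendsto_oscIntegral (hC' f hf) hf (cutoff_smul_eventuallyEq f)).congr fun n => ?_
  obtain ⟨C'', h⟩ := exists_isAmplitude_cutoff_smul_decay hf n (-(2 * d) - 1)
  exact h.oscIntegral_eq_integral (by linarith)

theorem IsAmplitude.oscIntegral_coord_smul {M : ℝ} {C : ℕ → ℝ} {f : PhaseSpace d → E}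
    (hf : IsAmplitude M C f) (l : Fin d ⊕ Fin d) :
    oscIntegral (fun z => phaseCoord l z • f z) =
      (I / 2) • oscIntegral fun z => _root_.fderiv ℝ f z (dualDir l) := by
  obtain ⟨C', hC'⟩ := exists_isAmplitude_cutoff_smul (E := E) (d := d) M C
  have h1 := ((IsAmplitude.continuousLinearMap (phaseCoord l)).smul hf).tendsto_integral_cutoff
  have h2 : Tendsto (fun n => ∫ z, chirp z •
      _root_.fderiv ℝ (fun z => cutoff n z • f z) z (dualDir l)) atTop
      (𝓝 (oscIntegral fun z => _root_.fderiv ℝ f z (dualDir l))) := by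
    refine (tendsto_oscIntegral (fun n => (hC' f hf n).fderiv.clm_apply (dualDir l))
      (hf.fderiv.clm_apply (dualDir l)) fun z => ?_).congr fun n => ?_
    · filter_upwards [cutoff_smul_eventuallyEq f z] with n hn
      filter_upwards [hn.fderiv (𝕜 := ℝ)] with y hy
      rw [hy]
    · obtain ⟨C'', h⟩ := exists_isAmplitude_cutoff_smul_decay hf n (-(2 * d) - 1)
      exact (h.fderiv.clm_apply (dualDir l)).oscIntegral_eq_integral (by linarith)
  refine tendsto_nhds_unique h1 ((h2.const_smul (I / 2)).congr fun n => ?_)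
  obtain ⟨C'', h⟩ := exists_isAmplitude_cutoff_smul_decay hf n (-(2 * d) - 2)
  rw [← integral_chirp_coord_smul h (by linarith) l]
  refine integral_congr_ae (Eventually.of_forall fun z => ?_)
  dsimp only
  rw [smul_comm (phaseCoord l z) (cutoff n z) (f z)]

end OscIntegral

/-! ### The total mass of the oscillating factor -/

section Normalization

open scoped FourierTransform

variable {d : ℕ} {E : Type*} [NormedAddCommGroup E] [NormedSpace ℝ E] [NormedSpace ℂ E]
  [IsScalarTower ℝ ℂ E]

/-- The integral `∫ e^{2i x · η} f(x) dx` in terms of the Fourier transform of Mathlib. -/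
theorem integral_exp_two_inner_mul (f : ConfigSpace d → ℂ) (η : ConfigSpace d) :
    ∫ x, cexp (2 * I * (⟪x, η⟫ : ℝ)) * f x = 𝓕 f (-(Real.pi⁻¹ • η)) := by
  rw [Real.fourier_eq']
  refine integral_congr_ae (Eventually.of_forall fun x => ?_)
  simp only [smul_eq_mul]
  congr 2
  rw [inner_neg_right, inner_smul_right]
  push_cast
  field_simp

theorem SchwartzMap.integral_fourier (f : 𝓢(ConfigSpace d, ℂ)) :
    ∫ ξ, 𝓕 (f : ConfigSpace d → ℂ) ξ = f 0 := by
  have h1 : 𝓕⁻ (𝓕 (f : ConfigSpace d → ℂ)) 0 = f 0 := by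
    rw [← SchwartzMap.fourier_coe, ← SchwartzMap.fourierInv_coe,
        FourierTransform.fourierInv_fourier_eq]
  rw [← h1, Real.fourierInv_eq']
  simp

/-- The complex-valued bump function as a Schwartz function. -/
def bumpSchwartz (d : ℕ) : 𝓢(ConfigSpace d, ℂ) :=
  HasCompactSupport.toSchwartzMap (f := fun x => ((bump d x : ℝ) : ℂ))
    ((bump d).hasCompactSupport.comp_left (g := ((↑) : ℝ → ℂ)) ofReal_zero)
    (ofRealCLM.contDiff.comp (bump d).contDiff)

theorem bumpSchwartz_apply (x : ConfigSpace d) : bumpSchwartz d x = ((bump d x : ℝ) : ℂ) := rfl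

/-- The integral of the truncated chirp, after integration in `x` and rescaling of `ξ`. -/
theorem integral_chirp_mul_cutoff (n : ℕ) :
    ∫ z : PhaseSpace d, chirp z * (cutoff n z : ℝ) =
      ∫ ξ : ConfigSpace d, bumpSchwartz d (((n + 1 : ℝ)⁻¹ ^ 2) • ξ) *
        𝓕 (bumpSchwartz d : ConfigSpace d → ℂ) (-(Real.pi⁻¹ • ξ)) := by
  set ε : ℝ := (n + 1 : ℝ)⁻¹ with hε
  have hε0 : 0 < ε := by positivity
  have hint : Integrable (fun z : PhaseSpace d => chirp z * (cutoff n z : ℝ)) := by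
    obtain ⟨C₀, hC₀⟩ := exists_isAmplitude_cutoff d
    obtain ⟨C, hC⟩ := exists_isAmplitude_of_hasCompactSupport (hC₀ n).smooth
      (hasCompactSupport_cutoff n) (-(2 * d) - 1)
    refine integrable_of_norm_le_rpow (contDiff_chirp.continuous.mul
      (continuous_ofReal.comp hC.continuous))
      (r := -(2 * d) - 1) (by linarith) (c := C 0) fun z => ?_
    rw [norm_mul, norm_chirp, one_mul, norm_real]
    exact hC.norm_le z
  have hfin : Module.finrank ℝ (ConfigSpace d) = d := by simp
  rw [Measure.volume_eq_prod, integral_prod_symm _ (by rwa [← Measure.volume_eq_prod])]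
  have h1 (ξ : ConfigSpace d) : ∫ x, chirp (x, ξ) * (cutoff n (x, ξ) : ℝ) =
      ((ε ^ d)⁻¹ : ℝ) • (bumpSchwartz d (ε • ξ) *
        𝓕 (bumpSchwartz d : ConfigSpace d → ℂ) (-(Real.pi⁻¹ • ε⁻¹ • ξ))) := by
    rw [← integral_exp_two_inner_mul, ← integral_const_mul]
    have := Measure.integral_comp_smul (volume : Measure (ConfigSpace d)) (fun x =>
      bumpSchwartz d (ε • ξ) * (cexp (2 * I * (⟪x, ε⁻¹ • ξ⟫ : ℝ)) * bumpSchwartz d x)) ε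
    rw [hfin, abs_of_pos (by positivity)] at this
    rw [← this]
    refine integral_congr_ae (Eventually.of_forall fun x => ?_)
    simp only [chirp, cutoff, bumpSchwartz_apply, inner_smul_left, inner_smul_right]
    rw [RCLike.conj_to_real, inv_mul_cancel_left₀ hε0.ne', ← hε]
    push_cast
    ring
  simp_rw [h1]
  have h2 := Measure.integral_comp_smul (volume : Measure (ConfigSpace d)) (fun ξ =>
      ((ε ^ d)⁻¹ : ℝ) • (bumpSchwartz d ((ε ^ 2) • ξ) *
        𝓕 (bumpSchwartz d : ConfigSpace d → ℂ) (-(Real.pi⁻¹ • ξ)))) ε⁻¹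
  have hc : (ε⁻¹ ^ d)⁻¹ * (ε ^ d)⁻¹ = 1 := by
    rw [← mul_inv, ← mul_pow, inv_mul_cancel₀ hε0.ne', one_pow, inv_one]
  rw [hfin, abs_of_pos (by positivity), integral_smul _ (fun ξ : ConfigSpace d =>
    bumpSchwartz d ((ε ^ 2) • ξ) * _), smul_smul, hc, one_smul] at h2
  rw [← h2]
  refine integral_congr_ae (Eventually.of_forall fun ξ => ?_)
  simp only [smul_smul]
  rw [show ε ^ 2 * ε⁻¹ = ε by field_simp]

/-- The limit is `∫ 𝓕 φ(-ξ / π) dξ` with `φ 0 = 1`, which Fourier inversion evaluates. -/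
theorem tendsto_integral_chirp_mul_cutoff :
    Tendsto (fun n => ∫ z : PhaseSpace d, chirp z * (cutoff n z : ℝ)) atTop
      (𝓝 ((Real.pi : ℂ) ^ d)) := by
  set χ := bumpSchwartz d with hχ
  have hfin : Module.finrank ℝ (ConfigSpace d) = d := by simp
  have h1 : ∫ ξ : ConfigSpace d, 𝓕 (χ : ConfigSpace d → ℂ) (-(Real.pi⁻¹ • ξ)) =
      (Real.pi : ℂ) ^ d := by
    have := Measure.integral_comp_smul (volume : Measure (ConfigSpace d))
      (fun ξ => 𝓕 (χ : ConfigSpace d → ℂ) ξ) (-Real.pi⁻¹)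
    simp only [neg_smul] at this
    rw [this, hfin, SchwartzMap.integral_fourier, bumpSchwartz_apply,
      (bump d).one_of_mem_closedBall (by simp [bump]), abs_inv, abs_pow, abs_neg, abs_inv,
      abs_of_pos Real.pi_pos]
    simp
  have hint : Integrable fun ξ : ConfigSpace d => 𝓕 (χ : ConfigSpace d → ℂ) (-(Real.pi⁻¹ • ξ)) := by
    have := ((𝓕 χ).integrable (μ := volume)).comp_smul (R := -Real.pi⁻¹)
      (neg_ne_zero.2 (inv_ne_zero Real.pi_ne_zero))
    simpa only [neg_smul, SchwartzMap.fourier_coe] using this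
  simp_rw [integral_chirp_mul_cutoff]
  rw [← h1]
  refine tendsto_integral_of_dominated_convergence
    (fun ξ => ‖𝓕 (χ : ConfigSpace d → ℂ) (-(Real.pi⁻¹ • ξ))‖) (fun n => ?_) hint.norm
    (fun n => Eventually.of_forall fun ξ => ?_) (Eventually.of_forall fun ξ => ?_)
  · exact ((χ.continuous.comp (continuous_const_smul _)).aestronglyMeasurable).mul
      hint.aestronglyMeasurable
  · rw [norm_mul]
    refine mul_le_of_le_one_left (norm_nonneg _) ?_
    rw [bumpSchwartz_apply, norm_real, Real.norm_of_nonneg (bump d).nonneg]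
    exact (bump d).le_one
  · have h2 : Tendsto (fun n : ℕ => ((n + 1 : ℝ)⁻¹ ^ 2) • ξ) atTop (𝓝 0) := by
      have : Tendsto (fun n : ℕ => (n + 1 : ℝ)⁻¹) atTop (𝓝 0) := by
        simpa [one_div] using tendsto_one_div_add_atTop_nhds_zero_nat (𝕜 := ℝ)
      simpa using (this.pow 2).smul_const ξ
    have h3 := (χ.continuous.tendsto 0).comp h2
    have h4 : χ 0 = 1 := by
      rw [bumpSchwartz_apply, (bump d).one_of_mem_closedBall (by simp [bump]), ofReal_one]
    rw [h4] at h3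
    simpa using h3.mul_const (𝓕 (χ : ConfigSpace d → ℂ) (-(Real.pi⁻¹ • ξ)))

/-- The total mass of the oscillating factor. -/
theorem oscIntegral_const [CompleteSpace E] (e : E) :
    oscIntegral (fun _ : PhaseSpace d => e) = (Real.pi : ℂ) ^ d • e := by
  refine tendsto_nhds_unique (IsAmplitude.const e).tendsto_integral_cutoff
    ((tendsto_integral_chirp_mul_cutoff.smul_const e).congr fun n => ?_)
  rw [← integral_smul_const]
  refine integral_congr_ae (Eventually.of_forall fun z => ?_)
  simp only [← smul_smul, ofReal_smul_of_tower]

end Normalization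

/-! ### Differentiation of oscillatory integrals with respect to parameters -/

section Parameter

set_option linter.unusedSectionVars false

variable {d : ℕ} {E : Type*} [NormedAddCommGroup E] [NormedSpace ℝ E] [NormedSpace ℂ E]
  [IsScalarTower ℝ ℂ E]
variable {P : Type*} [NormedAddCommGroup P] [NormedSpace ℝ P]
variable {V : Type*} [NormedAddCommGroup V] [NormedSpace ℝ V]

theorem hasFDerivAt_partial_left {F : Type*} [NormedAddCommGroup F] [NormedSpace ℝ F]
    {g : P × V → F} (hg : ContDiff ℝ ∞ g) (p : P) (z : V) :
    HasFDerivAt (fun p => g (p, z)) ((fderiv ℝ g (p, z)).comp (ContinuousLinearMap.inl ℝ P V)) p :=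
  (hg.differentiable (by simp) (p, z)).hasFDerivAt.comp p (hasFDerivAt_prodMk_left p z)

theorem hasFDerivAt_partial_right {F : Type*} [NormedAddCommGroup F] [NormedSpace ℝ F]
    {g : P × V → F} (hg : ContDiff ℝ ∞ g) (p : P) (z : V) :
    HasFDerivAt (fun z => g (p, z)) ((fderiv ℝ g (p, z)).comp (ContinuousLinearMap.inr ℝ P V)) z :=
  (hg.differentiable (by simp) (p, z)).hasFDerivAt.comp z (hasFDerivAt_prodMk_right p z)

/-- Partial derivatives in complementary variables commute. -/
theorem hasFDerivAt_fderiv_partial {F : Type*} [NormedAddCommGroup F] [NormedSpace ℝ F]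
    {g : P × V → F} (hg : ContDiff ℝ ∞ g) (p : P) (z v : V) :
    HasFDerivAt (fun p => fderiv ℝ (fun z => g (p, z)) z v)
      (fderiv ℝ (fun z => fderiv ℝ (fun p => g (p, z)) p) z v) p := by
  have hg' : ContDiff ℝ ∞ (fderiv ℝ g) := hg.fderiv_right (by simp)
  have e1 : (fun p => fderiv ℝ (fun z => g (p, z)) z v) = fun p => fderiv ℝ g (p, z) (0, v) := by
    ext1 p
    rw [(hasFDerivAt_partial_right hg p z).fderiv]
    simp
  have e2 : (fun z => fderiv ℝ (fun p => g (p, z)) p) =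
      fun z => (fderiv ℝ g (p, z)).comp (ContinuousLinearMap.inl ℝ P V) := by
    ext1 z
    exact (hasFDerivAt_partial_left hg p z).fderiv
  have h1 := (hasFDerivAt_partial_left hg' p z).clm_apply (hasFDerivAt_const ((0 : P), v) p)
  have h2 := (hasFDerivAt_partial_right hg' p z).clm_comp
    (hasFDerivAt_const (ContinuousLinearMap.inl ℝ P V) z)
  rw [e1, e2, h2.fderiv]
  convert h1 using 1
  ext q
  have hs := (hg.contDiffAt (x := (p, z))).isSymmSndFDerivAt
    (by simp; exact WithTop.coe_le_coe.2 le_top)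
  simpa using hs (0, v) (q, 0)

theorem contDiff_partial_right_apply {F : Type*} [NormedAddCommGroup F] [NormedSpace ℝ F]
    {g : P × V → F} (hg : ContDiff ℝ ∞ g) (v : V) :
    ContDiff ℝ ∞ fun q : P × V => fderiv ℝ (fun z => g (q.1, z)) q.2 v := by
  have : (fun q : P × V => fderiv ℝ (fun z => g (q.1, z)) q.2 v) =
      fun q => fderiv ℝ g q (0, v) := by
    ext1 q
    rw [(hasFDerivAt_partial_right hg q.1 q.2).fderiv]
    simp
  rw [this]
  exact (hg.fderiv_right (m := ∞) (by simp)).clm_apply contDiff_const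

variable {f : P → PhaseSpace d → E}

theorem contDiff_uncurry_weighted (hf : ContDiff ℝ ∞ fun q : P × PhaseSpace d => f q.1 q.2)
    (l : Fin d ⊕ Fin d) : ContDiff ℝ ∞ fun q : P × PhaseSpace d =>
      (invBracketSq q.2 • phaseCoord l q.2) • f q.1 q.2 :=
  ((contDiff_invBracketSq.comp contDiff_snd).smul ((phaseCoord l).contDiff.comp contDiff_snd)).smul
    hf

theorem contDiff_uncurry_oscStep (hf : ContDiff ℝ ∞ fun q : P × PhaseSpace d => f q.1 q.2) :
    ContDiff ℝ ∞ fun q : P × PhaseSpace d => oscStep (f q.1) q.2 := by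
  refine ((contDiff_invBracketSq.comp contDiff_snd).smul hf).add
    (ContDiff.const_smul _ (ContDiff.sum fun l _ => ?_))
  exact contDiff_partial_right_apply (contDiff_uncurry_weighted hf l) _

theorem contDiff_uncurry_oscStep_iterate
    (hf : ContDiff ℝ ∞ fun q : P × PhaseSpace d => f q.1 q.2) (K : ℕ) :
    ContDiff ℝ ∞ fun q : P × PhaseSpace d => (oscStep^[K] (f q.1)) q.2 := by
  induction K with
  | zero => exact hf
  | succ K ih =>
    simp only [Function.iterate_succ_apply']
    exact contDiff_uncurry_oscStep (f := fun p => oscStep^[K] (f p)) ih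

theorem hasFDerivAt_oscStep (hf : ContDiff ℝ ∞ fun q : P × PhaseSpace d => f q.1 q.2)
    (p : P) (z : PhaseSpace d) :
    HasFDerivAt (fun p => oscStep (f p) z)
      (oscStep (fun z => fderiv ℝ (fun p => f p z) p) z) p := by
  have h0 : HasFDerivAt (fun p => f p z) (fderiv ℝ (fun p => f p z) p) p :=
    (hasFDerivAt_partial_left hf p z).differentiableAt.hasFDerivAt
  have h1 (l : Fin d ⊕ Fin d) := hasFDerivAt_fderiv_partial (contDiff_uncurry_weighted hf l) p z
    (dualDir l)
  have h2 (l : Fin d ⊕ Fin d) : (fun z => fderiv ℝ (fun p =>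
      (invBracketSq z • phaseCoord l z) • f p z) p) =
      fun z => (invBracketSq z • phaseCoord l z) • fderiv ℝ (fun p => f p z) p := by
    ext1 z
    exact fderiv_fun_const_smul (hasFDerivAt_partial_left hf p z).differentiableAt _
  simp only [h2] at h1
  exact (h0.const_smul (invBracketSq z)).add
    ((HasFDerivAt.fun_sum fun l _ => h1 l).const_smul (I / 2))

theorem hasFDerivAt_oscStep_iterate (hf : ContDiff ℝ ∞ fun q : P × PhaseSpace d => f q.1 q.2)
    (K : ℕ) (p : P) (z : PhaseSpace d) :
    HasFDerivAt (fun p => (oscStep^[K] (f p)) z)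
      ((oscStep^[K] (fun z => fderiv ℝ (fun p => f p z) p)) z) p := by
  induction K generalizing z with
  | zero => exact (hasFDerivAt_partial_left hf p z).differentiableAt.hasFDerivAt
  | succ K ih =>
    simp only [Function.iterate_succ_apply']
    have h := hasFDerivAt_oscStep (f := fun p => oscStep^[K] (f p))
      (contDiff_uncurry_oscStep_iterate hf K) p z
    have e : (fun z => fderiv ℝ (fun p => (oscStep^[K] (f p)) z) p) =
        oscStep^[K] (fun z => fderiv ℝ (fun p => f p z) p) := by
      ext1 z
      exact (ih z).fderiv
    rwa [e] at h

/-- Differentiation under the oscillatory integral. -/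
theorem hasFDerivAt_oscIntegral (hf : ContDiff ℝ ∞ fun q : P × PhaseSpace d => f q.1 q.2)
    {M : ℝ} {C C' : ℕ → ℝ} {p₀ : P} (h : ∀ᶠ p in 𝓝 p₀, IsAmplitude M C (f p))
    (h' : ∀ᶠ p in 𝓝 p₀, IsAmplitude M C' fun z => fderiv ℝ (fun p => f p z) p) :
    HasFDerivAt (fun p => oscIntegral (f p))
      (oscIntegral fun z => fderiv ℝ (fun p => f p z) p₀) p₀ := by
  obtain ⟨K, hK⟩ := IsAmplitude.exists_steps d M
  obtain ⟨C'', hC''⟩ := exists_isAmplitude_oscStep_iterate (E := P →L[ℝ] E) (d := d) M C' K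
  have key : HasFDerivAt (fun p => ∫ z, chirp z • (oscStep^[K] (f p)) z)
      (∫ z, chirp z • (oscStep^[K] (fun z => fderiv ℝ (fun p => f p z) p₀)) z) p₀ := by
    refine hasFDerivAt_integral_of_dominated_of_fderiv_le
      (F' := fun p z => chirp z • (oscStep^[K] (fun z => fderiv ℝ (fun p => f p z) p)) z)
      (bound := fun z => C'' 0 * (1 + ‖z‖) ^ (M - K)) h' ?_ ?_ ?_ ?_ ?_ ?_
    · filter_upwards [h] with p hp
      exact (hp.integrable_oscStep_iterate hK).aestronglyMeasurable
    · exact h.self_of_nhds.integrable_oscStep_iterate hK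
    · exact (h'.self_of_nhds.integrable_oscStep_iterate hK).aestronglyMeasurable
    · refine Eventually.of_forall fun z p hp => ?_
      rw [norm_smul, norm_chirp, one_mul]
      exact (hC'' _ hp).norm_le z
    · exact integrable_of_norm_le_rpow (d := d) (f := fun z => C'' 0 * (1 + ‖z‖) ^ (M - K))
        (continuous_const.mul ((continuous_const.add continuous_norm).rpow_const
          fun z => Or.inl (one_add_norm_pos z).ne')) (c := |C'' 0|) hK fun z => by
            rw [norm_mul, Real.norm_eq_abs, Real.norm_of_nonneg (by positivity)]
    · exact Eventually.of_forall fun z p _ => (hasFDerivAt_oscStep_iterate hf K p z).const_smul _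
  rw [h'.self_of_nhds.oscIntegral_eq hK]
  refine key.congr_of_eventuallyEq ?_
  filter_upwards [h] with p hp
  exact hp.oscIntegral_eq hK

end Parameter

/-! ### Symbols -/

section Symbol

variable {X : Type*} [NormedAddCommGroup X] [NormedSpace ℝ X]
variable {E : Type*} [NormedAddCommGroup E] [NormedSpace ℝ E]

/-- `f` is a symbol of order `m` with constants `C`: every derivative improves the decay by a
factor `(1 + ‖z‖)⁻¹`. -/
structure IsSymbol (m : ℝ) (C : ℕ → ℝ) (f : X → E) : Prop where
  smooth : ContDiff ℝ ∞ f
  bound : ∀ k z, ‖iteratedFDeriv ℝ k f z‖ ≤ C k * (1 + ‖z‖) ^ (m - k)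

namespace IsSymbol

theorem const_nonneg {m : ℝ} {C : ℕ → ℝ} {f : X → E} (hf : IsSymbol m C f) (k : ℕ) :
    0 ≤ C k := by
  have h := (norm_nonneg _).trans (hf.bound k 0)
  simpa using h

theorem isAmplitude {m : ℝ} {C : ℕ → ℝ} {f : X → E} (hf : IsSymbol m C f) :
    IsAmplitude m C f where
  smooth := hf.smooth
  bound k z := (hf.bound k z).trans <| by
    have := hf.const_nonneg k
    gcongr
    · exact one_le_one_add_norm z
    · linarith [(k.cast_nonneg : (0 : ℝ) ≤ k)]

theorem fderiv {m : ℝ} {C : ℕ → ℝ} {f : X → E} (hf : IsSymbol m C f) :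
    IsSymbol (m - 1) (fun k => C (k + 1)) (fderiv ℝ f) where
  smooth := hf.smooth.fderiv_right (by simp)
  bound k z := by
    rw [norm_iteratedFDeriv_fderiv]
    have := hf.bound (k + 1) z
    push_cast at this
    rwa [show m - 1 - k = m - (k + 1) by ring]

theorem clm_apply {F : Type*} [NormedAddCommGroup F] [NormedSpace ℝ F]
    {m : ℝ} {C : ℕ → ℝ} {f : X → F →L[ℝ] E} (hf : IsSymbol m C f) (v : F) :
    IsSymbol m (fun k => ‖v‖ * C k) (fun z => f z v) where
  smooth := hf.smooth.clm_apply contDiff_const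
  bound k z := by
    refine (norm_iteratedFDeriv_clm_apply_const (hf.smooth.contDiffAt (x := z))
      (mod_cast le_top)).trans ?_
    rw [mul_assoc]
    gcongr
    exact hf.bound k z

theorem add {m : ℝ} {C C' : ℕ → ℝ} {f g : X → E} (hf : IsSymbol m C f)
    (hg : IsSymbol m C' g) : IsSymbol m (fun k => C k + C' k) (fun z => f z + g z) where
  smooth := hf.smooth.add hg.smooth
  bound k z := by
    have h := iteratedFDeriv_add_apply (i := k) (x := z) (𝕜 := ℝ) (f := f) (g := g)
      ((hf.smooth.of_le (mod_cast le_top)).contDiffAt)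
      ((hg.smooth.of_le (mod_cast le_top)).contDiffAt)
    change ‖iteratedFDeriv ℝ k (f + g) z‖ ≤ _
    rw [h, add_mul]
    exact (norm_add_le _ _).trans (add_le_add (hf.bound k z) (hg.bound k z))

theorem zero (m : ℝ) : IsSymbol m (fun _ => 0) (fun _ : X => (0 : E)) where
  smooth := contDiff_const
  bound k z := by simp

theorem sum {ι : Type*} {m : ℝ} {C : ι → ℕ → ℝ} {f : ι → X → E} (s : Finset ι)
    (hf : ∀ i ∈ s, IsSymbol m (C i) (f i)) :
    IsSymbol m (fun k => ∑ i ∈ s, C i k) (fun z => ∑ i ∈ s, f i z) := by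
  classical
  induction s using Finset.induction_on with
  | empty => simpa using zero m
  | insert i s hi ih =>
    simp only [Finset.sum_insert hi]
    exact (hf i (by simp)).add (ih fun j hj => hf j (by simp [hj]))

theorem const_smul {𝕜 : Type*} [NormedField 𝕜] [NormedAlgebra ℝ 𝕜] [NormedSpace 𝕜 E]
    [IsScalarTower ℝ 𝕜 E] {m : ℝ} {C : ℕ → ℝ} {f : X → E} (c : 𝕜)
    (hf : IsSymbol m C f) : IsSymbol m (fun k => ‖c‖ * C k) (fun z => c • f z) where
  smooth := hf.smooth.const_smul c
  bound k z := by
    have := iteratedFDeriv_const_smul_apply' (𝕜 := ℝ) (i := k) (a := c) (x := z) (f := f)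
      ((hf.smooth.of_le (mod_cast le_top)).contDiffAt)
    rw [this, norm_smul, mul_assoc]
    gcongr
    exact hf.bound k z

end IsSymbol

/-- Directional derivatives commute with the total derivative. -/
theorem fderiv_fderiv_apply {f : X → E} (hf : ContDiff ℝ ∞ f) (b : X) :
    (fun z => fderiv ℝ (fderiv ℝ f) z b) = fderiv ℝ (fun y => fderiv ℝ f y b) := by
  ext z v
  have hf' : ContDiff ℝ ∞ (fderiv ℝ f) := hf.fderiv_right (by simp)
  have h1 := ((hf'.differentiable (by simp) z).hasFDerivAt).clm_apply (hasFDerivAt_const b z)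
  rw [h1.fderiv]
  have hs := (hf.contDiffAt (x := z)).isSymmSndFDerivAt (by simp; exact WithTop.coe_le_coe.2 le_top)
  simpa using hs b v

end Symbol

/-! ### The oscillatory mean and its Taylor expansion -/

section Expansion

set_option linter.unusedSectionVars false

variable {d : ℕ} {E : Type*} [NormedAddCommGroup E] [NormedSpace ℝ E] [NormedSpace ℂ E]
  [IsScalarTower ℝ ℂ E]

/-- The direction of a coordinate. -/
def coordDir : Fin d ⊕ Fin d → PhaseSpace d
  | .inl k => (EuclideanSpace.single k 1, 0)
  | .inr k => (0, EuclideanSpace.single k 1)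

theorem sum_phaseCoord_smul (z : PhaseSpace d) : ∑ l, phaseCoord l z • coordDir l = z := by
  rw [Fintype.sum_sum_type]
  refine Prod.ext ?_ ?_ <;> ext k <;>
    simp [coordDir, phaseCoord, Prod.fst_sum, Prod.snd_sum, Finset.sum_apply,
      Pi.single_apply]

/-- The operator `(i/2) ∂_x · ∂_ξ = -(i/2) D_x · D_ξ`, in a form symmetric in `x` and `ξ`. -/
def crossOp (f : PhaseSpace d → E) (z : PhaseSpace d) : E :=
  (I / 4) • ∑ l, fderiv ℝ (fun y => fderiv ℝ f y (coordDir l)) z (dualDir l)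

theorem IsSymbol.exists_crossOp (m : ℝ) (C : ℕ → ℝ) :
    ∃ C' : ℕ → ℝ, ∀ f : PhaseSpace d → E, IsSymbol m C f → IsSymbol (m - 2) C' (crossOp f) := by
  refine ⟨fun k => ‖I / 4‖ * ∑ l : Fin d ⊕ Fin d, ‖dualDir l‖ * (‖coordDir l‖ * C (k + 1 + 1)),
    fun f hf => IsSymbol.const_smul _ (IsSymbol.sum _ fun l _ => ?_)⟩
  have h := ((hf.fderiv.clm_apply (coordDir l)).fderiv).clm_apply (dualDir l)
  rwa [show m - 1 - 1 = m - 2 by ring] at h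

theorem contDiff_crossOp {f : PhaseSpace d → E} (hf : ContDiff ℝ ∞ f) :
    ContDiff ℝ ∞ (crossOp f) := by
  refine ContDiff.const_smul _ (ContDiff.sum fun l _ => ?_)
  have h : ContDiff ℝ ∞ fun y => fderiv ℝ f y (coordDir l) :=
    (hf.fderiv_right (m := ∞) (by simp)).clm_apply contDiff_const
  exact (h.fderiv_right (m := ∞) (by simp)).clm_apply contDiff_const

theorem contDiff_crossOp_iterate {f : PhaseSpace d → E} (hf : ContDiff ℝ ∞ f) (j : ℕ) :
    ContDiff ℝ ∞ (crossOp^[j] f) := by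
  induction j with
  | zero => exact hf
  | succ j ih => rw [Function.iterate_succ_apply']; exact contDiff_crossOp ih

theorem crossOp_fderiv {f : PhaseSpace d → E} (hf : ContDiff ℝ ∞ f) :
    crossOp (fderiv ℝ f) = fderiv ℝ (crossOp f) := by
  have h (l : Fin d ⊕ Fin d) : ContDiff ℝ ∞ fun y => fderiv ℝ f y (coordDir l) :=
    (hf.fderiv_right (m := ∞) (by simp)).clm_apply contDiff_const
  have h' (l : Fin d ⊕ Fin d) : ContDiff ℝ ∞
      fun z => fderiv ℝ (fun y => fderiv ℝ f y (coordDir l)) z (dualDir l) :=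
    ((h l).fderiv_right (m := ∞) (by simp)).clm_apply contDiff_const
  ext1 z
  have e : fderiv ℝ (crossOp f) z = (I / 4) • ∑ l, fderiv ℝ
      (fun z => fderiv ℝ (fun y => fderiv ℝ f y (coordDir l)) z (dualDir l)) z :=
    ((HasFDerivAt.fun_sum fun l _ =>
      ((h' l).differentiable (by simp) z).hasFDerivAt).const_smul (I / 4)).fderiv
  rw [e, crossOp]
  congr 1
  refine Finset.sum_congr rfl fun l _ => ?_
  rw [fderiv_fderiv_apply hf (coordDir l)]
  exact congrFun (fderiv_fderiv_apply (h l) (dualDir l)) z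

theorem crossOp_iterate_fderiv {f : PhaseSpace d → E} (hf : ContDiff ℝ ∞ f) (j : ℕ) :
    crossOp^[j] (fderiv ℝ f) = fderiv ℝ (crossOp^[j] f) := by
  induction j with
  | zero => rfl
  | succ j ih =>
    rw [Function.iterate_succ_apply', ih, crossOp_fderiv (contDiff_crossOp_iterate hf j),
      Function.iterate_succ_apply']

theorem IsSymbol.exists_crossOp_iterate (m : ℝ) (C : ℕ → ℝ) (j : ℕ) :
    ∃ C' : ℕ → ℝ, ∀ f : PhaseSpace d → E, IsSymbol m C f →
      IsSymbol (m - 2 * j) C' (crossOp^[j] f) := by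
  induction j with
  | zero => exact ⟨C, fun f hf => by simpa using hf⟩
  | succ j ih =>
    obtain ⟨C', h'⟩ := ih
    obtain ⟨C'', h''⟩ := exists_crossOp (E := E) (d := d) (m - 2 * j) C'
    refine ⟨C'', fun f hf => ?_⟩
    rw [Function.iterate_succ_apply']
    have := h'' _ (h' f hf)
    rwa [show m - 2 * j - 2 = m - 2 * (j + 1 : ℕ) by push_cast; ring] at this

/-- The normalized oscillatory mean `π^{-d} ∫ e^{2i y · η} f(w + s (y, η)) dy dη`, which is
`exp((i s² / 2) ∂_x · ∂_ξ) f` at `w`. -/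
def oscMean (s : ℝ) (f : PhaseSpace d → E) (w : PhaseSpace d) : E :=
  ((Real.pi : ℂ) ^ d)⁻¹ • oscIntegral fun z => f (w + s • z)

theorem oscMean_zero [CompleteSpace E] (f : PhaseSpace d → E) (w : PhaseSpace d) :
    oscMean 0 f w = f w := by
  have h : (Real.pi : ℂ) ^ d ≠ 0 := pow_ne_zero _ (ofReal_ne_zero.2 Real.pi_ne_zero)
  simp only [oscMean, zero_smul, add_zero]
  rw [oscIntegral_const, smul_smul, inv_mul_cancel₀ h, one_smul]

theorem exists_norm_oscMean_le (m : ℝ) (C : ℕ → ℝ) :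
    ∃ B : ℝ, 0 ≤ B ∧ ∀ f : PhaseSpace d → E, IsAmplitude m C f → ∀ s : ℝ, |s| ≤ 2 → ∀ w,
      ‖oscMean s f w‖ ≤ B * (1 + ‖w‖) ^ m := by
  obtain ⟨B, hB⟩ := exists_norm_oscIntegral_le (E := E) (d := d) |m|
    (fun k => 2 ^ k * C k * (1 + 2) ^ |m|)
  refine ⟨‖((Real.pi : ℂ) ^ d)⁻¹‖ * |B|, by positivity, fun f hf s hs w => ?_⟩
  have h0 : 0 < (1 + ‖w‖) ^ m := by positivity
  -- Dividing by the weight at `w` makes the constants of `z ↦ f (w + s z)` independent of `w`.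
  have h1 := hf.comp_affine hs w
  have h2 : IsAmplitude |m| (fun k => 2 ^ k * C k * (1 + 2) ^ |m|)
      (fun z => ((((1 + ‖w‖) ^ m)⁻¹ : ℝ) : ℂ) • f (w + s • z)) := by
    refine (h1.const_smul ((((1 + ‖w‖) ^ m)⁻¹ : ℝ) : ℂ)).mono le_rfl fun k => le_of_eq ?_
    rw [norm_real, Real.norm_of_nonneg (by positivity)]
    field_simp
  have h3 := hB _ h2
  rw [h1.oscIntegral_const_smul, norm_smul, norm_real, Real.norm_of_nonneg (by positivity),
    inv_mul_le_iff₀ h0] at h3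
  rw [oscMean, norm_smul, mul_assoc]
  gcongr
  refine h3.trans ?_
  rw [mul_comm]
  gcongr
  exact le_abs_self B

theorem IsAmplitude.hasFDerivAt_oscMean {m : ℝ} {C : ℕ → ℝ} {f : PhaseSpace d → E}
    (hf : IsAmplitude m C f) (s : ℝ) (w : PhaseSpace d) :
    HasFDerivAt (oscMean s f) (oscMean s (_root_.fderiv ℝ f) w) w := by
  have hsm : ContDiff ℝ ∞ fun q : PhaseSpace d × PhaseSpace d => f (q.1 + s • q.2) :=
    hf.smooth.comp (contDiff_fst.add (contDiff_snd.const_smul s))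
  have hw : ∀ᶠ w' in 𝓝 w, (1 + ‖w'‖) ^ m < (1 + ‖w‖) ^ m + 1 :=
    (((continuous_const.add continuous_norm).rpow_const
      fun z => Or.inl (one_add_norm_pos z).ne').continuousAt.eventually_lt continuousAt_const
        (lt_add_one _))
  have e (w' : PhaseSpace d) : (fun z => _root_.fderiv ℝ (fun p => f (p + s • z)) w') =
      fun z => _root_.fderiv ℝ f (w' + s • z) := by
    ext1 z
    exact fderiv_comp_add_right (s • z)
  have key := hasFDerivAt_oscIntegral (f := fun w z => f (w + s • z)) hsm (M := |m|)
    (C := fun k => |s| ^ k * C k * ((1 + |s|) ^ |m| * ((1 + ‖w‖) ^ m + 1)))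
    (C' := fun k => |s| ^ k * C (k + 1) * ((1 + |s|) ^ |m| * ((1 + ‖w‖) ^ m + 1))) (p₀ := w) ?_ ?_
  · rw [e] at key
    exact key.const_smul (((Real.pi : ℂ) ^ d)⁻¹)
  · filter_upwards [hw] with w' hw'
    refine (hf.comp_affine le_rfl w').mono le_rfl fun k => ?_
    have := hf.const_nonneg k
    gcongr
  · filter_upwards [hw] with w' hw'
    rw [e]
    refine (hf.fderiv.comp_affine le_rfl w').mono le_rfl fun k => ?_
    have := hf.const_nonneg (k + 1)
    gcongr

theorem IsAmplitude.oscIntegral_apply {F : Type*} [NormedAddCommGroup F] [NormedSpace ℝ F]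
    {M : ℝ} {C : ℕ → ℝ} {f : PhaseSpace d → F →L[ℝ] E} (hf : IsAmplitude M C f) (v : F) :
    oscIntegral f v = oscIntegral fun z => f z v := by
  have h1 := hf.tendsto_integral_cutoff
  have h2 := (hf.clm_apply v).tendsto_integral_cutoff
  have h3 := ((ContinuousLinearMap.apply ℝ E v).continuous.tendsto _).comp h1
  refine tendsto_nhds_unique h3 (h2.congr fun n => ?_)
  obtain ⟨C'', h⟩ := exists_isAmplitude_cutoff_smul_decay hf n (-(2 * d) - 1)
  simp only [Function.comp_apply, ContinuousLinearMap.apply_apply]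
  rw [ContinuousLinearMap.integral_apply (h.integrable_chirp_smul (by linarith))]
  rfl

theorem IsAmplitude.clm_comp {F X : Type*} [NormedAddCommGroup F] [NormedSpace ℝ F]
    [NormedAddCommGroup X] [NormedSpace ℝ X] {M : ℝ} {C : ℕ → ℝ} {f : X → E}
    (hf : IsAmplitude M C f) (L : E →L[ℝ] F) :
    IsAmplitude M (fun k => ‖L‖ * C k) fun z => L (f z) where
  smooth := L.contDiff.comp hf.smooth
  bound k z := by
    refine (L.norm_iteratedFDeriv_comp_left (hf.smooth.contDiffAt (x := z)) (n := k)
      (mod_cast le_top)).trans ?_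
    rw [mul_assoc]
    gcongr
    exact hf.bound k z

/-- The evolution equation of the oscillatory mean, which solves `∂_t u = (i/2) ∂_x · ∂_ξ u` in the
time `t = s²`. -/
theorem IsAmplitude.hasDerivAt_oscMean {m : ℝ} {C : ℕ → ℝ} {f : PhaseSpace d → E}
    (hf : IsAmplitude m C f) (w : PhaseSpace d) (s : ℝ) :
    HasDerivAt (fun s => oscMean s f w) ((2 * s) • oscMean s (crossOp f) w) s := by
  have hsm : ContDiff ℝ ∞ fun q : ℝ × PhaseSpace d => f (w + q.1 • q.2) :=
    hf.smooth.comp (contDiff_const.add (contDiff_fst.smul contDiff_snd))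
  have hs : ∀ᶠ r in 𝓝 s, |r| < |s| + 1 :=
    continuous_abs.continuousAt.eventually_lt continuousAt_const (lt_add_one _)
  -- The derivative in `s` is expanded in coordinates.
  have e (r : ℝ) (z : PhaseSpace d) : HasDerivAt (fun r => f (w + r • z))
      (∑ l, phaseCoord l z • _root_.fderiv ℝ f (w + r • z) (coordDir l)) r := by
    have h1 : HasDerivAt (fun r : ℝ => w + r • z) z r := by
      simpa using ((hasDerivAt_id r).smul_const z).const_add w
    have h2 := (hf.smooth.differentiable (by simp) (w + r • z)).hasFDerivAt.comp_hasDerivAt r h1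
    refine HasDerivAt.congr_deriv h2 ?_
    simp_rw [← map_smul]
    rw [← map_sum, sum_phaseCoord_smul]
  have a1 (r : ℝ) (l : Fin d ⊕ Fin d) :=
      ((hf.fderiv.comp_affine (le_refl |r|) w).clm_apply (coordDir l))
  have a2 (r : ℝ) (hr : |r| ≤ |s| + 1) :
      IsAmplitude (1 + |m|) _ fun z => ∑ l, phaseCoord l z •
        _root_.fderiv ℝ f (w + r • z) (coordDir l) :=
    IsAmplitude.sum _ fun l _ => (IsAmplitude.continuousLinearMap (phaseCoord l)).smul
      ((hf.fderiv.comp_affine hr w).clm_apply (coordDir l))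
  set J : E →L[ℝ] (ℝ →L[ℝ] E) := ContinuousLinearMap.smulRightL ℝ ℝ E 1 with hJ
  have e' (r : ℝ) : (fun z => _root_.fderiv ℝ (fun r => f (w + r • z)) r) =
      fun z => J (∑ l, phaseCoord l z • _root_.fderiv ℝ f (w + r • z) (coordDir l)) := by
    ext1 z
    rw [(e r z).hasFDerivAt.fderiv]
    ext
    simp [hJ]
  have key := hasFDerivAt_oscIntegral (f := fun r z => f (w + r • z)) hsm (M := 1 + |m|)
    (C := fun k => (|s| + 1) ^ k * C k * ((1 + (|s| + 1)) ^ |m| * (1 + ‖w‖) ^ m)) (p₀ := s)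
    (C' := _) ?_ (by
      filter_upwards [hs] with r hr
      rw [e']
      exact (a2 r hr.le).clm_comp J)
  · have key' := key.hasDerivAt.const_smul (((Real.pi : ℂ) ^ d)⁻¹)
    refine HasDerivAt.congr_deriv key' ?_
    symm
    have a3 := (a2 s (by linarith)).clm_comp J
    rw [e', a3.oscIntegral_apply]
    have e2 : (fun z => J (∑ l, phaseCoord l z • _root_.fderiv ℝ f (w + s • z) (coordDir l)) 1) =
        fun z => ∑ l, phaseCoord l z • _root_.fderiv ℝ f (w + s • z) (coordDir l) := by
      ext z
      simp [hJ]
    have e3 (l : Fin d ⊕ Fin d) : (fun z => _root_.fderiv ℝ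
        (fun z => _root_.fderiv ℝ f (w + s • z) (coordDir l)) z (dualDir l)) =
        fun z => (s : ℂ) • _root_.fderiv ℝ (fun y => _root_.fderiv ℝ f y (coordDir l))
          (w + s • z) (dualDir l) := by
      ext1 z
      have h1 : HasFDerivAt (fun z : PhaseSpace d => w + s • z)
          (s • ContinuousLinearMap.id ℝ (PhaseSpace d)) z :=
        ((hasFDerivAt_id z).const_smul s).const_add w
      have h2 := (((hf.fderiv.clm_apply (coordDir l)).smooth.differentiable (by simp)
        (w + s • z)).hasFDerivAt).comp z h1
      have h3 := h2.fderiv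
      simp only [Function.comp_def] at h3
      rw [h3, ofReal_smul_of_tower]
      simp only [ContinuousLinearMap.comp_apply, _root_.smul_apply, ContinuousLinearMap.id_apply,
        map_smul]
    have a4 (l : Fin d ⊕ Fin d) := ((hf.fderiv.clm_apply (coordDir l)).fderiv.clm_apply
      (dualDir l)).comp_affine (le_refl |s|) w
    -- Each coordinate of `z` is traded for a derivative in the dual direction, which produces the
    -- second derivatives in `crossOp` and another factor `s`.
    rw [e2, oscIntegral_sum _ (fun l _ => (IsAmplitude.continuousLinearMap (phaseCoord l)).smul
      (a1 s l))]
    simp_rw [fun l => (a1 s l).oscIntegral_coord_smul l, e3,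
      fun l => (a4 l).oscIntegral_const_smul (s : ℂ)]
    rw [oscMean]
    simp only [crossOp]
    rw [(IsAmplitude.sum _ fun l _ => a4 l).oscIntegral_const_smul,
      oscIntegral_sum _ (fun l _ => a4 l), ← ofReal_smul_of_tower]
    simp_rw [← Finset.smul_sum, smul_smul]
    congr 1
    push_cast
    ring
  · filter_upwards [hs] with r hr
    exact (hf.comp_affine hr.le w).mono (by linarith) fun k => le_rfl

/-- The remainder of order `N` in the Taylor expansion of `exp((i s² / 2) ∂_x · ∂_ξ) f`. -/
def oscRemainder (N : ℕ) (s : ℝ) (f : PhaseSpace d → E) (w : PhaseSpace d) : E :=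
  oscMean s f w - ∑ j ∈ Finset.range N, (s ^ (2 * j) / (j ! : ℝ)) • (crossOp^[j] f) w

theorem IsAmplitude.hasDerivAt_oscRemainder {m : ℝ} {C : ℕ → ℝ} {f : PhaseSpace d → E}
    (hf : IsAmplitude m C f) (N : ℕ) (w : PhaseSpace d) (s : ℝ) :
    HasDerivAt (fun s => oscRemainder (N + 1) s f w)
      ((2 * s) • oscRemainder N s (crossOp f) w) s := by
  have h (j : ℕ) : HasDerivAt (fun s : ℝ => (s ^ (2 * (j + 1)) / ((j + 1)! : ℝ)) •
      (crossOp^[j + 1] f) w)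
      ((2 * s) • (s ^ (2 * j) / (j ! : ℝ)) • (crossOp^[j] (crossOp f)) w) s := by
    have h1 : HasDerivAt (fun s : ℝ => s ^ (2 * (j + 1)) / ((j + 1)! : ℝ))
        (2 * s * (s ^ (2 * j) / (j ! : ℝ))) s := by
      refine ((hasDerivAt_pow (2 * (j + 1)) s).div_const _).congr_deriv ?_
      have : ((j + 1)! : ℝ) ≠ 0 := by positivity
      have : (j ! : ℝ) ≠ 0 := by positivity
      rw [Nat.factorial_succ, show 2 * (j + 1) - 1 = 2 * j + 1 by omega]
      push_cast
      field_simp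
      ring
    rw [smul_smul]
    exact h1.smul_const _
  have e : (fun s => oscRemainder (N + 1) s f w) = fun s => oscMean s f w -
      (∑ j ∈ Finset.range N, (s ^ (2 * (j + 1)) / ((j + 1)! : ℝ)) • (crossOp^[j + 1] f) w +
        f w) := by
    ext1 s
    rw [oscRemainder, Finset.sum_range_succ']
    simp
  rw [e, oscRemainder, smul_sub, Finset.smul_sum]
  exact (hf.hasDerivAt_oscMean w s).sub ((HasDerivAt.fun_sum fun j _ => h j).add_const _)

theorem oscRemainder_zero [CompleteSpace E] (N : ℕ) (f : PhaseSpace d → E) (w : PhaseSpace d) :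
    oscRemainder (N + 1) 0 f w = 0 := by
  rw [oscRemainder, oscMean_zero, Finset.sum_range_succ']
  simp

/-- The remainder estimate, by integration of the evolution equation. -/
theorem exists_norm_oscRemainder_le [CompleteSpace E] (N : ℕ) (m : ℝ) (C : ℕ → ℝ) :
    ∃ B : ℝ, 0 ≤ B ∧ ∀ f : PhaseSpace d → E, IsSymbol m C f → ∀ s ∈ Set.Icc (0 : ℝ) 1, ∀ w,
      ‖oscRemainder N s f w‖ ≤ B * s ^ (2 * N) * (1 + ‖w‖) ^ (m - 2 * N) := by
  induction N generalizing m C with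
  | zero =>
    obtain ⟨B, hB0, hB⟩ := exists_norm_oscMean_le (E := E) (d := d) m C
    refine ⟨B, hB0, fun f hf s hs w => ?_⟩
    have := hB f hf.isAmplitude s (by rw [abs_of_nonneg hs.1]; linarith [hs.2]) w
    simpa [oscRemainder] using this
  | succ N ih =>
    obtain ⟨C', hC'⟩ := IsSymbol.exists_crossOp (E := E) (d := d) m C
    obtain ⟨B, hB0, hB⟩ := ih (m - 2) C'
    refine ⟨2 * B, by positivity, fun f hf s hs w => ?_⟩
    have hw : 0 < (1 + ‖w‖) ^ (m - 2 * (N + 1 : ℕ)) := by positivity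
    have h1 : ∀ r ∈ Set.Icc (0 : ℝ) s, HasDerivWithinAt (fun s => oscRemainder (N + 1) s f w)
        ((2 * r) • oscRemainder N r (crossOp f) w) (Set.Icc 0 s) r := fun r _ =>
      (hf.isAmplitude.hasDerivAt_oscRemainder N w r).hasDerivWithinAt
    have h2 := norm_image_sub_le_of_norm_deriv_le_segment' h1
      (C := 2 * s * (B * s ^ (2 * N) * (1 + ‖w‖) ^ (m - 2 * (N + 1 : ℕ)))) (fun r hr => ?_) s
      (Set.right_mem_Icc.2 hs.1)
    · rw [oscRemainder_zero, sub_zero] at h2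
      refine h2.trans (le_of_eq ?_)
      ring
    · have hr1 : r ≤ s := hr.2.le
      have h3 := hB _ (hC' f hf) r ⟨hr.1, hr1.trans hs.2⟩ w
      rw [show m - 2 - 2 * (N : ℝ) = m - 2 * (N + 1 : ℕ) by push_cast; ring] at h3
      have h0 := hr.1
      rw [norm_smul, Real.norm_of_nonneg (by linarith)]
      refine mul_le_mul (by linarith) (h3.trans (by gcongr)) (norm_nonneg _) (by linarith)

theorem IsSymbol.hasFDerivAt_oscRemainder {m : ℝ} {C : ℕ → ℝ} {f : PhaseSpace d → E}
    (hf : IsSymbol m C f) (N : ℕ) (s : ℝ) (w : PhaseSpace d) :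
    HasFDerivAt (oscRemainder N s f) (oscRemainder N s (_root_.fderiv ℝ f) w) w := by
  have h (j : ℕ) := (((contDiff_crossOp_iterate hf.smooth j).differentiable (by simp)
    w).hasFDerivAt).const_smul (s ^ (2 * j) / (j ! : ℝ))
  rw [oscRemainder]
  simp_rw [fun j => crossOp_iterate_fderiv hf.smooth j]
  exact (hf.isAmplitude.hasFDerivAt_oscMean s w).sub (HasFDerivAt.fun_sum fun j _ => h j)

end Expansion

/-- The remainder estimate for derivatives. The derivative of the remainder of `f` is the remainder
of `fderiv ℝ f`, a symbol of order `m - 1` with values in another normed space, so the induction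
runs over all spaces `E`. -/
theorem exists_norm_iteratedFDeriv_oscRemainder_le {d : ℕ} {E : Type*} [NormedAddCommGroup E]
    [NormedSpace ℝ E] [NormedSpace ℂ E] [IsScalarTower ℝ ℂ E] [CompleteSpace E] (k N : ℕ) (m : ℝ)
    (C : ℕ → ℝ) :
    ∃ B : ℝ, 0 ≤ B ∧ ∀ f : PhaseSpace d → E, IsSymbol m C f → ∀ s ∈ Set.Icc (0 : ℝ) 1,
      ContDiff ℝ k (oscRemainder N s f) ∧ ∀ w, ‖iteratedFDeriv ℝ k (oscRemainder N s f) w‖ ≤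
        B * s ^ (2 * N) * (1 + ‖w‖) ^ (m - 2 * N - k) := by
  induction k generalizing E m C with
  | zero =>
    obtain ⟨B, hB0, hB⟩ := exists_norm_oscRemainder_le (E := E) (d := d) N m C
    refine ⟨B, hB0, fun f hf s hs => ⟨?_, fun w => ?_⟩⟩
    · exact contDiff_zero.2 (continuous_iff_continuousAt.2 fun w =>
        (hf.hasFDerivAt_oscRemainder N s w).continuousAt)
    · simpa using hB f hf s hs w
  | succ k ih =>
    obtain ⟨B, hB0, hB⟩ := ih (E := PhaseSpace d →L[ℝ] E) (m - 1) fun k => C (k + 1)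
    refine ⟨B, hB0, fun f hf s hs => ?_⟩
    have e : fderiv ℝ (oscRemainder N s f) = oscRemainder N s (fderiv ℝ f) := by
      ext1 w
      exact (hf.hasFDerivAt_oscRemainder N s w).fderiv
    obtain ⟨h1, h2⟩ := hB _ hf.fderiv s hs
    refine ⟨?_, fun w => ?_⟩
    · push_cast
      rw [contDiff_succ_iff_fderiv]
      refine ⟨fun w => (hf.hasFDerivAt_oscRemainder N s w).differentiableAt, by simp, ?_⟩
      rw [e]
      exact h1
    · rw [← norm_iteratedFDeriv_fderiv, e]
      have := h2 w
      rwa [show m - 1 - 2 * (N : ℝ) - k = m - 2 * N - (k + 1 : ℕ) by push_cast; ring] at this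

/-! ### The chirp transform on Schwartz functions -/

section ChirpTransform

open scoped FourierTransform

variable {d : ℕ}

theorem hasTemperateGrowth_cexp_I_mul :
    Function.HasTemperateGrowth fun t : ℝ => cexp (I * t) := by
  have hs : ContDiff ℝ ∞ fun t : ℝ => cexp (I * t) :=
    (contDiff_const.mul ofRealCLM.contDiff).cexp
  refine ⟨hs, fun n => ⟨0, 1, fun t => ?_⟩⟩
  have h : iteratedDeriv n (fun t : ℝ => cexp (I * t)) = fun t : ℝ => I ^ n * cexp (I * t) := by
    induction n with
    | zero => simp
    | succ n ih =>
      ext t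
      rw [iteratedDeriv_succ, ih]
      have h1 : HasDerivAt (fun t : ℝ => cexp (I * t)) (cexp (I * t) * (I * 1)) t :=
        ((ofRealCLM.hasDerivAt (x := t)).const_mul I).cexp
      rw [(h1.const_mul (I ^ n)).deriv]
      ring
  rw [norm_iteratedFDeriv_eq_norm_iteratedDeriv, h]
  simp [mul_comm I, norm_exp_ofReal_mul_I]

theorem Function.HasTemperateGrowth.cexp_I_mul {X : Type*} [NormedAddCommGroup X] [NormedSpace ℝ X]
    {q : X → ℝ} (hq : q.HasTemperateGrowth) :
    Function.HasTemperateGrowth fun z => cexp (I * q z) :=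
  hasTemperateGrowth_cexp_I_mul.comp hq

theorem Function.HasTemperateGrowth.inner {X : Type*} [NormedAddCommGroup X] [NormedSpace ℝ X]
    {f g : X → ConfigSpace d} (hf : f.HasTemperateGrowth) (hg : g.HasTemperateGrowth) :
    Function.HasTemperateGrowth fun z => ⟪f z, g z⟫ :=
  (innerSL ℝ).bilinear_hasTemperateGrowth hf hg

theorem hasTemperateGrowth_chirp : Function.HasTemperateGrowth (chirp (d := d)) := by
  have h : Function.HasTemperateGrowth fun z : PhaseSpace d => 2 * ⟪z.1, z.2⟫ :=
    (Function.HasTemperateGrowth.const 2).mul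
      (Function.HasTemperateGrowth.inner
        (ContinuousLinearMap.fst ℝ (ConfigSpace d) (ConfigSpace d)).hasTemperateGrowth
        (ContinuousLinearMap.snd ℝ (ConfigSpace d) (ConfigSpace d)).hasTemperateGrowth)
  convert h.cexp_I_mul using 2 with z
  rw [chirp]
  push_cast
  ring_nf

theorem norm_iteratedFDeriv_comp_le_of_norm_le_one {X Y F : Type*} [NormedAddCommGroup X]
    [NormedSpace ℝ X] [NormedAddCommGroup Y] [NormedSpace ℝ Y] [NormedAddCommGroup F]
    [NormedSpace ℝ F] {f : Y → F} (hf : ContDiff ℝ ∞ f) (L : X →L[ℝ] Y) (hL : ‖L‖ ≤ 1) (n : ℕ)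
    (z : X) : ‖iteratedFDeriv ℝ n (fun z => f (L z)) z‖ ≤ ‖iteratedFDeriv ℝ n f (L z)‖ := by
  have h := L.iteratedFDeriv_comp_right hf z (i := n) (mod_cast le_top)
  rw [Function.comp_def] at h
  rw [h]
  refine (ContinuousMultilinearMap.norm_compContinuousLinearMap_le _ _).trans ?_
  refine mul_le_of_le_one_right (norm_nonneg _) ?_
  exact Finset.prod_le_one (fun _ _ => norm_nonneg _) fun _ _ => hL

/-- The tensor product `(x, ξ) ↦ f(x) g(ξ)` of two Schwartz functions. -/
def schwartzTensor (f g : 𝓢(ConfigSpace d, ℂ)) : 𝓢(PhaseSpace d, ℂ) where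
  toFun z := f z.1 * g z.2
  smooth' := ((f.smooth ⊤).comp contDiff_fst).mul ((g.smooth ⊤).comp contDiff_snd)
  decay' k n := by
    have hb (f : 𝓢(ConfigSpace d, ℂ)) (i : ℕ) (hi : i ≤ n) (x : ConfigSpace d) :
        (1 + ‖x‖) ^ k * ‖iteratedFDeriv ℝ i f x‖ ≤
          2 ^ k * (Finset.Iic (k, n)).sup (fun m => SchwartzMap.seminorm ℝ m.1 m.2) f :=
      SchwartzMap.one_add_le_sup_seminorm_apply (𝕜 := ℝ) (m := (k, n)) le_rfl hi f x
    set A := 2 ^ k * (Finset.Iic (k, n)).sup (fun m => SchwartzMap.seminorm ℝ m.1 m.2) f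
    set B := 2 ^ k * (Finset.Iic (k, n)).sup (fun m => SchwartzMap.seminorm ℝ m.1 m.2) g
    refine ⟨∑ i ∈ Finset.range (n + 1), (n.choose i : ℝ) * A * B, fun z => ?_⟩
    have h1 := norm_iteratedFDeriv_mul_le (𝕜 := ℝ) (n := n) (N := ∞)
      ((f.smooth ⊤).comp (contDiff_fst (E := ConfigSpace d) (F := ConfigSpace d)))
      ((g.smooth ⊤).comp (contDiff_snd (E := ConfigSpace d) (F := ConfigSpace d))) z
      (mod_cast le_top)
    calc ‖z‖ ^ k * ‖iteratedFDeriv ℝ n (fun z : PhaseSpace d => f z.1 * g z.2) z‖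
        ≤ ((1 + ‖z.1‖) ^ k * (1 + ‖z.2‖) ^ k) * ∑ i ∈ Finset.range (n + 1),
          (n.choose i : ℝ) * ‖iteratedFDeriv ℝ i (fun z : PhaseSpace d => f z.1) z‖ *
            ‖iteratedFDeriv ℝ (n - i) (fun z : PhaseSpace d => g z.2) z‖ := by
          rw [← mul_pow]
          gcongr
          · rw [Prod.norm_def]
            refine max_le ?_ ?_ <;> nlinarith [norm_nonneg z.1, norm_nonneg z.2]
          · exact h1
      _ ≤ _ := by
          rw [Finset.mul_sum]
          refine Finset.sum_le_sum fun i hi => ?_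
          have hf := hb f i (by simpa [Nat.lt_succ_iff] using hi) z.1
          have hg := hb g (n - i) (Nat.sub_le _ _) z.2
          have hf' := norm_iteratedFDeriv_comp_le_of_norm_le_one (f.smooth ⊤)
            (ContinuousLinearMap.fst ℝ (ConfigSpace d) (ConfigSpace d))
            (ContinuousLinearMap.norm_fst_le ..) i z
          have hg' := norm_iteratedFDeriv_comp_le_of_norm_le_one (g.smooth ⊤)
            (ContinuousLinearMap.snd ℝ (ConfigSpace d) (ConfigSpace d))
            (ContinuousLinearMap.norm_snd_le ..) (n - i) z
          simp only [ContinuousLinearMap.coe_fst', ContinuousLinearMap.coe_snd'] at hf' hg'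
          calc _ = (n.choose i : ℝ) * ((1 + ‖z.1‖) ^ k *
                ‖iteratedFDeriv ℝ i (fun z : PhaseSpace d => f z.1) z‖) * ((1 + ‖z.2‖) ^ k *
                ‖iteratedFDeriv ℝ (n - i) (fun z : PhaseSpace d => g z.2) z‖) := by ring
            _ ≤ (n.choose i : ℝ) * A * B := by
              gcongr
              · exact le_trans (by gcongr) hf
              · exact le_trans (by gcongr) hg

@[simp]
theorem schwartzTensor_apply (f g : 𝓢(ConfigSpace d, ℂ)) (z : PhaseSpace d) :
    schwartzTensor f g z = f z.1 * g z.2 := rfl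

/-- The Fourier transform on `𝓢(ℝ^{2d})`. Phase space is identified with its Euclidean version to
use the Fourier transform of an inner product space. -/
def phaseFourier : 𝓢(PhaseSpace d, ℂ) →L[ℂ] 𝓢(PhaseSpace d, ℂ) :=
  SchwartzMap.compCLMOfContinuousLinearEquiv ℂ
      (WithLp.prodContinuousLinearEquiv 2 ℝ (ConfigSpace d) (ConfigSpace d)).symm ∘L
    FourierTransform.fourierCLM ℂ 𝓢(WithLp 2 (PhaseSpace d), ℂ) ∘L
      SchwartzMap.compCLMOfContinuousLinearEquiv ℂ
        (WithLp.prodContinuousLinearEquiv 2 ℝ (ConfigSpace d) (ConfigSpace d))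

theorem phaseFourier_apply (f : 𝓢(PhaseSpace d, ℂ)) (z : PhaseSpace d) :
    phaseFourier f z =
      ∫ y : PhaseSpace d, cexp (-2 * Real.pi * I * ((⟪y.1, z.1⟫ + ⟪y.2, z.2⟫ : ℝ) : ℂ)) * f y := by
  have h : phaseFourier f z = 𝓕 (fun y : WithLp 2 (PhaseSpace d) => f y.ofLp) (WithLp.toLp 2 z) :=
    rfl
  rw [h, Real.fourier_eq']
  have hm := (WithLp.volume_preserving_ofLp (ConfigSpace d) (ConfigSpace d)).integral_comp
    (MeasurableEquiv.toLp 2 (PhaseSpace d)).symm.measurableEmbedding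
    (fun y : PhaseSpace d =>
      cexp (-2 * Real.pi * I * ((⟪y.1, z.1⟫ + ⟪y.2, z.2⟫ : ℝ) : ℂ)) * f y)
  rw [← hm]
  refine integral_congr_ae (Eventually.of_forall fun y => ?_)
  simp only [WithLp.prod_inner_apply, smul_eq_mul]
  congr 2
  push_cast
  ring

theorem phaseFourier_phaseFourier (f : 𝓢(PhaseSpace d, ℂ)) (z : PhaseSpace d) :
    phaseFourier (phaseFourier f) z = f (-z) := by
  set g : 𝓢(WithLp 2 (PhaseSpace d), ℂ) := SchwartzMap.compCLMOfContinuousLinearEquiv ℂ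
    (WithLp.prodContinuousLinearEquiv 2 ℝ (ConfigSpace d) (ConfigSpace d)) f
  have h : phaseFourier (phaseFourier f) z = 𝓕 (𝓕 g) (WithLp.toLp 2 z) := rfl
  have h1 : 𝓕⁻ (𝓕 g) (-WithLp.toLp 2 z) = 𝓕 (𝓕 g) (WithLp.toLp 2 z) := by
    rw [SchwartzMap.fourierInv_coe, Real.fourierInv_eq_fourier_neg, neg_neg,
      SchwartzMap.fourier_coe (𝓕 g)]
  rw [h, ← h1, FourierTransform.fourierInv_fourier_eq]
  rfl

/-- The map `(x, ξ) ↦ (π⁻¹ ξ, π⁻¹ x)`. -/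
def scaledSwap (d : ℕ) : PhaseSpace d ≃L[ℝ] PhaseSpace d :=
  (ContinuousLinearEquiv.prodComm ℝ (ConfigSpace d) (ConfigSpace d)).trans
    (ContinuousLinearEquiv.smulLeft (Units.mk0 Real.pi⁻¹ (inv_ne_zero Real.pi_ne_zero)))

/-- The reflection `(x, ξ) ↦ (-x, ξ)`. -/
def reflection (d : ℕ) : PhaseSpace d ≃L[ℝ] PhaseSpace d :=
  (ContinuousLinearEquiv.neg ℝ).prodCongr (ContinuousLinearEquiv.refl ℝ _)

/-- Composition with the reflection `(x, ξ) ↦ (-x, ξ)`. -/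
def reflect : 𝓢(PhaseSpace d, ℂ) →L[ℂ] 𝓢(PhaseSpace d, ℂ) :=
  SchwartzMap.compCLMOfContinuousLinearEquiv ℂ (reflection d)

theorem reflect_apply (R : 𝓢(PhaseSpace d, ℂ)) (z : PhaseSpace d) :
    reflect R z = R (-z.1, z.2) := rfl

/-- The convolution `R ↦ π^{-d} ∫ e^{2i (x' - x) · (ξ' - ξ)} R(x', ξ') dx' dξ'` with the chirp,
written as a product of chirp multiplications and a Fourier transform. -/
def chirpTransform : 𝓢(PhaseSpace d, ℂ) →L[ℂ] 𝓢(PhaseSpace d, ℂ) :=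
  ((Real.pi : ℂ) ^ d)⁻¹ • (SchwartzMap.smulLeftCLM ℂ chirp ∘L
    SchwartzMap.compCLMOfContinuousLinearEquiv ℂ (scaledSwap d) ∘L phaseFourier ∘L
      SchwartzMap.smulLeftCLM ℂ chirp)

theorem chirpTransform_eq (R : 𝓢(PhaseSpace d, ℂ)) (z : PhaseSpace d) :
    chirpTransform R z = ((Real.pi : ℂ) ^ d)⁻¹ * (chirp z *
      phaseFourier (SchwartzMap.smulLeftCLM ℂ chirp R) (Real.pi⁻¹ • z.2, Real.pi⁻¹ • z.1)) := by
  rw [chirpTransform, _root_.smul_apply, _root_.smul_apply, smul_eq_mul]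
  simp only [ContinuousLinearMap.comp_apply]
  rw [SchwartzMap.smulLeftCLM_apply_apply hasTemperateGrowth_chirp, smul_eq_mul]
  rfl

theorem chirp_sub (y z : PhaseSpace d) : chirp (y - z) =
    chirp z * (cexp (-2 * I * ((⟪y.1, z.2⟫ + ⟪z.1, y.2⟫ : ℝ) : ℂ)) * chirp y) := by
  rw [chirp, chirp, chirp, ← Complex.exp_add, ← Complex.exp_add]
  congr 1
  simp only [Prod.fst_sub, Prod.snd_sub, inner_sub_left, inner_sub_right]
  push_cast
  ring

theorem chirpTransform_apply (R : 𝓢(PhaseSpace d, ℂ)) (z : PhaseSpace d) :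
    chirpTransform R z = ((Real.pi : ℂ) ^ d)⁻¹ * ∫ y, chirp (y - z) * R y := by
  rw [chirpTransform_eq, phaseFourier_apply, ← integral_const_mul]
  congr 1
  refine integral_congr_ae (Eventually.of_forall fun y => ?_)
  have h : -2 * Real.pi * I *
      ((⟪y.1, Real.pi⁻¹ • z.2⟫ + ⟪y.2, Real.pi⁻¹ • z.1⟫ : ℝ) : ℂ) =
      -2 * I * ((⟪y.1, z.2⟫ + ⟪z.1, y.2⟫ : ℝ) : ℂ) := by
    have := ofReal_ne_zero.2 Real.pi_ne_zero
    simp only [inner_smul_right, real_inner_comm y.2 z.1]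
    push_cast
    field_simp
  simp only [SchwartzMap.smulLeftCLM_apply_apply hasTemperateGrowth_chirp, smul_eq_mul, chirp_sub]
  rw [h]
  ring

/-- The volume of phase space scales by `π^{2d}` under `(x, ξ) ↦ (-π ξ, π x)`. -/
theorem integral_comp_scaled_rotation (F : PhaseSpace d → ℂ) :
    ∫ y, F y = (Real.pi : ℂ) ^ (2 * d) *
      ∫ y : PhaseSpace d, F (-(Real.pi • y.2), Real.pi • y.1) := by
  have h1 := Measure.integral_comp_smul (volume : Measure (PhaseSpace d)) F Real.pi
  have hmp : MeasurePreserving (fun y : PhaseSpace d => ((-y.2, y.1) : PhaseSpace d)) :=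
    ((Measure.measurePreserving_neg (volume : Measure (ConfigSpace d))).prod
      (MeasurePreserving.id (volume : Measure (ConfigSpace d)))).comp Measure.measurePreserving_swap
  have hme : MeasurableEmbedding (fun y : PhaseSpace d => ((-y.2, y.1) : PhaseSpace d)) :=
    ((ContinuousLinearEquiv.prodComm ℝ (ConfigSpace d) (ConfigSpace d)).trans
      (reflection d)).toHomeomorph.measurableEmbedding
  have h2 := hmp.integral_comp hme fun y => F (Real.pi • y)
  simp only [Prod.smul_mk, smul_neg] at h2
  rw [h2, h1, Module.finrank_prod, finrank_euclideanSpace_fin, ← two_mul,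
    abs_of_nonneg (by positivity), real_smul]
  push_cast
  rw [mul_inv_cancel_left₀]
  exact pow_ne_zero _ (ofReal_ne_zero.2 Real.pi_ne_zero)

/-- Up to reflections, the chirp transform is its own inverse. -/
theorem chirpTransform_reflect_chirpTransform (R : 𝓢(PhaseSpace d, ℂ)) :
    chirpTransform (reflect (chirpTransform R)) = reflect R := by
  ext z
  have hpi : (Real.pi : ℂ) ≠ 0 := ofReal_ne_zero.2 Real.pi_ne_zero
  set H := phaseFourier (SchwartzMap.smulLeftCLM ℂ chirp R) with hH
  have hc : chirp z * chirp (-z.1, z.2) = 1 := by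
    rw [chirp, chirp, ← Complex.exp_add, inner_neg_left]
    push_cast
    ring_nf
    exact Complex.exp_zero
  have h1 : phaseFourier H (z.1, -z.2) = chirp (-z.1, z.2) * R (-z.1, z.2) := by
    rw [hH, phaseFourier_phaseFourier, SchwartzMap.smulLeftCLM_apply_apply hasTemperateGrowth_chirp]
    simp
  rw [chirpTransform_apply, integral_comp_scaled_rotation, reflect_apply]
  have h2 : ∫ y : PhaseSpace d, chirp ((-(Real.pi • y.2), Real.pi • y.1) - z) *
      reflect (chirpTransform R) (-(Real.pi • y.2), Real.pi • y.1) =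
      ((Real.pi : ℂ) ^ d)⁻¹ * (chirp z * phaseFourier H (z.1, -z.2)) := by
    rw [phaseFourier_apply, ← integral_const_mul, ← integral_const_mul]
    refine integral_congr_ae (Eventually.of_forall fun y => ?_)
    have h3 : chirp (-(Real.pi • y.2), Real.pi • y.1) *
        chirp (Real.pi • y.2, Real.pi • y.1) = 1 := by
      rw [chirp, chirp, ← Complex.exp_add, inner_neg_left]
      push_cast
      ring_nf
      exact Complex.exp_zero
    simp only [reflect_apply, neg_neg, chirpTransform_eq, chirp_sub, ← hH, smul_smul,
      inv_mul_cancel₀ Real.pi_ne_zero, one_smul, inner_neg_left, inner_smul_left, inner_smul_right,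
      inner_neg_right, real_inner_comm y.1 z.1]
    have h4 : -2 * I * ((-((starRingEnd ℝ) Real.pi * ⟪y.2, z.2⟫) + Real.pi * ⟪y.1, z.1⟫ : ℝ) : ℂ) =
        -2 * Real.pi * I * ((⟪y.1, z.1⟫ + -⟪y.2, z.2⟫ : ℝ) : ℂ) := by
      simp only [conj_trivial]
      push_cast
      ring
    rw [h4]
    linear_combination (((Real.pi : ℂ) ^ d)⁻¹ * chirp z *
      cexp (-2 * Real.pi * I * ((⟪y.1, z.1⟫ + -⟪y.2, z.2⟫ : ℝ) : ℂ)) * H (y.1, y.2)) * h3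
  rw [h2, h1]
  have h5 : ((Real.pi : ℂ) ^ d)⁻¹ * (Real.pi : ℂ) ^ (2 * d) * ((Real.pi : ℂ) ^ d)⁻¹ = 1 := by
    rw [two_mul, pow_add]
    field_simp
  linear_combination (chirp z * chirp (-z.1, z.2) * R (-z.1, z.2)) * h5 + R (-z.1, z.2) * hc

/-- The inverse of the chirp transform. -/
def chirpInverse : 𝓢(PhaseSpace d, ℂ) →L[ℂ] 𝓢(PhaseSpace d, ℂ) :=
  reflect ∘L chirpTransform ∘L reflect

theorem reflect_reflect (R : 𝓢(PhaseSpace d, ℂ)) : reflect (reflect R) = R := by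
  ext z
  simp [reflect_apply]

theorem chirpTransform_chirpInverse (R : 𝓢(PhaseSpace d, ℂ)) :
    chirpTransform (chirpInverse R) = R := by
  simp only [chirpInverse, ContinuousLinearMap.comp_apply]
  rw [chirpTransform_reflect_chirpTransform, reflect_reflect]

theorem chirpInverse_chirpTransform (R : 𝓢(PhaseSpace d, ℂ)) :
    chirpInverse (chirpTransform R) = R := by
  simp only [chirpInverse, ContinuousLinearMap.comp_apply]
  rw [chirpTransform_reflect_chirpTransform, reflect_reflect]

theorem chirpInverse_apply (R : 𝓢(PhaseSpace d, ℂ)) (z : PhaseSpace d) :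
    chirpInverse R z = ((Real.pi : ℂ) ^ d)⁻¹ * ∫ y, chirp (z.1 - y.1, y.2 - z.2) * R y := by
  have hmp : MeasurePreserving (fun y : PhaseSpace d => ((-y.1, y.2) : PhaseSpace d)) :=
    (Measure.measurePreserving_neg (volume : Measure (ConfigSpace d))).prod
      (MeasurePreserving.id (volume : Measure (ConfigSpace d)))
  have h := hmp.integral_comp (reflection d).toHomeomorph.measurableEmbedding
    fun y => chirp (y - (-z.1, z.2)) * R (-y.1, y.2)
  have h1 : chirpInverse R z = chirpTransform (reflect R) (-z.1, z.2) := rfl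
  rw [h1, chirpTransform_apply]
  simp only [reflect_apply]
  rw [← h]
  refine congrArg _ (integral_congr_ae (Eventually.of_forall fun y => ?_))
  simp only [neg_neg]
  congr 2
  ext1 <;> simp [sub_eq_add_neg, add_comm]

theorem chirp_neg (z : PhaseSpace d) : chirp (-z) = chirp z := by simp [chirp]

theorem continuous_chirp : Continuous (chirp (d := d)) := contDiff_chirp.continuous

theorem integrable_rpow_mul_schwartz {X : Type*} [NormedAddCommGroup X] [NormedSpace ℝ X]
    [MeasurableSpace X] [BorelSpace X] [SecondCountableTopology X] {μ : Measure X}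
    [μ.HasTemperateGrowth] (c r : ℝ) (Θ : 𝓢(X, ℂ)) :
    Integrable (fun z => c * (1 + ‖z‖) ^ r * ‖Θ z‖) μ := by
  obtain ⟨k, hk⟩ := exists_nat_ge r
  have h := ((((Θ.integrable_pow_mul μ 0).add (Θ.integrable_pow_mul μ k)).const_mul
    (2 ^ (k - 1))).const_mul |c|)
  refine h.mono' ?_ (Eventually.of_forall fun z => ?_)
  · exact ((continuous_const.mul ((continuous_const.add continuous_norm).rpow_const
      fun z => Or.inl (one_add_norm_pos z).ne')).mul Θ.continuous.norm).aestronglyMeasurable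
  have h1 : (1 + ‖z‖) ^ r ≤ 2 ^ (k - 1) * (‖z‖ ^ 0 + ‖z‖ ^ k) := by
    refine (Real.rpow_le_rpow_of_exponent_le (one_le_one_add_norm z) hk).trans ?_
    rw [Real.rpow_natCast]
    simpa using add_pow_le zero_le_one (norm_nonneg z) k
  rw [norm_mul, norm_mul, norm_norm, Real.norm_eq_abs, Real.norm_of_nonneg (by positivity),
    mul_assoc]
  refine mul_le_mul_of_nonneg_left ?_ (abs_nonneg c)
  refine (mul_le_mul_of_nonneg_right h1 (norm_nonneg _)).trans_eq ?_
  simp only [Pi.add_apply]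
  ring

/-- The oscillatory mean is transposed to the chirp transform. -/
theorem IsAmplitude.integral_oscMean_mul {m : ℝ} {C : ℕ → ℝ} {f : PhaseSpace d → ℂ}
    (hf : IsAmplitude m C f) (Θ : 𝓢(PhaseSpace d, ℂ)) :
    ∫ z, oscMean 1 f z * Θ z = ∫ z, f z * chirpTransform Θ z := by
  obtain ⟨C', hC'⟩ := exists_isAmplitude_cutoff_smul (E := ℂ) (d := d) m C
  set g : ℕ → PhaseSpace d → ℂ := fun n z => cutoff n z • f z with hg
  have hgA (n : ℕ) : IsAmplitude m C' (g n) := hC' f hf n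
  obtain ⟨B, hB0, hB⟩ := exists_norm_oscMean_le (E := ℂ) (d := d) m C'
  -- Both sides are limits of the corresponding integrals for the compactly supported `g n`.
  have hone : |(1 : ℝ)| ≤ 2 := by norm_num
  have hmean : ∀ z, Tendsto (fun n => oscMean 1 (g n) z) atTop (𝓝 (oscMean 1 f z)) := by
    intro z
    refine (tendsto_oscIntegral (fun n => (hgA n).comp_affine hone z) (hf.comp_affine hone z)
      fun y => ?_).const_smul _
    filter_upwards [cutoff_smul_eventuallyEq f (z + (1 : ℝ) • y)] with n hn
    exact (by fun_prop : Continuous fun y : PhaseSpace d => z + (1 : ℝ) • y).continuousAt.eventually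
      hn
  have hmc (n : ℕ) : Continuous (oscMean 1 (g n)) := continuous_iff_continuousAt.2 fun z =>
    ((hgA n).hasFDerivAt_oscMean 1 z).continuousAt
  have hl : Tendsto (fun n => ∫ z, oscMean 1 (g n) z * Θ z) atTop
      (𝓝 (∫ z, oscMean 1 f z * Θ z)) := by
    refine tendsto_integral_of_dominated_convergence (fun z => B * (1 + ‖z‖) ^ m * ‖Θ z‖)
      (fun n => ((hmc n).mul Θ.continuous).aestronglyMeasurable)
      (integrable_rpow_mul_schwartz B m Θ) (fun n => Eventually.of_forall fun z => ?_)
      (Eventually.of_forall fun z => (hmean z).mul_const _)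
    rw [norm_mul]
    gcongr
    exact hB _ (hgA n) 1 hone z
  have hr : Tendsto (fun n => ∫ z, g n z * chirpTransform Θ z) atTop
      (𝓝 (∫ z, f z * chirpTransform Θ z)) := by
    refine tendsto_integral_of_dominated_convergence
      (fun z => C' 0 * (1 + ‖z‖) ^ m * ‖chirpTransform Θ z‖)
      (fun n => ((hgA n).continuous.mul (chirpTransform Θ).continuous).aestronglyMeasurable)
      (integrable_rpow_mul_schwartz (C' 0) m _) (fun n => Eventually.of_forall fun z => ?_)
      (Eventually.of_forall fun z => Tendsto.mul_const _ (tendsto_const_nhds.congr' ?_))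
    · rw [norm_mul]
      gcongr
      exact (hgA n).norm_le z
    · filter_upwards [cutoff_smul_eventuallyEq f z] with n hn
      exact hn.eq_of_nhds.symm
  refine tendsto_nhds_unique hl (hr.congr fun n => ?_)
  -- For fixed `n` both integrals converge absolutely, and Fubini's theorem applies.
  obtain ⟨C'', hn⟩ := exists_isAmplitude_cutoff_smul_decay hf n (-(2 * d) - 1)
  have hgi : Integrable (g n) := integrable_of_norm_le_rpow hn.continuous
    (by linarith : -(2 * (d : ℝ)) - 1 < -(2 * d)) hn.norm_le
  have hmn (z : PhaseSpace d) : oscMean 1 (g n) z =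
      ((Real.pi : ℂ) ^ d)⁻¹ * ∫ y, chirp (y - z) * g n y := by
    obtain ⟨C₁, h1⟩ := exists_isAmplitude_of_hasCompactSupport
      (f := fun y => g n (z + y)) (hn.smooth.comp (contDiff_const.add contDiff_id))
      (((hasCompactSupport_cutoff n).smul_right).comp_homeomorph (Homeomorph.addLeft z))
      (-(2 * d) - 1)
    simp only [oscMean, one_smul, smul_eq_mul]
    rw [h1.oscIntegral_eq_integral (by linarith),
      ← integral_sub_right_eq_self (fun y => chirp y • g n (z + y)) z]
    simp only [add_sub_cancel, smul_eq_mul]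
  have hint : Integrable (Function.uncurry fun z y => chirp (y - z) * g n y * Θ z)
      ((volume : Measure (PhaseSpace d)).prod volume) := by
    refine ((Θ.integrable (μ := volume)).mul_prod hgi).mono ?_ ?_
    · refine Continuous.aestronglyMeasurable ?_
      have := (hgA n).continuous
      have := Θ.continuous
      have := continuous_chirp (d := d)
      simp only [Function.uncurry_def]
      fun_prop
    · refine Eventually.of_forall fun p => le_of_eq ?_
      simp only [Function.uncurry_def, norm_mul, norm_chirp, one_mul]
      exact mul_comm _ _
  calc ∫ y, g n y * chirpTransform Θ y
      = ((Real.pi : ℂ) ^ d)⁻¹ * ∫ y, ∫ z, chirp (y - z) * g n y * Θ z := by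
        rw [← integral_const_mul]
        refine integral_congr_ae (Eventually.of_forall fun y => ?_)
        simp only [chirpTransform_apply]
        rw [mul_left_comm, ← integral_const_mul]
        refine congrArg _ (integral_congr_ae (Eventually.of_forall fun z => ?_))
        simp only
        rw [← chirp_neg (z - y), neg_sub]
        ring
    _ = ((Real.pi : ℂ) ^ d)⁻¹ * ∫ z, ∫ y, chirp (y - z) * g n y * Θ z := by
        rw [integral_integral_swap hint]
    _ = ∫ z, oscMean 1 (g n) z * Θ z := by
        rw [← integral_const_mul]
        refine integral_congr_ae (Eventually.of_forall fun z => ?_)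
        simp only [hmn]
        rw [integral_mul_const, mul_assoc]

end ChirpTransform

/-! ### Kohn-Nirenberg and Weyl quantization -/

section Quantization

open scoped FourierTransform

variable {d : ℕ}

/-- The dilation by `r ≠ 0` on configuration space. -/
def dilation (d : ℕ) (r : ℝ) (hr : r ≠ 0) : ConfigSpace d ≃L[ℝ] ConfigSpace d :=
  ContinuousLinearEquiv.smulLeft (Units.mk0 r hr)

theorem two_pi_inv_ne_zero : (2 * Real.pi)⁻¹ ≠ 0 := by positivity

/-- The Fourier transform `û(ξ) = ∫ e^{-i y · ξ} u(y) dy` in angular frequency. -/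
def angularFourier : 𝓢(ConfigSpace d, ℂ) →L[ℂ] 𝓢(ConfigSpace d, ℂ) :=
  SchwartzMap.compCLMOfContinuousLinearEquiv ℂ (dilation d (2 * Real.pi)⁻¹ two_pi_inv_ne_zero) ∘L
    FourierTransform.fourierCLM ℂ 𝓢(ConfigSpace d, ℂ)

theorem angularFourier_eq (u : 𝓢(ConfigSpace d, ℂ)) (ξ : ConfigSpace d) :
    angularFourier u ξ = 𝓕 (u : ConfigSpace d → ℂ) ((2 * Real.pi)⁻¹ • ξ) := rfl

theorem angularFourier_apply (u : 𝓢(ConfigSpace d, ℂ)) (ξ : ConfigSpace d) :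
    angularFourier u ξ = ∫ y, cexp (-I * (⟪y, ξ⟫ : ℝ)) * u y := by
  rw [angularFourier_eq, Real.fourier_eq']
  refine integral_congr_ae (Eventually.of_forall fun y => ?_)
  have := ofReal_ne_zero.2 Real.pi_ne_zero
  simp only [smul_eq_mul, inner_smul_right]
  congr 2
  push_cast
  field_simp

theorem integral_cexp_mul_angularFourier (u : 𝓢(ConfigSpace d, ℂ)) (v : ConfigSpace d) :
    ∫ ξ, cexp (I * (⟪v, ξ⟫ : ℝ)) * angularFourier u ξ = ((2 * Real.pi : ℝ) : ℂ) ^ d * u v := by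
  have h1 := Measure.integral_comp_smul (volume : Measure (ConfigSpace d))
    (fun η => cexp (I * (⟪v, (2 * Real.pi) • η⟫ : ℝ)) * 𝓕 (u : ConfigSpace d → ℂ) η)
    (2 * Real.pi)⁻¹
  have h2 : 𝓕⁻ (𝓕 (u : ConfigSpace d → ℂ)) v = u v := by
    rw [← SchwartzMap.fourier_coe, ← SchwartzMap.fourierInv_coe,
      FourierTransform.fourierInv_fourier_eq]
  have h3 : ∫ η, cexp (I * (⟪v, (2 * Real.pi) • η⟫ : ℝ)) * 𝓕 (u : ConfigSpace d → ℂ) η = u v := by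
    rw [← h2, Real.fourierInv_eq']
    refine integral_congr_ae (Eventually.of_forall fun y => ?_)
    simp only [smul_eq_mul, inner_smul_right, real_inner_comm y v]
    congr 2
    push_cast
    ring
  simp only [smul_smul, mul_inv_cancel₀ (by positivity : 2 * Real.pi ≠ 0), one_smul] at h1
  simp only [angularFourier_eq]
  rw [h1, h3, finrank_euclideanSpace_fin, abs_of_nonneg (by positivity), real_smul]
  push_cast
  rw [inv_pow, inv_inv]

theorem angularFourier_surjective : Function.Surjective (angularFourier (d := d)) := by
  intro g
  refine ⟨𝓕⁻ (SchwartzMap.compCLMOfContinuousLinearEquiv ℂ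
    (dilation d (2 * Real.pi) (by positivity)) g), ?_⟩
  ext ξ
  rw [angularFourier_eq, ← SchwartzMap.fourier_coe, FourierTransform.fourier_fourierInv_eq]
  change g ((2 * Real.pi) • (2 * Real.pi)⁻¹ • ξ) = g ξ
  rw [smul_smul, mul_inv_cancel₀ (by positivity), one_smul]

theorem measurableEmbedding_affine (r : ℝ) (hr : r ≠ 0) (w : ConfigSpace d) :
    MeasurableEmbedding fun y : ConfigSpace d => r • y + w :=
  ((Homeomorph.smul (Units.mk0 r hr)).trans (Homeomorph.addRight w)).measurableEmbedding

theorem map_affine_volume (r : ℝ) (hr : r ≠ 0) (w : ConfigSpace d) :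
    (volume : Measure (ConfigSpace d)).map (fun y => r • y + w) =
      ENNReal.ofReal |(r ^ d)⁻¹| • volume := by
  have h : (fun y : ConfigSpace d => r • y + w) = (fun y => y + w) ∘ fun y => r • y := rfl
  rw [h, ← Measure.map_map (measurable_add_const w) (measurable_const_smul r),
    Measure.map_addHaar_smul _ hr, Measure.map_smul, map_add_right_eq_self,
    finrank_euclideanSpace_fin]

theorem integral_comp_affine {F : Type*} [NormedAddCommGroup F] [NormedSpace ℝ F]
    (f : ConfigSpace d → F) (r : ℝ) (hr : r ≠ 0) (w : ConfigSpace d) :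
    ∫ y, f (r • y + w) = |(r ^ d)⁻¹| • ∫ y, f y := by
  rw [← (measurableEmbedding_affine r hr w).integral_map f, map_affine_volume r hr,
    integral_smul_measure, ENNReal.toReal_ofReal (abs_nonneg _)]

theorem integral_comp_affine_fst {F : Type*} [NormedAddCommGroup F] [NormedSpace ℝ F]
    (f : PhaseSpace d → F) (r : ℝ) (hr : r ≠ 0) (w : ConfigSpace d) :
    ∫ z : PhaseSpace d, f (r • z.1 + w, z.2) = |(r ^ d)⁻¹| • ∫ z, f z := by
  have h := Measure.map_prod_map (volume : Measure (ConfigSpace d))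
    (volume : Measure (ConfigSpace d)) (measurableEmbedding_affine r hr w).measurable measurable_id
  rw [map_affine_volume r hr, Measure.map_id, Measure.prod_smul_left] at h
  have h1 := ((measurableEmbedding_affine r hr w).prodMap MeasurableEmbedding.id).integral_map
    (μ := (volume : Measure (ConfigSpace d)).prod volume) f
  rw [← h, integral_smul_measure, ENNReal.toReal_ofReal (abs_nonneg _)] at h1
  exact h1.symm

theorem one_add_norm_rpow_prod_le (r : ℝ) (z : PhaseSpace d) :
    (1 + ‖z‖) ^ r ≤ (1 + ‖z.1‖) ^ |r| * (1 + ‖z.2‖) ^ |r| := by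
  rw [← Real.mul_rpow (one_add_norm_pos _).le (one_add_norm_pos _).le]
  refine (Real.rpow_le_rpow_of_exponent_le (one_le_one_add_norm z) (le_abs_self r)).trans ?_
  refine Real.rpow_le_rpow (one_add_norm_pos z).le ?_ (abs_nonneg r)
  rw [Prod.norm_def]
  have h1 := norm_nonneg z.1
  have h2 := norm_nonneg z.2
  rcases max_cases ‖z.1‖ ‖z.2‖ with h | h <;> rw [h.1] <;> nlinarith

theorem IsAmplitude.norm_le_prod {m : ℝ} {C : ℕ → ℝ} {a : PhaseSpace d → ℂ}
    (ha : IsAmplitude m C a) (x ξ : ConfigSpace d) :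
    ‖a (x, ξ)‖ ≤ C 0 * ((1 + ‖x‖) ^ |m| * (1 + ‖ξ‖) ^ |m|) :=
  (ha.norm_le (x, ξ)).trans
    (mul_le_mul_of_nonneg_left (one_add_norm_rpow_prod_le m (x, ξ)) (ha.const_nonneg 0))

/-- The Kohn-Nirenberg operator `a(x, D) u(x) = (2π)^{-d} ∫ e^{i x · ξ} a(x, ξ) û(ξ) dξ`. -/
def knQuantization (a : PhaseSpace d → ℂ) (u : 𝓢(ConfigSpace d, ℂ)) (x : ConfigSpace d) : ℂ :=
  ((2 * Real.pi : ℝ) : ℂ)⁻¹ ^ d * ∫ ξ, cexp (I * (⟪x, ξ⟫ : ℝ)) * a (x, ξ) * angularFourier u ξ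

theorem norm_cexp_I_mul (t : ℝ) : ‖cexp (I * t)‖ = 1 := by rw [mul_comm, norm_exp_ofReal_mul_I]

theorem continuous_cexp_I_mul {X : Type*} [TopologicalSpace X] {q : X → ℝ} (hq : Continuous q) :
    Continuous fun z => cexp (I * q z) :=
  Complex.continuous_exp.comp (continuous_const.mul (continuous_ofReal.comp hq))

theorem regQuantization_one {m : ℝ} {C : ℕ → ℝ} {a : PhaseSpace d → ℂ} (ha : IsAmplitude m C a)
    {ψ : ConfigSpace d → ℂ} (hψ : Continuous ψ) (hs : HasCompactSupport ψ) {ε : ℝ} (hε : ε ≠ 0)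
    (u : 𝓢(ConfigSpace d, ℂ)) (x : ConfigSpace d) :
    regQuantization ψ ε 1 a u x = ((2 * Real.pi : ℝ) : ℂ)⁻¹ ^ d *
      ∫ ξ, ψ (ε • ξ) * (cexp (I * (⟪x, ξ⟫ : ℝ)) * a (x, ξ) * angularFourier u ξ) := by
  rw [regQuantization]
  congr 1
  have hac : Continuous fun ξ => a (x, ξ) := ha.continuous.comp (by fun_prop)
  have h1 : Integrable fun ξ => ψ (ε • ξ) * a (x, ξ) :=
    ((hψ.comp (continuous_const_smul ε)).mul hac).integrable_of_hasCompactSupport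
      ((hs.comp_smul hε).mul_right)
  have hint : Integrable (fun p : ConfigSpace d × ConfigSpace d =>
      ψ (ε • p.2) * cexp (I * (⟪x - p.1, p.2⟫ : ℝ)) * a ((1 : ℝ) • x + (1 - 1 : ℝ) • p.1, p.2) *
        u p.1) ((volume : Measure (ConfigSpace d)).prod volume) := by
    refine ((u.integrable (μ := volume)).mul_prod h1).mono ?_ (Eventually.of_forall fun p => ?_)
    · refine Continuous.aestronglyMeasurable ?_
      refine (((hψ.comp (continuous_snd.const_smul ε)).mul
        (continuous_cexp_I_mul (by fun_prop))).mul (ha.continuous.comp (by fun_prop))).mul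
          (u.continuous.comp continuous_fst)
    · refine le_of_eq ?_
      simp only [norm_mul, norm_cexp_I_mul, one_smul, sub_self, zero_smul, add_zero]
      ring
  rw [Measure.volume_eq_prod, integral_prod_symm _ hint]
  refine integral_congr_ae (Eventually.of_forall fun ξ => ?_)
  simp only [angularFourier_apply, one_smul, sub_self, zero_smul, add_zero]
  rw [← integral_const_mul, ← integral_const_mul]
  refine integral_congr_ae (Eventually.of_forall fun y => ?_)
  have : cexp (I * (⟪x - y, ξ⟫ : ℝ)) = cexp (I * (⟪x, ξ⟫ : ℝ)) * cexp (-I * (⟪y, ξ⟫ : ℝ)) := by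
    rw [← Complex.exp_add, inner_sub_left]
    push_cast
    ring_nf
  simp only [this]
  ring

theorem IsAmplitude.isQuantization_one {m : ℝ} {C : ℕ → ℝ} {a : PhaseSpace d → ℂ}
    (ha : IsAmplitude m C a) : IsQuantization 1 a (knQuantization a) := by
  intro ψ hψ hs h1 u x
  obtain ⟨K, hK⟩ := hs.exists_bound_of_continuous hψ.continuous
  refine Tendsto.congr' (f₁ := fun ε : ℝ => ((2 * Real.pi : ℝ) : ℂ)⁻¹ ^ d *
    ∫ ξ, ψ (ε • ξ) * (cexp (I * (⟪x, ξ⟫ : ℝ)) * a (x, ξ) * angularFourier u ξ)) ?_ ?_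
  · filter_upwards [self_mem_nhdsWithin] with ε hε
    rw [regQuantization_one ha hψ.continuous hs (ne_of_gt hε)]
  refine Tendsto.const_mul _ ?_
  have hK0 : 0 ≤ K := (norm_nonneg _).trans (hK 0)
  have hac : Continuous fun ξ => a (x, ξ) := ha.continuous.comp (by fun_prop)
  refine tendsto_integral_filter_of_dominated_convergence
    (fun ξ => K * (C 0 * (1 + ‖x‖) ^ |m|) * (1 + ‖ξ‖) ^ |m| * ‖angularFourier u ξ‖)
    (Eventually.of_forall fun ε => ?_) (Eventually.of_forall fun ε =>
      Eventually.of_forall fun ξ => ?_) (integrable_rpow_mul_schwartz _ _ _)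
    (Eventually.of_forall fun ξ => ?_)
  · refine Continuous.aestronglyMeasurable ?_
    exact (hψ.continuous.comp (continuous_const_smul ε)).mul
      (((continuous_cexp_I_mul (by fun_prop)).mul hac).mul (angularFourier u).continuous)
  · rw [norm_mul, norm_mul, norm_mul, norm_cexp_I_mul, one_mul, mul_assoc K, mul_assoc K]
    refine mul_le_mul (hK _) ?_ (by positivity) hK0
    refine mul_le_mul_of_nonneg_right ?_ (norm_nonneg _)
    rw [mul_assoc]
    exact ha.norm_le_prod x ξ
  · have h2 : Tendsto (fun ε : ℝ => ε • ξ) (𝓝[>] 0) (𝓝 0) := by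
      have : Tendsto (fun ε : ℝ => ε • ξ) (𝓝 0) (𝓝 ((0 : ℝ) • ξ)) :=
        (continuous_id.smul continuous_const).continuousAt
      rw [zero_smul] at this
      exact this.mono_left nhdsWithin_le_nhds
    refine tendsto_const_nhds.congr' ?_
    filter_upwards [h2.eventually h1] with ε hε
    rw [hε, one_mul]

/-- The test function `(y, ξ) ↦ ψ(ε ξ) e^{2i (x - y) · ξ} u(2y - x)` whose pairing with a symbol is,
up to a constant, the regularized Weyl quantization. -/
def weylTest (Ψ : 𝓢(ConfigSpace d, ℂ)) (ε : ℝ) (hε : ε ≠ 0) (u : 𝓢(ConfigSpace d, ℂ))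
    (x : ConfigSpace d) : 𝓢(PhaseSpace d, ℂ) :=
  SchwartzMap.smulLeftCLM ℂ
    (fun z : PhaseSpace d => cexp (I * ((⟪(2 : ℝ) • (x - z.1), z.2⟫ : ℝ) : ℂ)))
    (schwartzTensor
      (SchwartzMap.compCLMOfContinuousLinearEquiv ℂ (dilation d 2 two_ne_zero)
        (SchwartzMap.compSubConstCLM ℂ x u))
      (SchwartzMap.compCLMOfContinuousLinearEquiv ℂ (dilation d ε hε) Ψ))

theorem weylTest_apply (Ψ : 𝓢(ConfigSpace d, ℂ)) (ε : ℝ) (hε : ε ≠ 0) (u : 𝓢(ConfigSpace d, ℂ))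
    (x : ConfigSpace d) (z : PhaseSpace d) :
    weylTest Ψ ε hε u x z = cexp (I * ((⟪(2 : ℝ) • (x - z.1), z.2⟫ : ℝ) : ℂ)) *
      (u ((2 : ℝ) • z.1 - x) * Ψ (ε • z.2)) := by
  have h : Function.HasTemperateGrowth fun z : PhaseSpace d =>
      cexp (I * ((⟪(2 : ℝ) • (x - z.1), z.2⟫ : ℝ) : ℂ)) := by
    refine Function.HasTemperateGrowth.cexp_I_mul (Function.HasTemperateGrowth.inner ?_
      (ContinuousLinearMap.snd ℝ (ConfigSpace d) (ConfigSpace d)).hasTemperateGrowth)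
    exact (Function.HasTemperateGrowth.const (2 : ℝ)).smul
      ((Function.HasTemperateGrowth.const x).sub
        (ContinuousLinearMap.fst ℝ (ConfigSpace d) (ConfigSpace d)).hasTemperateGrowth)
  rw [weylTest, SchwartzMap.smulLeftCLM_apply_apply h]
  rfl

theorem regQuantization_half (b : PhaseSpace d → ℂ) (Ψ : 𝓢(ConfigSpace d, ℂ)) (ε : ℝ) (hε : ε ≠ 0)
    (u : 𝓢(ConfigSpace d, ℂ)) (x : ConfigSpace d) :
    regQuantization Ψ ε (1 / 2) b u x =
      ((Real.pi : ℂ) ^ d)⁻¹ * ∫ z, b z * weylTest Ψ ε hε u x z := by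
  set F : PhaseSpace d → ℂ := fun p => Ψ (ε • p.2) * cexp (I * (⟪x - p.1, p.2⟫ : ℝ)) *
    b ((1 / 2 : ℝ) • x + (1 - 1 / 2 : ℝ) • p.1, p.2) * u p.1 with hF
  have h1 := integral_comp_affine_fst F 2 two_ne_zero (-x)
  have h2 : ∫ z, b z * weylTest Ψ ε hε u x z = ∫ z : PhaseSpace d, F ((2 : ℝ) • z.1 + -x, z.2) := by
    refine integral_congr_ae (Eventually.of_forall fun z => ?_)
    have e1 : (1 / 2 : ℝ) • x + (1 - 1 / 2 : ℝ) • ((2 : ℝ) • z.1 + -x) = z.1 := by module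
    have e2 : x - ((2 : ℝ) • z.1 + -x) = (2 : ℝ) • (x - z.1) := by module
    simp only [hF, weylTest_apply]
    rw [e1, e2, ← sub_eq_add_neg]
    ring
  rw [h2, h1, regQuantization, abs_of_nonneg (by positivity), real_smul, ← mul_assoc]
  congr 1
  push_cast
  rw [inv_pow, mul_pow, mul_inv, mul_comm]

/-- The chirp transform separates the test function of the Weyl quantization. -/
theorem chirpTransform_weylTest (Ψ : 𝓢(ConfigSpace d, ℂ)) (ε : ℝ) (hε : ε ≠ 0)
    (u : 𝓢(ConfigSpace d, ℂ)) (x : ConfigSpace d) (z : PhaseSpace d) :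
    chirpTransform (weylTest Ψ ε hε u x) z = ((2 * Real.pi : ℝ) : ℂ)⁻¹ ^ d *
      ((∫ ξ, cexp (2 * I * (⟪ξ, x - z.1⟫ : ℝ)) * Ψ (ε • ξ)) *
        (cexp (I * (⟪(2 : ℝ) • z.1 - x, z.2⟫ : ℝ)) * angularFourier u z.2)) := by
  have h1 : ∫ y, cexp (-I * (⟪(2 : ℝ) • (y - z.1), z.2⟫ : ℝ)) * u ((2 : ℝ) • y - x) =
      ((2 : ℂ) ^ d)⁻¹ * (cexp (I * (⟪(2 : ℝ) • z.1 - x, z.2⟫ : ℝ)) * angularFourier u z.2) := by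
    have h := integral_comp_affine (fun s => cexp (-I * (⟪s + x - (2 : ℝ) • z.1, z.2⟫ : ℝ)) * u s)
      2 two_ne_zero (-x)
    rw [abs_of_nonneg (by positivity), real_smul] at h
    rw [angularFourier_apply, ← integral_const_mul]
    convert h using 1
    · refine integral_congr_ae (Eventually.of_forall fun y => ?_)
      have e : (2 : ℝ) • y + -x + x - (2 : ℝ) • z.1 = (2 : ℝ) • (y - z.1) := by module
      simp only
      rw [e, ← sub_eq_add_neg]
    · congr 1
      · push_cast
        rfl
      · refine integral_congr_ae (Eventually.of_forall fun s => ?_)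
        simp only
        rw [← mul_assoc, ← Complex.exp_add]
        congr 2
        simp only [inner_sub_left, inner_add_left]
        push_cast
        ring
  rw [chirpTransform_apply]
  have h2 : ∫ y, chirp (y - z) * weylTest Ψ ε hε u x y =
      (∫ y, cexp (-I * (⟪(2 : ℝ) • (y - z.1), z.2⟫ : ℝ)) * u ((2 : ℝ) • y - x)) *
        ∫ ξ, cexp (2 * I * (⟪ξ, x - z.1⟫ : ℝ)) * Ψ (ε • ξ) := by
    rw [← integral_prod_mul, Measure.volume_eq_prod]
    refine integral_congr_ae (Eventually.of_forall fun y => ?_)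
    have e : chirp (y - z) * cexp (I * ((⟪(2 : ℝ) • (x - y.1), y.2⟫ : ℝ) : ℂ)) =
        cexp (-I * (⟪(2 : ℝ) • (y.1 - z.1), z.2⟫ : ℝ)) *
          cexp (2 * I * (⟪y.2, x - z.1⟫ : ℝ)) := by
      rw [chirp, ← Complex.exp_add, ← Complex.exp_add, real_inner_comm (x - z.1) y.2]
      congr 1
      simp only [Prod.fst_sub, Prod.snd_sub, inner_sub_left, inner_sub_right, inner_smul_left,
        conj_trivial]
      push_cast
      ring
    simp only [weylTest_apply]
    linear_combination (u ((2 : ℝ) • y.1 - x) * Ψ (ε • y.2)) * e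
  rw [h2, h1]
  push_cast
  rw [inv_pow, mul_pow, mul_inv]
  ring

/-- The Weyl quantization of the oscillatory mean of `a` is the Kohn-Nirenberg quantization of
`a`. -/
theorem IsAmplitude.isQuantization_half_oscMean {m : ℝ} {C : ℕ → ℝ} {a : PhaseSpace d → ℂ}
    (ha : IsAmplitude m C a) : IsQuantization (1 / 2) (oscMean 1 a) (knQuantization a) := by
  intro ψ hψ hs h1 u x
  set Ψ : 𝓢(ConfigSpace d, ℂ) := hs.toSchwartzMap hψ
  have hpi : -Real.pi⁻¹ ≠ 0 := neg_ne_zero.2 (inv_ne_zero Real.pi_ne_zero)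
  -- `P` is the Fourier transform of `ψ`, normalized so that its integral is `π ^ d`.
  set P : 𝓢(ConfigSpace d, ℂ) :=
    SchwartzMap.compCLMOfContinuousLinearEquiv ℂ (dilation d (-Real.pi⁻¹) hpi) (𝓕 Ψ)
  have hP (s : ConfigSpace d) : P s = ∫ ξ, cexp (2 * I * (⟪ξ, s⟫ : ℝ)) * Ψ ξ := by
    rw [integral_exp_two_inner_mul, ← neg_smul]
    rfl
  have hPint : ∫ s, P s = (Real.pi : ℂ) ^ d := by
    have h := Measure.integral_comp_smul (volume : Measure (ConfigSpace d))
      (fun η => 𝓕 (Ψ : ConfigSpace d → ℂ) η) (-Real.pi⁻¹)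
    rw [SchwartzMap.integral_fourier, show Ψ 0 = 1 from h1.self_of_nhds,
      finrank_euclideanSpace_fin, abs_inv, abs_pow, abs_neg, abs_of_nonneg (by positivity),
      inv_pow, inv_inv, real_smul, mul_one, ofReal_pow] at h
    exact h
  -- The substitution `z.1 = x - ε s` turns the separated test function into `P(s)` times a function
  -- which converges as `ε → 0+`.
  have hmain (ε : ℝ) (hε : 0 < ε) : regQuantization ψ ε (1 / 2) (oscMean 1 a) u x =
      ((2 * Real.pi : ℝ) : ℂ)⁻¹ ^ d * (((Real.pi : ℂ) ^ d)⁻¹ * ∫ z : PhaseSpace d,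
        a ((-ε) • z.1 + x, z.2) * (P z.1 * (cexp (I * (⟪(2 : ℝ) • ((-ε) • z.1 + x) - x, z.2⟫ : ℝ)) *
          angularFourier u z.2))) := by
    have hε0 : -ε ≠ 0 := neg_ne_zero.2 hε.ne'
    have hPε (s : ConfigSpace d) :
        ∫ ξ, cexp (2 * I * (⟪ξ, ε • s⟫ : ℝ)) * Ψ (ε • ξ) = (((ε ^ d)⁻¹ : ℝ) : ℂ) * P s := by
      have h := Measure.integral_comp_smul (volume : Measure (ConfigSpace d))
        (fun ξ => cexp (2 * I * (⟪ξ, s⟫ : ℝ)) * Ψ ξ) ε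
      rw [← hP, finrank_euclideanSpace_fin, abs_of_nonneg (by positivity), real_smul] at h
      rw [← h]
      simp only [inner_smul_left, inner_smul_right, conj_trivial]
    have h2 := integral_comp_affine_fst
      (fun z => a z * ((∫ ξ, cexp (2 * I * (⟪ξ, x - z.1⟫ : ℝ)) * Ψ (ε • ξ)) *
        (cexp (I * (⟪(2 : ℝ) • z.1 - x, z.2⟫ : ℝ)) * angularFourier u z.2))) (-ε) hε0 x
    have h3 : regQuantization ψ ε (1 / 2) (oscMean 1 a) u x =
      ((Real.pi : ℂ) ^ d)⁻¹ * ∫ z, oscMean 1 a z * weylTest Ψ ε hε.ne' u x z :=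
      regQuantization_half _ Ψ ε hε.ne' u x
    rw [h3, ha.integral_oscMean_mul]
    simp only [chirpTransform_weylTest]
    have h4 (s : ConfigSpace d) : x - ((-ε) • s + x) = ε • s := by module
    simp only [h4, hPε, abs_inv, abs_pow, abs_neg, abs_of_pos hε] at h2
    simp_rw [mul_left_comm (a _) (((2 * Real.pi : ℝ) : ℂ)⁻¹ ^ d)]
    rw [integral_const_mul, mul_left_comm]
    congr 2
    simp_rw [mul_assoc (((ε ^ d)⁻¹ : ℝ) : ℂ), mul_left_comm (a _) (((ε ^ d)⁻¹ : ℝ) : ℂ)] at h2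
    rw [integral_const_mul, real_smul] at h2
    exact (mul_left_cancel₀ (ofReal_ne_zero.2 (by positivity)) h2).symm
  -- As `ε → 0+`, the argument of `a` moves to `x` while `P` keeps its total mass.
  have hlim : Tendsto (fun ε : ℝ => ∫ z : PhaseSpace d,
      a ((-ε) • z.1 + x, z.2) * (P z.1 * (cexp (I * (⟪(2 : ℝ) • ((-ε) • z.1 + x) - x, z.2⟫ : ℝ)) *
          angularFourier u z.2))) (𝓝[>] 0) (𝓝 (∫ z : PhaseSpace d,
      a ((-(0 : ℝ)) • z.1 + x, z.2) * (P z.1 *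
        (cexp (I * (⟪(2 : ℝ) • ((-(0 : ℝ)) • z.1 + x) - x, z.2⟫ : ℝ)) *
          angularFourier u z.2)))) := by
    have hac := ha.continuous
    refine tendsto_integral_filter_of_dominated_convergence (fun z : PhaseSpace d =>
      C 0 * (1 + ‖x‖) ^ |m| * ((1 * (1 + ‖z.1‖) ^ |m| * ‖P z.1‖) *
        (1 * (1 + ‖z.2‖) ^ |m| * ‖angularFourier u z.2‖)))
            (Eventually.of_forall fun ε => ?_) ?_ ?_ ?_
    · refine Continuous.aestronglyMeasurable ?_
      exact (hac.comp (by fun_prop)).mul ((P.continuous.comp continuous_fst).mul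
        ((continuous_cexp_I_mul (by fun_prop)).mul
          ((angularFourier u).continuous.comp continuous_snd)))
    · have hε : ∀ᶠ ε : ℝ in 𝓝[>] 0, ε < 1 := nhdsWithin_le_nhds (eventually_lt_nhds one_pos)
      filter_upwards [self_mem_nhdsWithin, hε] with ε hε hε1
      have hε0 : 0 < ε := hε
      refine Eventually.of_forall fun z => ?_
      rw [norm_mul, norm_mul, norm_mul, norm_cexp_I_mul, one_mul, one_mul, one_mul]
      have h2 : (1 + ‖(-ε) • z.1 + x‖) ^ |m| ≤ (1 + ‖x‖) ^ |m| * (1 + ‖z.1‖) ^ |m| := by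
        rw [← Real.mul_rpow (one_add_norm_pos _).le (one_add_norm_pos _).le]
        refine Real.rpow_le_rpow (one_add_norm_pos _).le ?_ (abs_nonneg _)
        have h3 : ‖(-ε) • z.1 + x‖ ≤ ‖z.1‖ + ‖x‖ := by
          refine (norm_add_le _ _).trans ?_
          rw [norm_smul, norm_neg, Real.norm_of_nonneg hε0.le]
          gcongr
          exact mul_le_of_le_one_left (norm_nonneg _) hε1.le
        nlinarith [norm_nonneg z.1, norm_nonneg x]
      calc ‖a ((-ε) • z.1 + x, z.2)‖ * (‖P z.1‖ * ‖angularFourier u z.2‖)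
          ≤ (C 0 * (((1 + ‖x‖) ^ |m| * (1 + ‖z.1‖) ^ |m|) * (1 + ‖z.2‖) ^ |m|)) *
            (‖P z.1‖ * ‖angularFourier u z.2‖) := by
            refine mul_le_mul_of_nonneg_right ((ha.norm_le_prod _ _).trans ?_) (by positivity)
            refine mul_le_mul_of_nonneg_left ?_ (ha.const_nonneg 0)
            exact mul_le_mul_of_nonneg_right h2 (by positivity)
        _ = _ := by ring
    · exact ((integrable_rpow_mul_schwartz 1 |m| P).mul_prod
        (integrable_rpow_mul_schwartz 1 |m| (angularFourier u))).const_mul _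
    · refine Eventually.of_forall fun z => ?_
      have hc : Continuous fun ε : ℝ => a ((-ε) • z.1 + x, z.2) * (P z.1 *
          (cexp (I * (⟪(2 : ℝ) • ((-ε) • z.1 + x) - x, z.2⟫ : ℝ)) * angularFourier u z.2)) :=
        (hac.comp (by fun_prop)).mul (continuous_const.mul
          ((continuous_cexp_I_mul (by fun_prop)).mul continuous_const))
      exact (hc.tendsto 0).mono_left nhdsWithin_le_nhds
  have hval : ((Real.pi : ℂ) ^ d)⁻¹ * ∫ z : PhaseSpace d, a ((-(0 : ℝ)) • z.1 + x, z.2) * (P z.1 *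
      (cexp (I * (⟪(2 : ℝ) • ((-(0 : ℝ)) • z.1 + x) - x, z.2⟫ : ℝ)) * angularFourier u z.2)) =
      ∫ ξ, cexp (I * (⟪x, ξ⟫ : ℝ)) * a (x, ξ) * angularFourier u ξ := by
    have h2 : (2 : ℝ) • x - x = x := by module
    simp only [neg_zero, zero_smul, zero_add, h2]
    have h3 := integral_prod_mul (μ := (volume : Measure (ConfigSpace d)))
      (ν := (volume : Measure (ConfigSpace d))) (fun s => P s)
      (fun ξ => cexp (I * (⟪x, ξ⟫ : ℝ)) * a (x, ξ) * angularFourier u ξ)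
    rw [hPint] at h3
    rw [inv_mul_eq_iff_eq_mul₀ (pow_ne_zero _ (ofReal_ne_zero.2 Real.pi_ne_zero)), ← h3,
      Measure.volume_eq_prod]
    refine integral_congr_ae (Eventually.of_forall fun z => ?_)
    simp only
    ring
  refine Tendsto.congr' (EventuallyEq.symm (eventually_nhdsWithin_of_forall fun ε hε =>
    hmain ε hε)) ?_
  rw [knQuantization, ← hval]
  exact (hlim.const_mul _).const_mul _

end Quantization

/-! ### The Wigner distribution -/

section WignerDistribution

open scoped FourierTransform

variable {d : ℕ}

/-- The complex conjugate of a Schwartz function. -/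
def schwartzConj (g : 𝓢(ConfigSpace d, ℂ)) : 𝓢(ConfigSpace d, ℂ) :=
  SchwartzMap.postcompCLM (𝕜 := ℝ) (conjCLE : ℂ →L[ℝ] ℂ) g

@[simp]
theorem schwartzConj_apply (g : 𝓢(ConfigSpace d, ℂ)) (x : ConfigSpace d) :
    schwartzConj g x = conj (g x) := rfl

/-- The phase `e^{i x · ξ}`. -/
def innerPhase (z : PhaseSpace d) : ℂ := cexp (I * (⟪z.1, z.2⟫ : ℝ))

theorem hasTemperateGrowth_innerPhase : Function.HasTemperateGrowth (innerPhase (d := d)) :=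
  ((ContinuousLinearMap.fst ℝ (ConfigSpace d) (ConfigSpace d)).hasTemperateGrowth.inner
    (ContinuousLinearMap.snd ℝ (ConfigSpace d) (ConfigSpace d)).hasTemperateGrowth).cexp_I_mul

/-- The function `R(x, ξ) = e^{i x · ξ} conj(g(x)) f̂(ξ)`, for which
`(a(x, D) f, g) = (2π)^{-d} ∫ a R`. -/
def rihaczek (f g : 𝓢(ConfigSpace d, ℂ)) : 𝓢(PhaseSpace d, ℂ) :=
  SchwartzMap.smulLeftCLM ℂ innerPhase (schwartzTensor (schwartzConj g) (angularFourier f))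

theorem rihaczek_apply (f g : 𝓢(ConfigSpace d, ℂ)) (z : PhaseSpace d) :
    rihaczek f g z = cexp (I * (⟪z.1, z.2⟫ : ℝ)) * (conj (g z.1) * angularFourier f z.2) := by
  rw [rihaczek, SchwartzMap.smulLeftCLM_apply_apply hasTemperateGrowth_innerPhase]
  rfl

theorem IsAmplitude.integral_knQuantization_mul_conj {m : ℝ} {C : ℕ → ℝ} {a : PhaseSpace d → ℂ}
    (ha : IsAmplitude m C a) (f g : 𝓢(ConfigSpace d, ℂ)) :
    ∫ x, knQuantization a f x * conj (g x) =
      ((2 * Real.pi : ℝ) : ℂ)⁻¹ ^ d * ∫ z, a z * rihaczek f g z := by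
  have hint : Integrable (fun z => a z * rihaczek f g z) := by
    refine (integrable_rpow_mul_schwartz (C 0) m (rihaczek f g)).mono'
      (ha.continuous.mul (rihaczek f g).continuous).aestronglyMeasurable
      (Eventually.of_forall fun z => ?_)
    rw [norm_mul]
    exact mul_le_mul_of_nonneg_right (ha.norm_le z) (norm_nonneg _)
  rw [Measure.volume_eq_prod, integral_prod _ (by exact hint), ← integral_const_mul]
  refine integral_congr_ae (Eventually.of_forall fun x => ?_)
  simp only [knQuantization, rihaczek_apply]
  rw [mul_assoc, ← integral_mul_const]
  refine congrArg _ (integral_congr_ae (Eventually.of_forall fun ξ => ?_))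
  simp only
  ring

/-- The conjugate Wigner distribution is the inverse chirp transform of `rihaczek f g`. -/
theorem chirpInverse_rihaczek (f g : 𝓢(ConfigSpace d, ℂ)) (z : PhaseSpace d) :
    chirpInverse (rihaczek f g) z = conj (wigner g f z) := by
  have hpi : (Real.pi : ℂ) ≠ 0 := ofReal_ne_zero.2 Real.pi_ne_zero
  have hexp (y : PhaseSpace d) :
      chirp (z.1 - y.1, y.2 - z.2) * cexp (I * (⟪y.1, y.2⟫ : ℝ)) =
        cexp (I * (⟪(2 : ℝ) • (y.1 - z.1), z.2⟫ : ℝ)) *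
          cexp (I * (⟪(2 : ℝ) • z.1 - y.1, y.2⟫ : ℝ)) := by
    rw [chirp, ← Complex.exp_add, ← Complex.exp_add]
    congr 1
    simp only [inner_sub_left, inner_sub_right, inner_smul_left, conj_trivial]
    push_cast
    ring
  have hint : Integrable (fun y => chirp (z.1 - y.1, y.2 - z.2) * rihaczek f g y) := by
    refine ((rihaczek f g).integrable (μ := volume)).mono ?_ (Eventually.of_forall fun y => ?_)
    · exact ((continuous_chirp.comp (by fun_prop)).mul
        (rihaczek f g).continuous).aestronglyMeasurable
    · rw [norm_mul, norm_chirp, one_mul]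
  have h1 : ∫ y, chirp (z.1 - y.1, y.2 - z.2) * rihaczek f g y =
      ((2 * Real.pi : ℝ) : ℂ) ^ d * ∫ x, conj (g x) *
        (cexp (I * (⟪(2 : ℝ) • (x - z.1), z.2⟫ : ℝ)) * f ((2 : ℝ) • z.1 - x)) := by
    rw [Measure.volume_eq_prod, integral_prod _ (by exact hint), ← integral_const_mul]
    refine integral_congr_ae (Eventually.of_forall fun x => ?_)
    simp only [rihaczek_apply]
    have h2 (ξ : ConfigSpace d) : chirp (z.1 - x, ξ - z.2) * (cexp (I * (⟪x, ξ⟫ : ℝ)) *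
        (conj (g x) * angularFourier f ξ)) =
        (conj (g x) * cexp (I * (⟪(2 : ℝ) • (x - z.1), z.2⟫ : ℝ))) *
          (cexp (I * (⟪(2 : ℝ) • z.1 - x, ξ⟫ : ℝ)) * angularFourier f ξ) := by
      linear_combination (conj (g x) * angularFourier f ξ) * hexp (x, ξ)
    simp_rw [h2]
    rw [integral_const_mul, integral_cexp_mul_angularFourier]
    ring
  have h3 := integral_comp_affine (fun x => conj (g x) *
    (cexp (I * (⟪(2 : ℝ) • (x - z.1), z.2⟫ : ℝ)) * f ((2 : ℝ) • z.1 - x))) (1 / 2) (by norm_num) z.1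
  rw [abs_of_nonneg (by positivity), real_smul] at h3
  have h4 : conj (wigner g f z) = ∫ y : ConfigSpace d, conj (g ((1 / 2 : ℝ) • y + z.1)) *
    (cexp (I * (⟪(2 : ℝ) • ((1 / 2 : ℝ) • y + z.1 - z.1), z.2⟫ : ℝ)) *
      f ((2 : ℝ) • z.1 - ((1 / 2 : ℝ) • y + z.1))) := by
    rw [wigner, ← integral_conj]
    refine integral_congr_ae (Eventually.of_forall fun y => ?_)
    have e1 : (2 : ℝ) • ((1 / 2 : ℝ) • y + z.1 - z.1) = y := by module
    have e2 : (2 : ℝ) • z.1 - ((1 / 2 : ℝ) • y + z.1) = z.1 - (1 / 2 : ℝ) • y := by module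
    simp only [map_mul, ← Complex.exp_conj, map_neg, conj_I, conj_ofReal, neg_neg, conj_conj]
    rw [e1, e2, add_comm z.1]
    ring
  rw [h4, h3, chirpInverse_apply, h1, ← mul_assoc]
  congr 1
  push_cast
  rw [mul_pow]
  simp only [one_div, inv_pow, inv_inv]
  field_simp

/-- The tempered distribution given by the oscillatory mean of an amplitude `a` is a Weyl symbol of
`a(x, D)`. -/
theorem IsAmplitude.isWeylSymbol {m : ℝ} {C : ℕ → ℝ} {a : PhaseSpace d → ℂ}
    (ha : IsAmplitude m C a) {T : 𝓢'(PhaseSpace d, ℂ)}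
    (hT : ∀ Φ : 𝓢(PhaseSpace d, ℂ), T Φ = ∫ z, oscMean 1 a z * Φ z) :
    IsWeylSymbol T (knQuantization a) := by
  intro f g
  refine ⟨chirpInverse (rihaczek f g), chirpInverse_rihaczek f g, ?_⟩
  rw [ha.integral_knQuantization_mul_conj, hT, ha.integral_oscMean_mul,
    chirpTransform_chirpInverse]

end WignerDistribution

/-! ### Tensor products separate tempered distributions -/

section TensorDensity

open scoped LineDeriv BoundedContinuousFunction

variable {V : Type*} [NormedAddCommGroup V] [NormedSpace ℝ V]

/-- The Banach space of bounded continuous functions with values in a normed space. The definition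
fixes the metric of `F` to the one given by its norm. -/
abbrev BoundedFunctions (V F : Type*) [TopologicalSpace V] [NormedAddCommGroup F] : Type _ := V →ᵇ F

/-- The Banach space of bounded families of `n`-linear forms on `V`, indexed by `V`. -/
abbrev JetSpace (V : Type*) [NormedAddCommGroup V] [NormedSpace ℝ V] (n : ℕ) : Type _ :=
  BoundedFunctions V (V [×n]→L[ℝ] ℂ)

/-- The derivative of order `n` weighted with `‖z‖ ^ k`, as a bounded continuous function. -/
def weightedJet (k n : ℕ) : 𝓢(V, ℂ) →ₗ[ℂ] JetSpace V n where
  toFun f := BoundedContinuousFunction.ofNormedAddCommGroup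
    (fun z => ‖z‖ ^ k • iteratedFDeriv ℝ n f z)
    ((continuous_norm.pow k).smul ((f.smooth ⊤).continuous_iteratedFDeriv (mod_cast le_top)))
    (SchwartzMap.seminorm ℝ k n f) fun z => by
      rw [norm_smul, norm_pow, norm_norm]
      exact SchwartzMap.le_seminorm ℝ k n f z
  map_add' f g := by
    ext1 z
    have h : iteratedFDeriv ℝ n (⇑(f + g)) z = iteratedFDeriv ℝ n f z + iteratedFDeriv ℝ n g z :=
      iteratedFDeriv_add_apply (f.smooth n).contDiffAt (g.smooth n).contDiffAt
    exact (congrArg (fun x => ‖z‖ ^ k • x) h).trans (smul_add _ _ _)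
  map_smul' c f := by
    ext1 z
    have h : iteratedFDeriv ℝ n (⇑(c • f)) z = c • iteratedFDeriv ℝ n f z :=
      iteratedFDeriv_const_smul_apply (f.smooth n).contDiffAt
    exact (congrArg (fun x => ‖z‖ ^ k • x) h).trans (smul_comm _ _ _)

theorem weightedJet_apply (k n : ℕ) (f : 𝓢(V, ℂ)) (z : V) :
    weightedJet k n f z = ‖z‖ ^ k • iteratedFDeriv ℝ n f z := rfl

theorem seminorm_le_norm_weightedJet (k n : ℕ) (f : 𝓢(V, ℂ)) :
    SchwartzMap.seminorm ℂ k n f ≤ ‖weightedJet k n f‖ :=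
  SchwartzMap.seminorm_le_bound ℂ k n f (norm_nonneg _) fun z => by
    have h := (weightedJet k n f).norm_coe_le_norm z
    rwa [weightedJet_apply, norm_smul, norm_pow, norm_norm] at h

/-- Finitely many weighted derivatives. -/
def weightedJets (s : Finset (ℕ × ℕ)) :
    𝓢(V, ℂ) →ₗ[ℂ] ((i : s) → JetSpace V i.1.2) :=
  LinearMap.pi fun i => weightedJet i.1.1 i.1.2

/-- By the Hahn-Banach theorem, a functional bounded by `‖J f‖` is a continuous functional of
`J f`. -/
theorem LinearMap.exists_strongDual_comp_eq {M Y : Type*} [AddCommGroup M] [Module ℂ M]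
    [NormedAddCommGroup Y] [NormedSpace ℂ Y] (J : M →ₗ[ℂ] Y) (v : M →ₗ[ℂ] ℂ) (C : ℝ)
    (hb : ∀ f, ‖v f‖ ≤ C * ‖J f‖) : ∃ ℓ : StrongDual ℂ Y, ∀ f, v f = ℓ (J f) := by
  obtain ⟨g, hg⟩ := J.rangeRestrict.exists_rightInverse_of_surjective
    (LinearMap.range_rangeRestrict _)
  have hg' (y : J.range) : J (g y) = y := congrArg Subtype.val (LinearMap.congr_fun hg y)
  set ℓ₀ : StrongDual ℂ J.range := (v ∘ₗ g).mkContinuous C fun y => by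
    have h := hb (g y)
    rw [hg'] at h
    exact h
  obtain ⟨ℓ, hℓ, -⟩ := exists_extension_norm_eq _ ℓ₀
  refine ⟨ℓ, fun f => ?_⟩
  rw [hℓ ⟨J f, LinearMap.mem_range_self _ f⟩]
  change v f = v (g _)
  have h2 := hb (f - g ⟨J f, LinearMap.mem_range_self _ f⟩)
  rw [map_sub, map_sub, hg', sub_self, norm_zero, mul_zero] at h2
  exact sub_eq_zero.1 (norm_le_zero_iff.1 h2)

/-- A continuous functional on Schwartz space factors through finitely many weighted derivatives,
hence through a Banach space. -/
theorem exists_factor_weightedJets (v : 𝓢(V, ℂ) →L[ℂ] ℂ) :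
    ∃ (s : Finset (ℕ × ℕ)) (ℓ : StrongDual ℂ ((i : s) → JetSpace V i.1.2)),
      ∀ f, v f = ℓ (weightedJets s f) := by
  obtain ⟨s, C, -, hC⟩ := Seminorm.bound_of_continuous (schwartz_withSeminorms ℂ V ℂ)
    ((normSeminorm ℂ ℂ).comp v.toLinearMap) (continuous_norm.comp v.continuous)
  refine ⟨s, (weightedJets s).exists_strongDual_comp_eq v.toLinearMap C fun f => ?_⟩
  refine (hC f).trans ?_
  rw [_root_.smul_apply]
  refine mul_le_mul_of_nonneg_left ?_ C.2
  refine Seminorm.finset_sup_apply_le (norm_nonneg _) fun i hi => ?_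
  exact (seminorm_le_norm_weightedJet i.1 i.2 f).trans
    (norm_le_pi_norm (weightedJets s f) ⟨i, hi⟩)

theorem exists_one_add_norm_pow_mul_le (f : 𝓢(V, ℂ)) (k n : ℕ) :
    ∃ B, 0 ≤ B ∧ ∀ y, (1 + ‖y‖) ^ k * ‖iteratedFDeriv ℝ n f y‖ ≤ B := by
  refine ⟨_, ?_, fun y =>
    SchwartzMap.one_add_le_sup_seminorm_apply (𝕜 := ℝ) (m := (k, n)) le_rfl le_rfl f y⟩
  positivity

theorem norm_pow_mul_iteratedFDeriv_sub_le {f : 𝓢(V, ℂ)} {k n : ℕ} {B : ℝ}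
    (hB : ∀ y, (1 + ‖y‖) ^ k * ‖iteratedFDeriv ℝ n f y‖ ≤ B) (z w : V) :
    ‖z‖ ^ k * ‖iteratedFDeriv ℝ n f (z - w)‖ ≤ (1 + ‖w‖) ^ k * B := by
  have h1 : ‖z‖ ≤ (1 + ‖w‖) * (1 + ‖z - w‖) := by
    have h2 : ‖z‖ ≤ ‖z - w‖ + ‖w‖ := by simpa using norm_add_le (z - w) w
    nlinarith [norm_nonneg w, norm_nonneg (z - w)]
  calc ‖z‖ ^ k * ‖iteratedFDeriv ℝ n f (z - w)‖
      ≤ ((1 + ‖w‖) * (1 + ‖z - w‖)) ^ k * ‖iteratedFDeriv ℝ n f (z - w)‖ := by gcongr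
    _ = (1 + ‖w‖) ^ k * ((1 + ‖z - w‖) ^ k * ‖iteratedFDeriv ℝ n f (z - w)‖) := by
        rw [mul_pow]; ring
    _ ≤ _ := by gcongr; exact hB _

theorem weightedJet_translate_apply (f : 𝓢(V, ℂ)) (k n : ℕ) (w z : V) :
    weightedJet k n (SchwartzMap.compSubConstCLM ℂ w f) z =
      ‖z‖ ^ k • iteratedFDeriv ℝ n f (z - w) := by
  rw [weightedJet_apply]
  congr 1
  exact iteratedFDeriv_comp_sub n w z

theorem exists_norm_weightedJet_translate_le (f : 𝓢(V, ℂ)) (k n : ℕ) :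
    ∃ B, 0 ≤ B ∧ ∀ w, ‖weightedJet k n (SchwartzMap.compSubConstCLM ℂ w f)‖ ≤
      B * (1 + ‖w‖) ^ k := by
  obtain ⟨B, hB0, hB⟩ := exists_one_add_norm_pow_mul_le f k n
  refine ⟨B, hB0, fun w => (BoundedContinuousFunction.norm_le (by positivity)).2 fun z => ?_⟩
  rw [weightedJet_translate_apply, norm_smul, norm_pow, norm_norm, mul_comm B]
  exact norm_pow_mul_iteratedFDeriv_sub_le hB z w

theorem continuous_weightedJet_translate (f : 𝓢(V, ℂ)) (k n : ℕ) :
    Continuous fun w => weightedJet k n (SchwartzMap.compSubConstCLM ℂ w f) := by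
  obtain ⟨B, hB0, hB⟩ := exists_one_add_norm_pow_mul_le f k (n + 1)
  refine continuous_iff_continuousAt.2 fun w₀ => ?_
  -- The derivative of the translated jet is a jet of order `n + 1`, bounded near `w₀`.
  have hlip : ∀ w ∈ Metric.closedBall w₀ 1,
      ‖weightedJet k n (SchwartzMap.compSubConstCLM ℂ w f) -
        weightedJet k n (SchwartzMap.compSubConstCLM ℂ w₀ f)‖ ≤
      (2 + ‖w₀‖) ^ k * B * ‖w - w₀‖ := by
    intro w hw
    refine (BoundedContinuousFunction.norm_le (by positivity)).2 fun z => ?_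
    rw [BoundedContinuousFunction.sub_apply, weightedJet_translate_apply,
      weightedJet_translate_apply]
    have hd (y : V) : HasFDerivAt (fun y => ‖z‖ ^ k • iteratedFDeriv ℝ n f (z - y))
        (‖z‖ ^ k • (fderiv ℝ (iteratedFDeriv ℝ n f) (z - y)).comp
          (-ContinuousLinearMap.id ℝ V)) y := by
      have h1 : DifferentiableAt ℝ (iteratedFDeriv ℝ n f) (z - y) :=
        ((f.smooth ⊤).differentiable_iteratedFDeriv (mod_cast WithTop.coe_lt_top n)) _
      exact (h1.hasFDerivAt.comp y ((hasFDerivAt_id y).const_sub z)).const_smul (‖z‖ ^ k)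
    refine Convex.norm_image_sub_le_of_norm_hasFDerivWithin_le
      (fun y _ => (hd y).hasFDerivWithinAt) (fun y hy => ?_) (convex_closedBall w₀ 1)
      (Metric.mem_closedBall_self zero_le_one) hw
    have hy' : ‖y‖ ≤ 1 + ‖w₀‖ := by
      have h1 : ‖y - w₀‖ ≤ 1 := by simpa [dist_eq_norm] using hy
      have h2 : ‖y‖ ≤ ‖y - w₀‖ + ‖w₀‖ := by simpa using norm_add_le (y - w₀) w₀
      linarith
    rw [ContinuousLinearMap.comp_neg, ContinuousLinearMap.comp_id, norm_smul, norm_neg, norm_pow,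
      norm_norm, norm_fderiv_iteratedFDeriv]
    refine (norm_pow_mul_iteratedFDeriv_sub_le hB z y).trans ?_
    gcongr ?_ ^ k * B
    linarith
  rw [ContinuousAt, tendsto_iff_norm_sub_tendsto_zero]
  have h0 : Tendsto (fun w => (2 + ‖w₀‖) ^ k * B * ‖w - w₀‖) (𝓝 w₀) (𝓝 0) := by
    have : Continuous fun w => (2 + ‖w₀‖) ^ k * B * ‖w - w₀‖ := by fun_prop
    simpa using this.tendsto w₀
  refine squeeze_zero' (Eventually.of_forall fun _ => norm_nonneg _) ?_ h0
  filter_upwards [Metric.closedBall_mem_nhds w₀ one_pos] with w hw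
  exact hlip w hw

theorem continuous_apply_translate (v : 𝓢(V, ℂ) →L[ℂ] ℂ) (f : 𝓢(V, ℂ)) :
    Continuous fun w => v (SchwartzMap.compSubConstCLM ℂ w f) := by
  obtain ⟨s, ℓ, hℓ⟩ := exists_factor_weightedJets v
  simp only [hℓ]
  exact ℓ.continuous.comp (continuous_pi fun i => continuous_weightedJet_translate f i.1.1 i.1.2)

theorem lineDerivOp_comm (a b : V) (f : 𝓢(V, ℂ)) :
    ∂_{a} (∂_{b} f : 𝓢(V, ℂ)) = (∂_{b} (∂_{a} f : 𝓢(V, ℂ)) : 𝓢(V, ℂ)) := by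
  have h (a b : V) (x : V) : (∂_{a} (∂_{b} f : 𝓢(V, ℂ)) : 𝓢(V, ℂ)) x =
      fderiv ℝ (fderiv ℝ f) x a b := by
    have h1 : ⇑(∂_{b} f : 𝓢(V, ℂ)) = fun y => fderiv ℝ f y b := by
      ext y
      exact SchwartzMap.lineDerivOp_apply_eq_fderiv b f y
    have h2 : DifferentiableAt ℝ (fderiv ℝ f) x :=
      ((f.smooth 2).fderiv_right (m := 1) (by norm_num)).differentiable (by simp) x
    rw [SchwartzMap.lineDerivOp_apply_eq_fderiv, h1]
    rw [(h2.hasFDerivAt.clm_apply (hasFDerivAt_const b x)).fderiv]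
    simp
  ext x
  rw [h, h]
  have hs : IsSymmSndFDerivAt ℝ f x := (f.smooth 2).contDiffAt.isSymmSndFDerivAt (by simp)
  exact hs a b

theorem iteratedLineDerivOp_lineDerivOp {n : ℕ} (m : Fin n → V) (a : V) (f : 𝓢(V, ℂ)) :
    ∂^{m} (∂_{a} f : 𝓢(V, ℂ)) = (∂_{a} (∂^{m} f : 𝓢(V, ℂ)) : 𝓢(V, ℂ)) := by
  induction n with
  | zero => rfl
  | succ n ih => rw [LineDeriv.iteratedLineDerivOp_succ_left, ih, lineDerivOp_comm,
      ← LineDeriv.iteratedLineDerivOp_succ_left]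

variable [FiniteDimensional ℝ V] [MeasureSpace V] [BorelSpace V]
  [(volume : Measure V).IsAddHaarMeasure]

theorem integrable_smul_weightedJets (ρ f : 𝓢(V, ℂ)) (s : Finset (ℕ × ℕ)) :
    Integrable fun w => ρ w • weightedJets s (SchwartzMap.compSubConstCLM ℂ w f) := by
  have hc : Continuous fun w => weightedJets s (SchwartzMap.compSubConstCLM ℂ w f) :=
    continuous_pi fun i => continuous_weightedJet_translate f i.1.1 i.1.2
  choose B hB0 hB using fun i : ℕ × ℕ => exists_norm_weightedJet_translate_le f i.1 i.2
  have hi := integrable_finsetSum Finset.univ fun (i : s) _ =>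
    integrable_rpow_mul_schwartz (μ := volume) (B i) (i.1.1 : ℝ) ρ
  have : ProperSpace V := FiniteDimensional.proper ℝ V
  have : SecondCountableTopologyEither V ((i : s) → JetSpace V i.1.2) :=
    secondCountableTopologyEither_of_left V _
  refine hi.mono' (ρ.continuous.smul hc).aestronglyMeasurable (Eventually.of_forall fun w => ?_)
  have hnn (i : s) : 0 ≤ B i * (1 + ‖w‖) ^ (i.1.1 : ℝ) := mul_nonneg (hB0 i) (by positivity)
  rw [norm_smul, mul_comm, ← Finset.sum_mul]
  refine mul_le_mul_of_nonneg_right ?_ (norm_nonneg _)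
  refine (pi_norm_le_iff_of_nonneg (Finset.sum_nonneg fun i _ => hnn i)).2 fun i => ?_
  refine ((hB i.1 w).trans_eq ?_).trans (Finset.single_le_sum (fun i _ => hnn i)
    (Finset.mem_univ i))
  rw [Real.rpow_natCast]

theorem integral_mul_lineDerivOp_sub (ρ f : 𝓢(V, ℂ)) (a z : V) :
    ∫ w, ρ w * (∂_{a} f : 𝓢(V, ℂ)) (z - w) = ∫ w, (∂_{a} ρ : 𝓢(V, ℂ)) w * f (z - w) := by
  set g : 𝓢(V, ℂ) := SchwartzMap.compCLMOfContinuousLinearEquiv ℂ (ContinuousLinearEquiv.neg ℝ)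
    (SchwartzMap.compSubConstCLM ℂ (-z) f)
  have hg (w : V) : g w = f (z - w) := by
    change f (-w - -z) = _
    congr 1
    abel
  have hg' (w : V) : (∂_{a} g : 𝓢(V, ℂ)) w = -(∂_{a} f : 𝓢(V, ℂ)) (z - w) := by
    rw [SchwartzMap.lineDerivOp_apply_eq_fderiv, SchwartzMap.lineDerivOp_apply_eq_fderiv,
      show ⇑g = fun w => f (z - w) from funext hg]
    have h := (f.differentiableAt (x := z - w)).hasFDerivAt.comp w
      ((hasFDerivAt_id w).const_sub z)
    rw [Function.comp_def] at h
    rw [h.fderiv]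
    simp
  have h := SchwartzMap.integral_mul_lineDerivOp_right_eq_neg_left (μ := volume) ρ g a
  simp only [hg, hg', mul_neg, integral_neg, neg_inj] at h
  exact h

/-- Both sides are the same derivative of the convolution of `ρ` and `f`. -/
theorem integral_mul_iteratedLineDerivOp_sub {n : ℕ} (m : Fin n → V) (ρ f : 𝓢(V, ℂ)) (z : V) :
    ∫ w, ρ w * (∂^{m} f : 𝓢(V, ℂ)) (z - w) = ∫ w, f w * (∂^{m} ρ : 𝓢(V, ℂ)) (z - w) := by
  induction n generalizing ρ with
  | zero =>
    simp only [LineDeriv.iteratedLineDerivOp_fin_zero]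
    rw [← integral_sub_left_eq_self _ _ z]
    simp [mul_comm]
  | succ n ih =>
    rw [LineDeriv.iteratedLineDerivOp_succ_left, LineDeriv.iteratedLineDerivOp_succ_left,
      integral_mul_lineDerivOp_sub, ih, iteratedLineDerivOp_lineDerivOp]

/-- Commutativity of convolution, tested against a continuous functional. Such a functional factors
through a Banach space in which the convolution is a Bochner integral. -/
theorem integral_mul_translate_comm (v : 𝓢(V, ℂ) →L[ℂ] ℂ) (ρ f : 𝓢(V, ℂ)) :
    ∫ w, ρ w * v (SchwartzMap.compSubConstCLM ℂ w f) =
      ∫ w, f w * v (SchwartzMap.compSubConstCLM ℂ w ρ) := by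
  obtain ⟨s, ℓ, hℓ⟩ := exists_factor_weightedJets v
  have h1 (ρ f : 𝓢(V, ℂ)) : ∫ w, ρ w * v (SchwartzMap.compSubConstCLM ℂ w f) =
      ℓ (∫ w, ρ w • weightedJets s (SchwartzMap.compSubConstCLM ℂ w f)) := by
    rw [← ℓ.integral_comp_comm (integrable_smul_weightedJets ρ f s)]
    refine integral_congr_ae (Eventually.of_forall fun w => ?_)
    simp [hℓ]
  rw [h1, h1]
  congr 1
  have h2 (ρ f : 𝓢(V, ℂ)) (i : s) (z : V) (m : Fin i.1.2 → V) :
      (∫ w, ρ w • weightedJets s (SchwartzMap.compSubConstCLM ℂ w f)) i z m =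
        ‖z‖ ^ i.1.1 • ∫ w, ρ w * (∂^{m} f : 𝓢(V, ℂ)) (z - w) := by
    set L : ((i : s) → JetSpace V i.1.2) →L[ℝ] ℂ :=
      (ContinuousMultilinearMap.apply ℝ (fun _ : Fin i.1.2 => V) ℂ m).comp
        ((BoundedContinuousFunction.evalCLM ℝ z).comp (ContinuousLinearMap.proj i))
    have h3 : L (∫ w, ρ w • weightedJets s (SchwartzMap.compSubConstCLM ℂ w f)) = _ :=
      (L.integral_comp_comm (integrable_smul_weightedJets ρ f s)).symm
    refine h3.trans ?_
    rw [← integral_smul]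
    refine integral_congr_ae (Eventually.of_forall fun w => ?_)
    have h4 : L (ρ w • weightedJets s (SchwartzMap.compSubConstCLM ℂ w f)) =
      ρ w * weightedJet i.1.1 i.1.2 (SchwartzMap.compSubConstCLM ℂ w f) z m := rfl
    simp only [h4, weightedJet_translate_apply, SchwartzMap.iteratedLineDerivOp_eq_iteratedFDeriv]
    simp
    ring
  ext i z m
  rw [h2, h2, integral_mul_iteratedLineDerivOp_sub]

variable {d : ℕ}

/-- A tempered distribution which vanishes on all tensor products vanishes. -/
theorem eq_zero_of_schwartzTensor (v : 𝓢(PhaseSpace d, ℂ) →L[ℂ] ℂ)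
    (hv : ∀ f g : 𝓢(ConfigSpace d, ℂ), v (schwartzTensor f g) = 0) : v = 0 := by
  ext f
  set c : PhaseSpace d → ℂ := fun w => v (SchwartzMap.compSubConstCLM ℂ w f)
  have hc : Continuous c := continuous_apply_translate v f
  have hc0 : c 0 = v f := by simp [c]
  have hzero (g : 𝓢(ConfigSpace d, ℂ)) : ∫ w, schwartzTensor g g w * c w = 0 := by
    have h1 (w : PhaseSpace d) : v (SchwartzMap.compSubConstCLM ℂ w (schwartzTensor g g)) = 0 :=
      hv (SchwartzMap.compSubConstCLM ℂ w.1 g) (SchwartzMap.compSubConstCLM ℂ w.2 g)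
    rw [integral_mul_translate_comm v (schwartzTensor g g) f]
    simp [h1]
  rw [_root_.zero_apply, ← hc0]
  refine norm_le_zero_iff.1 (le_of_forall_pos_le_add fun ε hε => ?_)
  rw [zero_add]
  obtain ⟨δ, hδ, hcδ⟩ := Metric.continuousAt_iff.1 hc.continuousAt ε hε
  -- A product of bump functions of integral one, supported in the ball of radius `δ`.
  let β : ContDiffBump (0 : ConfigSpace d) := ⟨δ / 2, δ, half_pos hδ, half_lt_self hδ⟩
  set g₀ : ConfigSpace d → ℝ := β.normed volume with hg₀
  have hg₀c : HasCompactSupport fun x => ((g₀ x : ℝ) : ℂ) :=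
    (β.hasCompactSupport_normed).comp_left (g := ((↑) : ℝ → ℂ)) ofReal_zero
  set g : 𝓢(ConfigSpace d, ℂ) :=
    hg₀c.toSchwartzMap (ofRealCLM.contDiff.comp (β.contDiff_normed))
  have hg (x : ConfigSpace d) : g x = ((g₀ x : ℝ) : ℂ) := rfl
  set p : PhaseSpace d → ℝ := fun w => g₀ w.1 * g₀ w.2 with hp
  have hpg (w : PhaseSpace d) : schwartzTensor g g w = ((p w : ℝ) : ℂ) := by
    rw [schwartzTensor_apply, hg, hg, ← ofReal_mul]
  have hp0 (w : PhaseSpace d) : 0 ≤ p w := mul_nonneg (β.nonneg_normed _) (β.nonneg_normed _)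
  have hp1 : ∫ w, p w = 1 := by
    have h := integral_prod_mul (μ := (volume : Measure (ConfigSpace d)))
      (ν := (volume : Measure (ConfigSpace d))) g₀ g₀
    rw [hg₀, β.integral_normed, one_mul] at h
    exact h
  have hpi : Integrable p := by
    have h := ((schwartzTensor g g).integrable (μ := volume)).norm
    refine h.congr (Eventually.of_forall fun w => ?_)
    simp only [hpg, norm_real, Real.norm_of_nonneg (hp0 w)]
  have hpc : Continuous p := (β.continuous_normed.comp continuous_fst).mul
    (β.continuous_normed.comp continuous_snd)
  have hps (w : PhaseSpace d) (hw : p w ≠ 0) : dist w 0 < δ := by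
    have h (x : ConfigSpace d) (hx : g₀ x ≠ 0) : ‖x‖ < δ := by
      have : x ∈ Function.support g₀ := hx
      rw [hg₀, β.support_normed_eq] at this
      simpa using this
    rw [dist_zero_right, Prod.norm_def]
    exact max_lt (h _ (left_ne_zero_of_mul hw)) (h _ (right_ne_zero_of_mul hw))
  have hle (w : PhaseSpace d) : ‖(p w : ℂ) * (c 0 - c w)‖ ≤ p w * ε := by
    rw [norm_mul, norm_real, Real.norm_of_nonneg (hp0 w)]
    by_cases hw : p w = 0
    · simp [hw]
    · refine mul_le_mul_of_nonneg_left ?_ (hp0 w)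
      rw [← dist_eq_norm, dist_comm]
      exact (hcδ (hps w hw)).le
  have hi1 : Integrable fun w => (p w : ℂ) * (c 0 - c w) :=
    (hpi.mul_const ε).mono' ((continuous_ofReal.comp hpc).mul
      (continuous_const.sub hc)).aestronglyMeasurable (Eventually.of_forall hle)
  have hi2 : Integrable fun w => (p w : ℂ) * c 0 := hpi.ofReal.mul_const _
  have hval : ∫ w, (p w : ℂ) * (c 0 - c w) = c 0 := by
    have h1 : (fun w => (p w : ℂ) * c w) =
        fun w => (p w : ℂ) * c 0 - (p w : ℂ) * (c 0 - c w) := by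
      ext w
      ring
    have h2 := hzero g
    simp only [hpg, h1] at h2
    rw [integral_sub hi2 hi1, integral_mul_const, integral_complex_ofReal, hp1, ofReal_one, one_mul,
      sub_eq_zero] at h2
    exact h2.symm
  -- `c` averages to zero against the bump, and it differs from `c 0` by at most `ε` on its support.
  calc ‖c 0‖ = ‖∫ w, (p w : ℂ) * (c 0 - c w)‖ := by rw [hval]
    _ ≤ ∫ w, p w * ε := norm_integral_le_of_norm_le (hpi.mul_const ε) (Eventually.of_forall hle)
    _ = ε := by rw [integral_mul_const, hp1, one_mul]

theorem innerPhase_neg_mul (z : PhaseSpace d) :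
    innerPhase z * cexp (I * ((-⟪z.1, z.2⟫ : ℝ) : ℂ)) = 1 := by
  rw [innerPhase, ← Complex.exp_add, ofReal_neg, mul_neg, add_neg_cancel, Complex.exp_zero]

/-- A tempered distribution whose Weyl quantization vanishes is zero. -/
theorem eq_zero_of_chirpInverse_rihaczek (v : 𝓢(PhaseSpace d, ℂ) →L[ℂ] ℂ)
    (hv : ∀ f g : 𝓢(ConfigSpace d, ℂ), v (chirpInverse (rihaczek f g)) = 0) : v = 0 := by
  have h1 : v ∘L chirpInverse ∘L SchwartzMap.smulLeftCLM ℂ innerPhase = 0 := by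
    refine eq_zero_of_schwartzTensor _ fun f g => ?_
    obtain ⟨g', rfl⟩ := angularFourier_surjective g
    have h2 : schwartzConj (schwartzConj f) = f := by
      ext x
      simp
    rw [← h2]
    exact hv g' (schwartzConj f)
  have hq : Function.HasTemperateGrowth fun z : PhaseSpace d =>
      cexp (I * ((-⟪z.1, z.2⟫ : ℝ) : ℂ)) :=
    ((ContinuousLinearMap.fst ℝ (ConfigSpace d) (ConfigSpace d)).hasTemperateGrowth.inner
      (ContinuousLinearMap.snd ℝ (ConfigSpace d) (ConfigSpace d)).hasTemperateGrowth).neg.cexp_I_mul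
  ext Φ
  have h3 := DFunLike.congr_fun h1 (SchwartzMap.smulLeftCLM ℂ
    (fun z : PhaseSpace d => cexp (I * ((-⟪z.1, z.2⟫ : ℝ) : ℂ))) (chirpTransform Φ))
  have h4 : SchwartzMap.smulLeftCLM ℂ innerPhase (SchwartzMap.smulLeftCLM ℂ
    (fun z : PhaseSpace d => cexp (I * ((-⟪z.1, z.2⟫ : ℝ) : ℂ))) (chirpTransform Φ)) =
      chirpTransform Φ := by
    ext z
    rw [SchwartzMap.smulLeftCLM_apply_apply hasTemperateGrowth_innerPhase,
      SchwartzMap.smulLeftCLM_apply_apply hq, smul_smul, innerPhase_neg_mul, one_smul]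
  simp only [ContinuousLinearMap.comp_apply, h4, chirpInverse_chirpTransform] at h3
  exact h3

/-- The Weyl symbol of an operator is unique. -/
theorem IsWeylSymbol.unique {S T : 𝓢'(PhaseSpace d, ℂ)}
    {A : 𝓢(ConfigSpace d, ℂ) → ConfigSpace d → ℂ} (hS : IsWeylSymbol S A)
    (hT : IsWeylSymbol T A) : S = T := by
  let v : 𝓢(PhaseSpace d, ℂ) →L[ℂ] ℂ :=
    { toFun := fun Φ => (S - T) Φ
      map_add' := map_add (S - T)
      map_smul' := map_smul (S - T)
      cont := (S - T).continuous }
  have hv : v = 0 := by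
    refine eq_zero_of_chirpInverse_rihaczek v fun f g => ?_
    obtain ⟨Φ, hΦ, h1⟩ := hS f g
    obtain ⟨Ψ, hΨ, h2⟩ := hT f g
    have h3 : Φ = chirpInverse (rihaczek f g) := by
      ext z
      rw [hΦ, chirpInverse_rihaczek]
    have h4 : Ψ = chirpInverse (rihaczek f g) := by
      ext z
      rw [hΨ, chirpInverse_rihaczek]
    have hne : ((2 * Real.pi : ℝ) : ℂ)⁻¹ ^ d ≠ 0 :=
      pow_ne_zero _ (inv_ne_zero (ofReal_ne_zero.2 (by positivity)))
    have h5 : S Φ = T Ψ := mul_left_cancel₀ hne (h1.symm.trans h2)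
    rw [h3, h4] at h5
    exact sub_eq_zero.2 h5
  ext Φ
  exact sub_eq_zero.1 (DFunLike.congr_fun hv Φ)

end TensorDensity

/-! ### Symbols depending on the semiclassical parameter -/

section Semiclassical

variable {d : ℕ}

theorem rpow_le_two_rpow_mul {x y : ℝ} (hx : 0 < x) (hy : 0 < y) (h1 : x ≤ 2 * y) (h2 : y ≤ 2 * x)
    (r : ℝ) : x ^ r ≤ 2 ^ |r| * y ^ r := by
  rcases le_total 0 r with hr | hr
  · rw [abs_of_nonneg hr, ← Real.mul_rpow zero_le_two hy.le]
    exact Real.rpow_le_rpow hx.le h1 hr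
  · rw [abs_of_nonpos hr, Real.rpow_neg zero_le_two, ← Real.inv_rpow zero_le_two,
      ← Real.mul_rpow (by norm_num) hy.le]
    exact Real.rpow_le_rpow_of_nonpos (by positivity) (by linarith) hr

theorem japaneseBracket_sq (z : PhaseSpace d) : japaneseBracket z ^ 2 = bracketSq z := by
  rw [japaneseBracket, Real.sq_sqrt (by positivity), bracketSq_eq]

theorem japaneseBracket_pos (z : PhaseSpace d) : 0 < japaneseBracket z :=
  Real.sqrt_pos.2 (by positivity)

theorem japaneseBracket_le (z : PhaseSpace d) : japaneseBracket z ≤ 2 * (1 + ‖z‖) := by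
  have h := bracketSq_le z
  rw [← japaneseBracket_sq] at h
  nlinarith [one_add_norm_pos z, japaneseBracket_pos z]

theorem one_add_norm_le (z : PhaseSpace d) : 1 + ‖z‖ ≤ 2 * japaneseBracket z := by
  have h := one_add_norm_sq_le z
  rw [← japaneseBracket_sq] at h
  nlinarith [one_add_norm_pos z, japaneseBracket_pos z]

theorem japaneseBracket_rpow_le (z : PhaseSpace d) (r : ℝ) :
    japaneseBracket z ^ r ≤ 2 ^ |r| * (1 + ‖z‖) ^ r :=
  rpow_le_two_rpow_mul (japaneseBracket_pos z) (one_add_norm_pos z) (japaneseBracket_le z)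
    (one_add_norm_le z) r

theorem one_add_norm_rpow_le (z : PhaseSpace d) (r : ℝ) :
    (1 + ‖z‖) ^ r ≤ 2 ^ |r| * japaneseBracket z ^ r :=
  rpow_le_two_rpow_mul (one_add_norm_pos z) (japaneseBracket_pos z) (one_add_norm_le z)
    (japaneseBracket_le z) r

/-- Rescaling turns `h`-Shubin symbols into symbols with constants independent of `h`. -/
theorem IsHShubin.exists_isSymbol_rescale {m : ℝ} {a : ℝ → PhaseSpace d → ℂ}
    (ha : IsHShubin m a) :
    ∃ C : ℕ → ℝ, ∀ h ∈ Set.Ioc (0 : ℝ) 1, IsSymbol m C fun w => a h (h⁻¹ • w) := by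
  choose C hC using ha.bound
  refine ⟨fun k => |C k| * 2 ^ |m - k|, fun h hh => ⟨?_, fun k w => ?_⟩⟩
  · exact (ha.smooth h hh).comp (contDiff_const_smul _)
  have hh0 := hh.1
  have h1 := iteratedFDeriv_comp_affine (ha.smooth h hh) 0 h⁻¹ k w
  simp only [zero_add] at h1
  have h2 := hC k h hh (h⁻¹ • w)
  rw [smul_smul, mul_inv_cancel₀ hh0.ne', one_smul] at h2
  rw [h1, norm_smul, norm_pow, norm_inv, Real.norm_of_nonneg hh0.le]
  calc h⁻¹ ^ k * ‖iteratedFDeriv ℝ k (a h) (h⁻¹ • w)‖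
      ≤ h⁻¹ ^ k * (|C k| * h ^ k * (2 ^ |m - k| * (1 + ‖w‖) ^ (m - k))) := by
        refine mul_le_mul_of_nonneg_left (h2.trans ?_) (by positivity)
        exact mul_le_mul (mul_le_mul_of_nonneg_right (le_abs_self _) (by positivity))
          (japaneseBracket_rpow_le w _) (Real.rpow_nonneg (japaneseBracket_pos w).le _)
          (by positivity)
    _ = |C k| * 2 ^ |m - k| * (1 + ‖w‖) ^ (m - k) := by
        rw [inv_pow]
        field_simp

/-- The converse of `IsHShubin.exists_isSymbol_rescale`. -/
theorem isHShubin_of_rescale {m : ℝ} {g : ℝ → PhaseSpace d → ℂ} {C : ℕ → ℝ}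
    (hg : ∀ h ∈ Set.Ioc (0 : ℝ) 1, IsSymbol m C (g h)) : IsHShubin m fun h z => g h (h • z) where
  smooth h hh := (hg h hh).smooth.comp (contDiff_const_smul _)
  bound k := by
    refine ⟨C k * 2 ^ |m - k|, fun h hh z => ?_⟩
    have h1 := iteratedFDeriv_comp_affine (hg h hh).smooth 0 h k z
    simp only [zero_add] at h1
    have hh0 := hh.1
    have hC := (hg h hh).const_nonneg k
    rw [h1, norm_smul, norm_pow, Real.norm_of_nonneg hh0.le]
    calc h ^ k * ‖iteratedFDeriv ℝ k (g h) (h • z)‖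
        ≤ h ^ k * (C k * (2 ^ |m - k| * japaneseBracket (h • z) ^ (m - k))) := by
          refine mul_le_mul_of_nonneg_left (((hg h hh).bound k _).trans ?_) (by positivity)
          exact mul_le_mul_of_nonneg_left (one_add_norm_rpow_le _ _) hC
      _ = _ := by ring

theorem halfDxDxi_eq_crossOp {f : PhaseSpace d → ℂ} (hf : ContDiff ℝ ∞ f) :
    halfDxDxi f = crossOp f := by
  ext z
  have hs : IsSymmSndFDerivAt ℝ f z := (hf.contDiffAt (x := z)).isSymmSndFDerivAt
    (by simp; exact WithTop.coe_le_coe.2 le_top)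
  have hd : DifferentiableAt ℝ (fderiv ℝ f) z :=
    (hf.fderiv_right (m := ∞) (by simp)).differentiable (by simp) z
  have h (a b : PhaseSpace d) : fderiv ℝ (fun y => fderiv ℝ f y a) z b =
      fderiv ℝ (fderiv ℝ f) z b a := by
    rw [(hd.hasFDerivAt.clm_apply (hasFDerivAt_const a z)).fderiv]
    simp
  have h1 (k : Fin d) : dX k (dXi k f) z = -fderiv ℝ (fderiv ℝ f) z
      (EuclideanSpace.single k 1, 0) (0, EuclideanSpace.single k 1) := by
    have h2 : DifferentiableAt ℝ (fun y => fderiv ℝ f y (0, EuclideanSpace.single k 1)) z :=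
      hd.clm_apply (differentiableAt_const _)
    have e : dXi k f = fun y => -I * fderiv ℝ f y (0, EuclideanSpace.single k 1) := rfl
    simp only [dX]
    rw [e, fderiv_const_mul h2, _root_.smul_apply, h, smul_eq_mul, ← mul_assoc, neg_mul_neg,
      I_mul_I, neg_one_mul]
  simp only [halfDxDxi, crossOp, h1, h, Fintype.sum_sum_type, coordDir, dualDir]
  rw [Finset.sum_congr rfl fun k _ => hs (0, EuclideanSpace.single k 1)
    (EuclideanSpace.single k 1, 0), Finset.sum_neg_distrib, smul_eq_mul]
  ring

theorem halfDxDxi_iterate_eq_crossOp {f : PhaseSpace d → ℂ} (hf : ContDiff ℝ ∞ f) (j : ℕ) :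
    halfDxDxi^[j] f = crossOp^[j] f := by
  induction j with
  | zero => rfl
  | succ j ih => rw [Function.iterate_succ_apply', Function.iterate_succ_apply', ih,
      halfDxDxi_eq_crossOp (contDiff_crossOp_iterate hf j)]

theorem IsAmplitude.hasTemperateGrowth {m : ℝ} {C : ℕ → ℝ} {f : PhaseSpace d → ℂ}
    (hf : IsAmplitude m C f) : f.HasTemperateGrowth := by
  obtain ⟨k, hk⟩ := exists_nat_ge m
  refine ⟨hf.smooth, fun n => ⟨k, C n, fun z => (hf.bound n z).trans ?_⟩⟩
  rw [← Real.rpow_natCast]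
  exact mul_le_mul_of_nonneg_left
    (Real.rpow_le_rpow_of_exponent_le (one_le_one_add_norm z) hk) (hf.const_nonneg n)

/-- The remainder of order `N`, divided by `s ^ (2 * N)`, is a symbol of order `m - 2 * N` uniformly
in `s`. -/
theorem exists_isSymbol_oscRemainder (N : ℕ) (m : ℝ) (C : ℕ → ℝ) :
    ∃ B : ℕ → ℝ, ∀ f : PhaseSpace d → ℂ, IsSymbol m C f → ∀ s ∈ Set.Ioc (0 : ℝ) 1,
      IsSymbol (m - 2 * N) B fun w => (((s ^ (2 * N))⁻¹ : ℝ) : ℂ) * oscRemainder N s f w := by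
  choose B hB0 hB using fun k =>
    exists_norm_iteratedFDeriv_oscRemainder_le (d := d) (E := ℂ) k N m C
  refine ⟨B, fun f hf s hs => ?_⟩
  have hs' : s ∈ Set.Icc (0 : ℝ) 1 := ⟨hs.1.le, hs.2⟩
  have hs0 := hs.1
  have hsm : ContDiff ℝ ∞ (oscRemainder N s f) :=
    contDiff_infty.2 fun k => (hB k f hf s hs').1
  refine ⟨contDiff_const.mul hsm, fun k w => ?_⟩
  have h1 : iteratedFDeriv ℝ k (fun w => (((s ^ (2 * N))⁻¹ : ℝ) : ℂ) * oscRemainder N s f w) w =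
      (((s ^ (2 * N))⁻¹ : ℝ) : ℂ) • iteratedFDeriv ℝ k (oscRemainder N s f) w :=
    iteratedFDeriv_const_smul_apply (a := (((s ^ (2 * N))⁻¹ : ℝ) : ℂ))
      ((hB k f hf s hs').1.contDiffAt)
  rw [h1, norm_smul, norm_real, Real.norm_of_nonneg (by positivity)]
  refine (mul_le_mul_of_nonneg_left ((hB k f hf s hs').2 w) (by positivity)).trans_eq ?_
  field_simp

end Semiclassical

end

theorem theoremA5 (d : ℕ) (m : ℝ) (a : ℝ → PhaseSpace d → ℂ) (ha : IsHShubin m a) :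
    ∃ b : ℝ → PhaseSpace d → ℂ,
      (∀ h ∈ Set.Ioc (0 : ℝ) 1, ∃ A : 𝓢(ConfigSpace d, ℂ) → ConfigSpace d → ℂ,
        IsQuantization 1 (a h) A ∧ IsQuantization (1 / 2) (b h) A ∧
        ∃ T : 𝓢'(PhaseSpace d, ℂ), (∀ Φ : 𝓢(PhaseSpace d, ℂ), T Φ = ∫ z, b h z * Φ z) ∧
          ∀ S : 𝓢'(PhaseSpace d, ℂ), IsWeylSymbol S A ↔ S = T) ∧
      IsHShubin m b ∧
      HasHAsymptoticExpansion b (fun j : ℕ => m - 2 * (j : ℝ)) (knWeylTerm a) := by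
  obtain ⟨C, hC⟩ := ha.exists_isSymbol_rescale
  set α : ℝ → PhaseSpace d → ℂ := fun h w => a h (h⁻¹ • w) with hα
  have hαa (h : ℝ) (hh : h ∈ Set.Ioc (0 : ℝ) 1) (z : PhaseSpace d) : α h (h • z) = a h z := by
    simp only [hα]
    rw [smul_smul, inv_mul_cancel₀ hh.1.ne', one_smul]
  have hb (h : ℝ) (hh : h ∈ Set.Ioc (0 : ℝ) 1) (z : PhaseSpace d) :
      oscMean 1 (a h) z = oscMean h (α h) (h • z) := by
    simp only [oscMean, one_smul, ← smul_add, hαa h hh]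
  -- The remainders of order `N` form a family in `h ^ (2 * N) G_h^{m - 2 * N}`.
  have hrem (N : ℕ) : ∃ g : ℝ → PhaseSpace d → ℂ, IsHShubin (m - 2 * N) g ∧
      ∀ h ∈ Set.Ioc (0 : ℝ) 1, ∀ z,
        oscRemainder N h (α h) (h • z) = ((h ^ (2 * (N : ℝ)) : ℝ) : ℂ) * g h z := by
    obtain ⟨B, hB⟩ := exists_isSymbol_oscRemainder (d := d) N m C
    refine ⟨_, isHShubin_of_rescale (g := fun h w =>
      (((h ^ (2 * N))⁻¹ : ℝ) : ℂ) * oscRemainder N h (α h) w)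
      fun h hh => hB _ (hC h hh) h hh, fun h hh z => ?_⟩
    have h0 : h ^ (2 * N) ≠ 0 := pow_ne_zero _ hh.1.ne'
    have h1 : h ^ (2 * (N : ℝ)) = h ^ (2 * N) := by
      rw [← Real.rpow_natCast]
      push_cast
      rfl
    rw [h1, ← mul_assoc, ← ofReal_mul, mul_inv_cancel₀ h0, ofReal_one, one_mul]
  -- The remainder of order zero is the oscillatory mean itself.
  have hbS : IsHShubin m fun h => oscMean 1 (a h) := by
    obtain ⟨g, hg, h1⟩ := hrem 0
    have h2 (h : ℝ) (hh : h ∈ Set.Ioc (0 : ℝ) 1) : oscMean 1 (a h) = g h := by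
      ext z
      have h3 := h1 h hh z
      simpa [oscRemainder, hb h hh] using h3
    simp only [Nat.cast_zero, mul_zero, sub_zero] at hg
    refine ⟨fun h hh => ?_, fun k => ?_⟩
    · simp only [h2 h hh]
      exact hg.smooth h hh
    · obtain ⟨K, hK⟩ := hg.bound k
      refine ⟨K, fun h hh => ?_⟩
      simp only [h2 h hh]
      exact hK h hh
  -- For fixed `h`, an `h`-Shubin symbol is an amplitude.
  have hamp {c : ℝ → PhaseSpace d → ℂ} (hc : IsHShubin m c) (h : ℝ)
      (hh : h ∈ Set.Ioc (0 : ℝ) 1) : ∃ C', IsAmplitude |m| C' (c h) := by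
    obtain ⟨K, hK⟩ := hc.exists_isSymbol_rescale
    have h1 := (hK h hh).isAmplitude.comp_affine (le_refl |h|) 0
    simp only [zero_add, smul_smul, inv_mul_cancel₀ hh.1.ne', one_smul] at h1
    exact ⟨_, h1⟩
  refine ⟨fun h => oscMean 1 (a h), fun h hh => ?_, hbS, ?_⟩
  · obtain ⟨C', hA⟩ := hamp ha h hh
    obtain ⟨C'', hB⟩ := hamp hbS h hh
    set T := hB.hasTemperateGrowth.toTemperedDistribution volume
    have hT (Φ : 𝓢(PhaseSpace d, ℂ)) : T Φ = ∫ z, oscMean 1 (a h) z * Φ z := by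
      refine (Function.HasTemperateGrowth.toTemperedDistribution_apply volume _ Φ).trans ?_
      simp only [smul_eq_mul, mul_comm]
    have hTw : IsWeylSymbol T (knQuantization (a h)) := hA.isWeylSymbol hT
    exact ⟨knQuantization (a h), hA.isQuantization_one, hA.isQuantization_half_oscMean, T, hT,
      fun S => ⟨fun hS => hS.unique hTw, fun hS => hS ▸ hTw⟩⟩
  · refine ⟨?_, fun j => ?_, hbS.smooth, fun N _ => ?_⟩
    · have h1 : Tendsto (fun j : ℕ => 2 * (j : ℝ)) atTop atTop :=
        tendsto_natCast_atTop_atTop.const_mul_atTop two_pos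
      exact tendsto_atBot_add_const_left atTop m (tendsto_neg_atTop_atBot.comp h1)
    · obtain ⟨C', hC'⟩ := IsSymbol.exists_crossOp_iterate (d := d) (E := ℂ) m C j
      have h1 := isHShubin_of_rescale (g := fun h w => ((j ! : ℂ))⁻¹ • (crossOp^[j] (α h)) w)
        fun h hh => (hC' _ (hC h hh)).const_smul ((j ! : ℂ))⁻¹
      have h2 (h : ℝ) (hh : h ∈ Set.Ioc (0 : ℝ) 1) : knWeylTerm a j h =
          fun z => ((j ! : ℂ))⁻¹ • (crossOp^[j] (α h)) (h • z) := by
        ext z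
        rw [knWeylTerm, halfDxDxi_iterate_eq_crossOp (hC h hh).smooth, smul_eq_mul, div_eq_inv_mul]
      refine ⟨fun h hh => ?_, fun k => ?_⟩
      · rw [h2 h hh]
        exact h1.smooth h hh
      · obtain ⟨K, hK⟩ := h1.bound k
        refine ⟨K, fun h hh => ?_⟩
        rw [h2 h hh]
        exact hK h hh
    · simp only [tailMax_sub_two_mul, Nat.cast_zero, mul_zero, sub_zero, sub_sub_cancel]
      obtain ⟨g, hg, h1⟩ := hrem N
      refine ⟨g, hg, fun h hh z => ?_⟩
      rw [← h1 h hh z, oscRemainder, ← hb h hh]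
      refine congrArg (oscMean 1 (a h) z - ·) (Finset.sum_congr rfl fun j _ => ?_)
      have h2 : h ^ (2 * (j : ℝ)) = h ^ (2 * j) := by
        rw [← Real.rpow_natCast]
        push_cast
        rfl
      rw [knWeylTerm, halfDxDxi_iterate_eq_crossOp (hC h hh).smooth, h2, real_smul]
      push_cast
      ring
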